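/- Let $\mathbf{Gpd}$ be the category of (small) groupoids and $\mathbf{Gpd}^{\mathbb{Z}_2}=[\mathbf{B}(\mathbb{Z}_2),\mathbf{Gpd}]$ the category of groupoids with an involution and equivariant functors. Call a morphism of $\mathbf{Gpd}^{\mathbb{Z}_2}$ an injective fibration if it has the right lifting property with respect to all equivariant functors that are equivalences and injective on objects. Let $(\mathbf{Gpd}^{\mathbb{Z}_2})_{\mathbf f}$ be the full subcategory of the objects $X$ for which $X\to\mathbf 1$ is an injective fibration. A type-theoretic fibration category is a category $\mathscr C$ together with a class of fibrations such that: 1. $\mathscr C$ has a terminal object $1$; 2. the fibrations form a subcategory containing all isomorphisms and all morphisms with codomain $1$ (a morphism is called an acyclic cofibration if it has the left lifting property with respect to all fibrations); 3. all pullbacks of fibrations exist and are fibrations; 4. for every fibration $g\colon A\to B$ the pullback functor $g^*\colon\mathscr C/B\to\mathscr C/A$ has a partial right adjoint $\Pi_g$ defined at all fibrations with codomain $A$, its values are fibrations over $B$, and $\Pi_g$ sends every fibration over $A$ between such objects to a fibration; 5. every morphism factors as an acyclic cofibration followed by a fibration. A fibration $p\colon\widetilde U\to U$ in a type-theoretic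 fibration category $\mathscr C$ is a universe if: - (a) the pullbacks of $p$ are closed under composition and contain all identities; - (b) if $f\colon Y\to A$ and $g\colon A\to B$ are pullbacks of $p$, then so is $\Pi_g f\to B$; - (c) if $X\to Z$ and $Y\to Z$ are pullbacks of $p$, then every morphism $f\colon X\to Y$ over $Z$ factors as an acyclic cofibration followed by a pullback of $p$. Let $\kappa$ be an inaccessible cardinal. Let $U$ be the groupoid whose objects are the triples $(A,B,\varphi)$ with $A,B$ $\kappa$-small discrete groupoids (sets, taken, so that $U$ is itself a small groupoid, among the subsets of cardinality $<\kappa$ of a fixed set of cardinality $\kappa$) and $\varphi\colon A\to B$ an isomorphism. The morphisms $(A,B,\varphi)\to(C,D,\psi)$ are the pairs of isomorphisms $(\rho\colon A\to C,\ \tau\colon B\to D)$ with $\psi\circ\rho=\tau\circ\varphi$, composed componentwise. The involution of $U$ is $(A,B,\varphi)\mapsto(B,A,\varphi^{-1})$, $(\rho,\tau)\mapsto(\tau,\rho)$. Let $\widetilde U$ be the groupoid whose objects are the tuples $(A,B,\varphi,a)$ with $(A,B,\varphi)$ an object of $U$ and $a$ an object of $A$, and whose morphisms $(A,B,\varphi,a)\to(C,D,\psi,c)$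 are the morphisms $(\rho,\tau)$ of $U$ with $\rho(a)=c$. The involution of $\widetilde U$ is $(A,B,\varphi,a)\mapsto(B,A,\varphi^{-1},\varphi(a))$, $(\rho,\tau)\mapsto(\tau,\rho)$. Let $p\colon\widetilde U\to U$ be the equivariant projection $(A,B,\varphi,a)\mapsto(A,B,\varphi)$, $(\rho,\tau)\mapsto(\rho,\tau)$. **Theorem.** The category $(\mathbf{Gpd}^{\mathbb{Z}_2})_{\mathbf f}$, with the injective fibrations between its objects as fibrations, is a type-theoretic fibration category; $\widetilde U$ and $U$ are objects of it; and $p\colon\widetilde U\to U$ is a universe in it. -/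

import Mathlib

open CategoryTheory CategoryTheory.Limits

universe u

namespace TTFC

/-! ### Type-theoretic fibration categories and universes in them -/

section General

universe v w

variable {C : Type w} [Category.{v} C]

/-- `DependentProduct f g π` says that `π : P ⟶ B` is (with a suitable evaluation map) the value
`Π_g f` at `f : Y ⟶ A` of the right adjoint of the pullback functor `g* : C/B ⥤ C/A`:
maps `x ⟶ π` in `C/B` correspond to maps `g* x ⟶ f` in `C/A`, naturally in `x : C/B`. -/
abbrev DependentProduct {Y A B P : C} (f : Y ⟶ A) (g : A ⟶ B) [HasPullbacksAlong g]
    (π : P ⟶ B) :=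
  ((Over.pullback g).op ⋙ yoneda.obj (Over.mk f)).RepresentableBy (Over.mk π)

/-- The class `Fib` of morphisms of `C` makes `C` a type-theoretic fibration category.
As usual, a morphism is called an acyclic cofibration if it has the left lifting property with
respect to all fibrations, i.e. if it belongs to `Fib.llp`. -/
structure IsTypeTheoreticFibrationCategory (Fib : MorphismProperty C) : Prop where
  /-- There is a terminal object. -/
  hasTerminal : HasTerminal C
  /-- The fibrations form a (wide) subcategory ... -/
  isMultiplicative : Fib.IsMultiplicative
  /-- ... containing all isomorphisms ... -/
  of_isIso : ∀ ⦃X Y : C⦄ (f : X ⟶ Y), IsIso f → Fib f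
  /-- ... and all morphisms to a terminal object. -/
  of_isTerminal : ∀ ⦃X T : C⦄ (f : X ⟶ T), Nonempty (IsTerminal T) → Fib f
  /-- All pullbacks of fibrations exist ... -/
  hasPullbacksAlong : ∀ ⦃A B : C⦄ (g : A ⟶ B), Fib g → HasPullbacksAlong g
  /-- ... and are fibrations. -/
  isStableUnderBaseChange : Fib.IsStableUnderBaseChange
  /-- The pullback functor along any fibration `g : A ⟶ B` has a partial right adjoint `Π_g`,
  defined at all fibrations over `A`, whose values are fibrations over `B`. -/
  exists_dependentProduct : ∀ ⦃Y A B : C⦄ (f : Y ⟶ A) (g : A ⟶ B) [HasPullbacksAlong g],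
    Fib f → Fib g → ∃ (P : C) (π : P ⟶ B), Fib π ∧ Nonempty (DependentProduct f g π)
  /-- `Π_g` preserves fibrations: if `u` is a fibration over `A` between fibrations `f` and `f'`
  with codomain `A`, and if `v` is the morphism `Π_g u : Π_g f ⟶ Π_g f'` over `B` induced by `u`,
  then `v` is a fibration. -/
  dependentProduct_map : ∀ ⦃Y Y' A B P P' : C⦄ (f : Y ⟶ A) (f' : Y' ⟶ A) (g : A ⟶ B)
    [HasPullbacksAlong g] (π : P ⟶ B) (π' : P' ⟶ B)
    (r : DependentProduct f g π) (r' : DependentProduct f' g π')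
    (u : Over.mk f ⟶ Over.mk f') (v : Over.mk π ⟶ Over.mk π'),
    Fib f → Fib f' → Fib g → Fib u.left →
    r'.homEquiv v = (r.homEquiv (𝟙 (Over.mk π)) : (Over.pullback g).obj (Over.mk π) ⟶ Over.mk f) ≫ u →
    Fib v.left
  /-- Every morphism factors as an acyclic cofibration followed by a fibration. -/
  hasFactorization : ∀ ⦃X Y : C⦄ (f : X ⟶ Y), ∃ (Z : C) (i : X ⟶ Z) (q : Z ⟶ Y),
    Fib.llp i ∧ Fib q ∧ i ≫ q = f

/-- The class of pullbacks of `p`. -/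
def pullbacksOf {E U : C} (p : E ⟶ U) : MorphismProperty C :=
  fun X Y q => ∃ (a : X ⟶ E) (b : Y ⟶ U), IsPullback a q p b

/-- The morphism `p` is a universe with respect to the class `Fib` of fibrations (which is meant
to be a type-theoretic fibration category structure on `C`). -/
structure IsUniverse (Fib : MorphismProperty C) {E U : C} (p : E ⟶ U) : Prop where
  /-- `p` is a fibration. -/
  fib : Fib p
  /-- Pullbacks of `p` contain the identities ... -/
  id_mem : ∀ X : C, pullbacksOf p (𝟙 X)
  /-- ... and are closed under composition. -/
  comp_mem : ∀ ⦃X Y Z : C⦄ (f : X ⟶ Y) (g : Y ⟶ Z),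
    pullbacksOf p f → pullbacksOf p g → pullbacksOf p (f ≫ g)
  /-- If `f : Y ⟶ A` and `g : A ⟶ B` are pullbacks of `p`, then so is `Π_g f ⟶ B`. -/
  dependentProduct_mem : ∀ ⦃Y A B P : C⦄ (f : Y ⟶ A) (g : A ⟶ B) [HasPullbacksAlong g]
    (π : P ⟶ B), pullbacksOf p f → pullbacksOf p g → DependentProduct f g π → pullbacksOf p π
  /-- If `a : X ⟶ Z` and `b : Y ⟶ Z` are pullbacks of `p`, then any `f : X ⟶ Y` over `Z` factors
  as an acyclic cofibration followed by a pullback of `p`. -/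
  factorization : ∀ ⦃X Y Z : C⦄ (a : X ⟶ Z) (b : Y ⟶ Z) (f : X ⟶ Y),
    pullbacksOf p a → pullbacksOf p b → f ≫ b = a →
    ∃ (W : C) (i : X ⟶ W) (q : W ⟶ Y), Fib.llp i ∧ pullbacksOf p q ∧ i ≫ q = f

end General

/-! ### The injective structure on `[B(ℤ/2), Gpd]` -/

/-- Weak equivalences of the canonical model structure on groupoids: equivalences. -/
def grpdWeakEquivalences : MorphismProperty Grpd.{u, u} :=
  fun X Y F => Functor.IsEquivalence (C := X) (D := Y) F

/-- Cofibrations of the canonical model structure on groupoids: injective-on-objects functors. -/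
def grpdCofibrations : MorphismProperty Grpd.{u, u} :=
  fun X Y F => Function.Injective (fun x : X => Functor.obj (C := X) (D := Y) F x)

/-- `B(ℤ/2)`: the one-object category with endomorphism group `ℤ/2`. -/
abbrev BZ2 : Type := SingleObj (Multiplicative (ZMod 2))

/-- The category `Gpd^{ℤ/2}` of functors `B(ℤ/2) ⥤ Gpd`, i.e. of groupoids with involution and
equivariant functors. -/
abbrev GpdZ2 : Type (u + 1) := BZ2 ⥤ Grpd.{u, u}

/-- Injective acyclic cofibrations: morphisms which are objectwise weak equivalences and
objectwise cofibrations. -/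
def injAcyclicCofibrations : MorphismProperty GpdZ2.{u} :=
  grpdWeakEquivalences.{u}.functorCategory BZ2 ⊓ grpdCofibrations.{u}.functorCategory BZ2

/-- Injective fibrations: morphisms with the right lifting property with respect to all injective
acyclic cofibrations. -/
def injFibrations : MorphismProperty GpdZ2.{u} := injAcyclicCofibrations.{u}.rlp

/-- An object is injectively fibrant if its morphism to a terminal object is an injective
fibration. -/
def injFibrant : ObjectProperty GpdZ2.{u} :=
  fun X => ∃ (T : GpdZ2.{u}) (hT : IsTerminal T), injFibrations (hT.from X)

/-- `(Gpd^{ℤ/2})_f`: the full subcategory of injectively fibrant objects. -/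
abbrev GpdZ2f : Type (u + 1) := injFibrant.{u}.FullSubcategory

/-- The fibrations of `(Gpd^{ℤ/2})_f`: injective fibrations between injectively fibrant objects. -/
def fibrations : MorphismProperty GpdZ2f.{u} := injFibrations.{u}.inverseImage injFibrant.{u}.ι

/-! ### Groupoids with an involution as functors on `B(ℤ/2)` -/

lemma eq_of_ne_one : ∀ g h : Multiplicative (ZMod 2), g ≠ 1 → h ≠ 1 → h * g = 1 := by decide

/-- The functor `B(ℤ/2) ⥤ Gpd` given by a groupoid `X` with an involution `α`: the nontrivial
element of `ℤ/2` acts by `α`. -/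
def ofInvolution (X : Grpd.{u, u}) (α : X ⟶ X) (hα : α ≫ α = 𝟙 X) : GpdZ2.{u} where
  obj _ := X
  map {_ _} (g : Multiplicative (ZMod 2)) := if g = 1 then 𝟙 X else α
  map_id _ := if_pos rfl
  map_comp {_ _ _} (g h : Multiplicative (ZMod 2)) := by
    change (if h * g = 1 then 𝟙 X else α) = _
    by_cases hg : g = 1
    · subst hg; simp
    · by_cases hh : h = 1
      · subst hh; simp [hg]
      · simp [hg, hh, eq_of_ne_one g h hg hh, hα]

/-- The morphism in `Gpd^{ℤ/2}` given by an equivariant functor. -/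
def ofEquivariant {X Y : Grpd.{u, u}} {α : X ⟶ X} {hα : α ≫ α = 𝟙 X} {β : Y ⟶ Y}
    {hβ : β ≫ β = 𝟙 Y} (F : X ⟶ Y) (hF : α ≫ F = F ≫ β) :
    ofInvolution X α hα ⟶ ofInvolution Y β hβ where
  app _ := F
  naturality _ _ (g : Multiplicative (ZMod 2)) := by
    change (if g = 1 then 𝟙 X else α) ≫ F = F ≫ (if g = 1 then 𝟙 Y else β)
    by_cases hg : g = 1
    · simp [hg]
    · simp [hg, hF]

/-! ### The projection `p : Ũ ⟶ U` -/

/-- The `κ`-small sets (i.e. `κ`-small discrete groupoids). All sets of cardinality `< κ` form a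
proper class, so, in order for `U` to be a groupoid, they are taken among the subsets of a fixed
set of cardinality `κ`; every set of cardinality `< κ` is in bijection with one of these.
(For `κ` inaccessible, the set `V_κ` of the cumulative hierarchy has cardinality `κ`, and its
elements are exactly its subsets of cardinality `< κ`. So this is `V_κ`, transported along a
bijection from `V_κ` to the chosen set.) -/
def SmallSet (κ : Cardinal.{u}) : Type u := {s : Set κ.out // Cardinal.mk s < κ}

/-- The underlying set of a `κ`-small set. -/
def SmallSet.El {κ : Cardinal.{u}} (s : SmallSet κ) : Type u := ↥s.1

/-- Every set of cardinality `< κ` is in bijection with one of the chosen `κ`-small sets. -/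
lemma SmallSet.exists_equiv {κ : Cardinal.{u}} (X : Type u) (hX : Cardinal.mk X < κ) :
    ∃ s : SmallSet κ, Nonempty (s.El ≃ X) := by
  have h : Cardinal.mk X ≤ Cardinal.mk κ.out := by rw [Cardinal.mk_out]; exact hX.le
  obtain ⟨e⟩ := h
  exact ⟨⟨Set.range e, by rwa [Cardinal.mk_range_eq e e.injective]⟩,
    ⟨(Equiv.ofInjective e e.injective).symm⟩⟩

variable (κ : Cardinal.{u})

/-- Objects of `U`: triples `(A, B, φ)` with `A`, `B` `κ`-small discrete groupoids and
`φ : A ⟶ B` an isomorphism. -/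
structure U : Type u where
  A : SmallSet κ
  B : SmallSet κ
  φ : A.El ≃ B.El

/-- Objects of `Ũ`: tuples `(A, B, φ, a)` with `(A, B, φ)` an object of `U` and `a` in `A`. -/
structure UTilde : Type u extends U κ where
  a : A.El

variable {κ}

/-- Morphisms `(A, B, φ) ⟶ (C, D, ψ)` of `U`: pairs of isomorphisms `ρ : A ⟶ C`, `τ : B ⟶ D`
with `ψ ∘ ρ = τ ∘ φ`. -/
@[ext]
structure U.Hom (X Y : U κ) : Type u where
  ρ : X.A.El ≃ Y.A.El
  τ : X.B.El ≃ Y.B.El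
  comm : ∀ x : X.A.El, Y.φ (ρ x) = τ (X.φ x)

/-- Morphisms `(A, B, φ, a) ⟶ (C, D, ψ, c)` of `Ũ`: morphisms `(ρ, τ)` of `U` with `ρ a = c`. -/
@[ext]
structure UTilde.Hom (X Y : UTilde κ) : Type u extends U.Hom X.toU Y.toU where
  map_a : ρ X.a = Y.a

instance : Groupoid.{u} (U κ) where
  Hom X Y := U.Hom X Y
  id X := ⟨Equiv.refl _, Equiv.refl _, fun _ => rfl⟩
  comp f g := ⟨f.ρ.trans g.ρ, f.τ.trans g.τ, fun x => by simp [f.comm, g.comm]⟩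
  id_comp _ := rfl
  comp_id _ := rfl
  assoc _ _ _ := rfl
  inv f := ⟨f.ρ.symm, f.τ.symm, fun x => by
    rw [Equiv.eq_symm_apply, ← f.comm, Equiv.apply_symm_apply]⟩
  inv_comp f := U.Hom.ext f.ρ.symm_trans_self f.τ.symm_trans_self
  comp_inv f := U.Hom.ext f.ρ.self_trans_symm f.τ.self_trans_symm

instance : Groupoid.{u} (UTilde κ) where
  Hom X Y := UTilde.Hom X Y
  id X := ⟨⟨Equiv.refl _, Equiv.refl _, fun _ => rfl⟩, rfl⟩
  comp f g := ⟨⟨f.ρ.trans g.ρ, f.τ.trans g.τ, fun x => by simp [f.comm, g.comm]⟩, by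
    simp [f.map_a, g.map_a]⟩
  id_comp _ := rfl
  comp_id _ := rfl
  assoc _ _ _ := rfl
  inv f := ⟨⟨f.ρ.symm, f.τ.symm, fun x => by
    rw [Equiv.eq_symm_apply, ← f.comm, Equiv.apply_symm_apply]⟩, by
    rw [Equiv.symm_apply_eq, f.map_a]⟩
  inv_comp f := UTilde.Hom.ext f.ρ.symm_trans_self f.τ.symm_trans_self
  comp_inv f := UTilde.Hom.ext f.ρ.self_trans_symm f.τ.self_trans_symm

variable (κ)

/-- The involution `υ` on `U`: `(A, B, φ) ↦ (B, A, φ⁻¹)`, `(ρ, τ) ↦ (τ, ρ)`. -/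
def υ : U κ ⥤ U κ where
  obj X := ⟨X.B, X.A, X.φ.symm⟩
  map f := ⟨U.Hom.τ f, U.Hom.ρ f, fun x => by
    rw [Equiv.symm_apply_eq, U.Hom.comm f, Equiv.apply_symm_apply]⟩
  map_id _ := rfl
  map_comp _ _ := rfl

/-- The involution on `Ũ`: `(A, B, φ, a) ↦ (B, A, φ⁻¹, φ a)`, `(ρ, τ) ↦ (τ, ρ)`. -/
def υTilde : UTilde κ ⥤ UTilde κ where
  obj X := ⟨⟨X.B, X.A, X.φ.symm⟩, X.φ X.a⟩
  map {X Y} f := ⟨⟨(UTilde.Hom.toHom f).τ, (UTilde.Hom.toHom f).ρ, fun x => by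
    change Y.φ.symm _ = _
    rw [Equiv.symm_apply_eq, (UTilde.Hom.toHom f).comm]
    exact congrArg _ (X.φ.apply_symm_apply x).symm⟩, by
    change (UTilde.Hom.toHom f).τ (X.φ X.a) = Y.φ Y.a
    rw [← (UTilde.Hom.toHom f).comm, UTilde.Hom.map_a f]⟩
  map_id _ := rfl
  map_comp _ _ := rfl

/-- The projection `Ũ ⟶ U` of groupoids: `(A, B, φ, a) ↦ (A, B, φ)`, `(ρ, τ) ↦ (ρ, τ)`. -/
def projFunctor : UTilde κ ⥤ U κ where
  obj X := X.toU
  map f := UTilde.Hom.toHom f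
  map_id _ := rfl
  map_comp _ _ := rfl

lemma υ_involutive : υ κ ⋙ υ κ = 𝟭 (U κ) := rfl

lemma υTilde_involutive : υTilde κ ⋙ υTilde κ = 𝟭 (UTilde κ) := by
  have h : ∀ X : UTilde κ, (υTilde κ ⋙ υTilde κ).obj X = X := by
    rintro ⟨⟨A, B, φ⟩, a⟩
    change (⟨⟨A, B, φ⟩, φ.symm (φ a)⟩ : UTilde κ) = ⟨⟨A, B, φ⟩, a⟩
    rw [Equiv.symm_apply_apply]
  refine Functor.hext h ?_
  rintro ⟨⟨A, B, φ⟩, a⟩ ⟨⟨C, D, ψ⟩, c⟩ ⟨f, hf⟩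
  have key : ∀ (a' : A.El) (c' : C.El) (hf' : f.ρ a' = c'), a' = a → c' = c →
      HEq (⟨f, hf'⟩ : UTilde.Hom ⟨⟨A, B, φ⟩, a'⟩ ⟨⟨C, D, ψ⟩, c'⟩)
        (⟨f, hf⟩ : UTilde.Hom ⟨⟨A, B, φ⟩, a⟩ ⟨⟨C, D, ψ⟩, c⟩) := by
    rintro a' c' hf' rfl rfl
    rfl
  exact key (φ.symm (φ a)) (ψ.symm (ψ c)) _ (φ.symm_apply_apply a) (ψ.symm_apply_apply c)

/-- `U` as an object of `Gpd^{ℤ/2}`. -/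
def UObj : GpdZ2.{u} := ofInvolution (Grpd.of (U κ)) (υ κ) (υ_involutive κ)

/-- `Ũ` as an object of `Gpd^{ℤ/2}`. -/
def UTildeObj : GpdZ2.{u} :=
  ofInvolution (Grpd.of (UTilde κ)) (υTilde κ) (υTilde_involutive κ)

/-- The morphism `p : Ũ ⟶ U` of `Gpd^{ℤ/2}`. -/
def p : UTildeObj κ ⟶ UObj κ :=
  ofEquivariant (X := Grpd.of (UTilde κ)) (Y := Grpd.of (U κ)) (projFunctor κ) rfl

end TTFC

/-! The fibration category structure is largely formal. Let `W` be stable under pullback along maps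
in `W.rlp`, let every map factor as one in `W` followed by one in `W.rlp`, and let dependent
products along maps in `W.rlp` exist. Transposing lifting problems shows that dependent products
preserve `W.rlp`, and everything restricts to the fibrant objects
(`isTypeTheoreticFibrationCategory_fibrantObjects`). The three inputs for groupoids with involution
are `injAcyclicCofibrations_of_isPullback`, `exists_factorization` and `exists_isDependentProduct`.

Injective fibrations come from two sources. A discrete fibration lifts uniquely, so a lift built
from a non-equivariant deformation retraction is still equivariant
(`IsDiscreteFibration.hasAcyclicRLP`). The groupoid `X × X` with the swap is cofree, so maps into it
extend without regard to equivariance. Hence `q` is an injective fibration as soon as `(q, e, e ∘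
σ)` is a discrete fibration for some functor `e` (`hasAcyclicRLP_of_discrete`). This yields the
factorization of `f : X → Y` through the groupoid of pairs `(a : f x₀ → y, t : x₀ → σ x₁)`, which is
discrete over the triples `(y, x₀, x₁)`. It also yields the fibrancy of `U`, which is discrete over
pairs of small sets by `(A, B, φ) ↦ (A, B)`.

For the universe, the pullbacks of `p` between fibrant objects are exactly the discrete fibrations
with `κ`-small fibers. To classify such a map, choose a small set for each fiber; the fibers over
`d` and `σ d` with the bijection between them form an object of `U`. Recording both fibers makes the
classifying map strictly equivariant for arbitrary choices. Regularity of `κ` gives closure under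
composition, and the strong limit property closure under dependent products. By cancellation every
map over `Z` between two such fibrations is again one, so the required factorization is trivial.

Groupoids are encoded by their arrows with a composition relation (`SGroupoid`), so that equalities
of functors and strict fibers are elementwise statements, without transport along equalities of
objects. -/

namespace TTFC

/-! ### Dependent products and the lifting property -/

section Abstract

universe v w

variable {C : Type w} [Category.{v} C]

/-- The objects `X` such that `X ⟶ 1` has the right lifting property with respect to `W`. -/
def fibrantObjects (W : MorphismProperty C) : ObjectProperty C :=
  fun X => ∃ (T : C) (hT : IsTerminal T), W.rlp (hT.from X)

/-- `π : P ⟶ B`, together with the evaluation `ev : Q ⟶ Y` defined on the pullback `Q` of `π`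
along `g`, is the dependent product of `f` along `g`. -/
structure IsDependentProduct {Y A B P Q : C} (f : Y ⟶ A) (g : A ⟶ B) (π : P ⟶ B)
    (q : Q ⟶ P) (q' : Q ⟶ A) (ev : Q ⟶ Y) : Prop where
  isPullback : IsPullback q q' π g
  w : ev ≫ f = q'
  existsUnique : ∀ ⦃T R : C⦄ (t : T ⟶ B) (r : R ⟶ T) (r' : R ⟶ A) (h : R ⟶ Y),
    IsPullback r r' t g → h ≫ f = r' →
    ∃! k : T ⟶ P, k ≫ π = t ∧ ∀ l : R ⟶ Q, l ≫ q = r ≫ k → l ≫ q' = r' → l ≫ ev = h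

/-- Lifts into the pullback `Q` exist and are unique, so the quantified condition on `l` in the
universal property can be tested on one lift. This is the uniqueness half, for two maps with equal
transposes. -/
lemma IsDependentProduct.hom_ext {Y A B P Q : C} {f : Y ⟶ A} {g : A ⟶ B} {π : P ⟶ B}
    {q : Q ⟶ P} {q' : Q ⟶ A} {ev : Q ⟶ Y} (hP : IsDependentProduct f g π q q' ev)
    {T R : C} {t : T ⟶ B} {r : R ⟶ T} {r' : R ⟶ A} (hR : IsPullback r r' t g)
    {k k' : T ⟶ P} (hk : k ≫ π = t) (hk' : k' ≫ π = t)
    (h : ∀ l l' : R ⟶ Q, l ≫ q = r ≫ k → l ≫ q' = r' → l' ≫ q = r ≫ k' → l' ≫ q' = r' →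
      l ≫ ev = l' ≫ ev) : k = k' := by
  have e : ∀ {k : T ⟶ P}, k ≫ π = t → ∃ l : R ⟶ Q, l ≫ q = r ≫ k ∧ l ≫ q' = r' := fun {k} hk =>
    ⟨hP.isPullback.lift (r ≫ k) r' (by rw [Category.assoc, hk, hR.w]), by simp, by simp⟩
  obtain ⟨l, hl, hl'⟩ := e hk
  obtain ⟨m, hm, hm'⟩ := e hk'
  refine (hP.existsUnique t r r' (l ≫ ev) hR (by rw [Category.assoc, hP.w, hl'])).unique
    ⟨hk, fun n hn hn' => ?_⟩ ⟨hk', fun n hn hn' => ?_⟩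
  · exact (h n m hn hn' hm hm').trans (h l m hl hl' hm hm').symm
  · exact (h l n hl hl' hn hn').symm

/-- If `W` is stable under pullback along the maps in `W.rlp`, then dependent products along such
maps preserve `W.rlp`. -/
lemma IsDependentProduct.rlp [HasPullbacks C] {W : MorphismProperty C}
    (hW : ∀ ⦃X' X Y' Y : C⦄ (j : X' ⟶ Y') (a : X' ⟶ X) (b : Y' ⟶ Y) (i : X ⟶ Y),
      IsPullback j a b i → W.rlp b → W i → W j)
    {Y A B P Q Y' P' Q' : C} {f : Y ⟶ A} {g : A ⟶ B} {π : P ⟶ B}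
    {q : Q ⟶ P} {q' : Q ⟶ A} {ev : Q ⟶ Y} (hP : IsDependentProduct f g π q q' ev)
    {f₁ : Y' ⟶ A} {π₁ : P' ⟶ B}
    {q₁ : Q' ⟶ P'} {q₁' : Q' ⟶ A} {ev₁ : Q' ⟶ Y'} (hP' : IsDependentProduct f₁ g π₁ q₁ q₁' ev₁)
    (hg : W.rlp g) {u : Y ⟶ Y'} {v : P ⟶ P'} (hu : u ≫ f₁ = f) (hv : v ≫ π₁ = π)
    (huv : ∀ l : Q ⟶ Q', l ≫ q₁ = q ≫ v → l ≫ q₁' = q' → l ≫ ev₁ = ev ≫ u) (hu' : W.rlp u) :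
    W.rlp v := by
  intro S S' i hi
  refine ⟨fun {a b} sq => ?_⟩
  -- Pulling `i` back along `r'` gives `j`, and the lifting problem of `i` against `v` transposes to
  -- one of `j` against `u`. Since `r'` is a pullback of `g`, it lies in `W.rlp`, so `j` is in `W`.
  have hR' := IsPullback.of_hasPullback (b ≫ π₁) g
  have hR := (IsPullback.of_hasPullback i (pullback.fst (b ≫ π₁) g)).flip
  set r' := pullback.fst (b ≫ π₁) g
  set ra := pullback.snd (b ≫ π₁) g
  set j := pullback.snd i r'
  set r := pullback.fst i r'
  have hj : W j := hW j r r' i hR (by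
    exact MorphismProperty.of_isPullback (P := W.rlp) hR'.flip hg) hi
  have hRR : IsPullback r (j ≫ ra) (i ≫ b ≫ π₁) g := hR.flip.paste_vert hR'
  have haπ : a ≫ π = i ≫ b ≫ π₁ := by rw [← hv, reassoc_of% sq.w]
  let l₁ := hP'.isPullback.lift (r' ≫ b) ra (by rw [Category.assoc, hR'.w])
  have l₁q : l₁ ≫ q₁ = r' ≫ b := by simp [l₁]
  have l₁q' : l₁ ≫ q₁' = ra := by simp [l₁]
  let l := hP.isPullback.lift (r ≫ a) (j ≫ ra) (by rw [Category.assoc, haπ, hRR.w])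
  have lq : l ≫ q = r ≫ a := by simp [l]
  have lq' : l ≫ q' = j ≫ ra := by simp [l]
  let m := hP'.isPullback.lift (q ≫ v) q' (by rw [Category.assoc, hv, hP.isPullback.w])
  have mq : m ≫ q₁ = q ≫ v := by simp [m]
  have mq' : m ≫ q₁' = q' := by simp [m]
  have hm := huv m mq mq'
  have lm : l ≫ m = j ≫ l₁ := hP'.isPullback.hom_ext
    (by rw [Category.assoc, Category.assoc, mq, l₁q, reassoc_of% lq, sq.w, reassoc_of% hR.flip.w])
    (by rw [Category.assoc, Category.assoc, mq', l₁q', lq'])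
  have sq' : CommSq (l ≫ ev) j u (l₁ ≫ ev₁) := ⟨by
    rw [Category.assoc, ← hm, reassoc_of% lm]⟩
  have := hu' j hj
  let h := sq'.lift
  have hjh : j ≫ h = l ≫ ev := sq'.fac_left
  have hhu : h ≫ u = l₁ ≫ ev₁ := sq'.fac_right
  -- The lift of the original square is the transpose `k` of `h`; both triangles are checked after
  -- evaluation.
  obtain ⟨k, ⟨hk, hk'⟩, -⟩ := hP.existsUnique (b ≫ π₁) r' ra h hR' (by
    rw [← hu, reassoc_of% hhu, hP'.w, l₁q'])
  let n := hP.isPullback.lift (r' ≫ k) ra (by rw [Category.assoc, hk, hR'.w])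
  have nq : n ≫ q = r' ≫ k := by simp [n]
  have nq' : n ≫ q' = ra := by simp [n]
  refine ⟨⟨⟨k, ?_, ?_⟩⟩⟩
  · refine hP.hom_ext hRR (by rw [Category.assoc, hk]) haπ fun c c' hc hc' hd hd' => ?_
    have e1 : c = j ≫ n := hP.isPullback.hom_ext
      (by rw [hc, Category.assoc, nq, reassoc_of% hR.flip.w]) (by rw [hc', Category.assoc, nq'])
    have e2 : c' = l := hP.isPullback.hom_ext (by rw [hd, lq]) (by rw [hd', lq'])
    rw [e1, e2, Category.assoc, hk' n nq nq', hjh]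
  · refine hP'.hom_ext hR' (by rw [Category.assoc, hv, hk]) rfl fun c c' hc hc' hd hd' => ?_
    have e1 : c = n ≫ m := hP'.isPullback.hom_ext
      (by rw [hc, Category.assoc, mq, reassoc_of% nq]) (by rw [hc', Category.assoc, mq', nq'])
    have e2 : c' = l₁ := hP'.isPullback.hom_ext (by rw [hd, l₁q]) (by rw [hd', l₁q'])
    rw [e1, e2, Category.assoc, hm, reassoc_of% (hk' n nq nq'), hhu]

/-- Any `f : Y ⟶ A` is a map to the terminal object of the slice over `A`. Knowing the product of
that terminal object reduces the claim that `Π_g f` is a fibration to the claim that `Π_g` preserves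
fibrations. -/
lemma isDependentProduct_id {A B : C} (g : A ⟶ B) :
    IsDependentProduct (𝟙 A) g (𝟙 B) g (𝟙 A) (𝟙 A) where
  isPullback := IsPullback.of_vert_isIso ⟨by simp⟩
  w := by simp
  existsUnique T R t r r' h hR hh := by
    refine ⟨t, ⟨by simp, fun l _ h' => ?_⟩, fun k hk => by simpa using hk.1⟩
    simp_all

end Abstract

/-! ### Fibrant objects form a type-theoretic fibration category -/

section Fibrant

universe v w

variable {C : Type w} [Category.{v} C] {W : MorphismProperty C}

lemma fibrantObjects_of_rlp {X Y : C} {f : X ⟶ Y} (hf : W.rlp f) (hY : fibrantObjects W Y) :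
    fibrantObjects W X := by
  obtain ⟨T, hT, h⟩ := hY
  exact ⟨T, hT, hT.hom_ext (f ≫ hT.from Y) (hT.from X) ▸ W.rlp.comp_mem _ _ hf h⟩

/-- The evaluation map of a dependent product, on the chosen pullback. -/
noncomputable def IsDependentProduct.evaluation
    {Y A B P : (fibrantObjects W).FullSubcategory} {f : Y ⟶ A} {g : A ⟶ B} [HasPullbacksAlong g]
    {π : P ⟶ B} {Q : C} {q : Q ⟶ P.obj} {q' : Q ⟶ A.obj} {ev : Q ⟶ Y.obj}
    (hP : IsDependentProduct f.hom g.hom π.hom q q' ev) :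
    (Over.pullback g).obj (Over.mk π) ⟶ Over.mk f :=
  Over.homMk (ObjectProperty.homMk (hP.isPullback.lift (pullback.fst π g).hom (pullback.snd π g).hom
    (congrArg InducedCategory.Hom.hom (pullback.condition (f := π) (g := g))) ≫ ev)) (by ext; simp [hP.w])

/-- Bridge between the adjunct computed with the chosen pullbacks of the full subcategory and the
choice-free condition in `IsDependentProduct`. -/
lemma IsDependentProduct.map_comp_evaluation_eq_iff
    {Y A B P : (fibrantObjects W).FullSubcategory} {f : Y ⟶ A} {g : A ⟶ B} [HasPullbacksAlong g]
    {π : P ⟶ B} {Q : C} {q : Q ⟶ P.obj} {q' : Q ⟶ A.obj} {ev : Q ⟶ Y.obj}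
    (hP : IsDependentProduct f.hom g.hom π.hom q q' ev)
    {T : Over B} (k : T ⟶ Over.mk π) (h : (Over.pullback g).obj T ⟶ Over.mk f) :
    (Over.pullback g).map k ≫ hP.evaluation = h ↔ (∀ m : (pullback T.hom g).obj ⟶ Q,
      m ≫ q = (pullback.fst T.hom g).hom ≫ k.left.hom → m ≫ q' = (pullback.snd T.hom g).hom →
      m ≫ ev = h.left.hom) := by
  let l := hP.isPullback.lift (pullback.fst π g).hom (pullback.snd π g).hom
    (congrArg InducedCategory.Hom.hom (pullback.condition (f := π) (g := g)))
  have e1 : (((Over.pullback g).map k).left.hom ≫ l) ≫ q =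
      (pullback.fst T.hom g).hom ≫ k.left.hom := by
    rw [Category.assoc, hP.isPullback.lift_fst]
    exact congrArg (·.hom) (show ((Over.pullback g).map k).left ≫ pullback.fst _ _ = _ from
      pullback.lift_fst _ _ _)
  have e2 : (((Over.pullback g).map k).left.hom ≫ l) ≫ q' = (pullback.snd T.hom g).hom := by
    rw [Category.assoc, hP.isPullback.lift_snd]
    exact congrArg (·.hom) (show ((Over.pullback g).map k).left ≫ pullback.snd _ _ = _ from
      pullback.lift_snd _ _ _)
  constructor
  · rintro rfl m h1 h2
    have : m = ((Over.pullback g).map k).left.hom ≫ l :=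
      hP.isPullback.hom_ext (h1.trans e1.symm) (h2.trans e2.symm)
    rw [this]
    simp [evaluation, l]
  · intro H
    ext
    have := H _ e1 e2
    simpa [evaluation, l] using this

variable [HasPullbacks C]

/-- The ambient pullback is a fibration over the fibrant object `T`, hence is itself fibrant. -/
lemma exists_isPullback_fullSubcategory {T A B : (fibrantObjects W).FullSubcategory} (t : T ⟶ B)
    {g : A ⟶ B} (hg : W.rlp g.hom) :
    ∃ (R : (fibrantObjects W).FullSubcategory) (r : R ⟶ T) (r' : R ⟶ A),
      IsPullback r r' t g ∧ IsPullback r.hom r'.hom t.hom g.hom := by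
  have sq := IsPullback.of_hasPullback t.hom g.hom
  have h : W.rlp (pullback.fst t.hom g.hom) :=
    MorphismProperty.of_isPullback (P := W.rlp) sq.flip hg
  refine ⟨⟨_, fibrantObjects_of_rlp h T.property⟩, ObjectProperty.homMk (pullback.fst _ _),
    ObjectProperty.homMk (pullback.snd _ _), ?_, sq⟩
  exact IsPullback.of_map_of_faithful (fibrantObjects W).ι sq

lemma isPullback_hom_iff {T A B R : (fibrantObjects W).FullSubcategory} {t : T ⟶ B}
    {g : A ⟶ B} (hg : W.rlp g.hom) {r : R ⟶ T} {r' : R ⟶ A} :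
    IsPullback r.hom r'.hom t.hom g.hom ↔ IsPullback r r' t g := by
  obtain ⟨S, s, s', h, h'⟩ := exists_isPullback_fullSubcategory t hg
  have : PreservesLimit (cospan t g) (fibrantObjects W).ι :=
    (IsPullback.preservesLimit_cospan_iff h (F := (fibrantObjects W).ι)).2 h'
  exact ⟨fun H => IsPullback.of_map_of_faithful (fibrantObjects W).ι H,
    fun H => H.map (fibrantObjects W).ι⟩

lemma hasPullbacksAlong_of_rlp {A B : (fibrantObjects W).FullSubcategory} (g : A ⟶ B)
    (hg : W.rlp g.hom) : HasPullbacksAlong g := fun t =>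
  let ⟨_, _, _, h, _⟩ := exists_isPullback_fullSubcategory t hg
  h.hasPullback

/-- The universal property of dependent products, in terms of representability. -/
noncomputable def IsDependentProduct.dependentProduct
    {Y A B P : (fibrantObjects W).FullSubcategory} {f : Y ⟶ A} {g : A ⟶ B} [HasPullbacksAlong g]
    (hg : W.rlp g.hom) {π : P ⟶ B} {Q : C} {q : Q ⟶ P.obj} {q' : Q ⟶ A.obj} {ev : Q ⟶ Y.obj}
    (hP : IsDependentProduct f.hom g.hom π.hom q q' ev) : DependentProduct f g π where
  homEquiv {T} := Equiv.ofBijective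
    (fun k : T ⟶ Over.mk π => ((Over.pullback g).map k ≫ hP.evaluation :
      (Over.pullback g).obj T ⟶ Over.mk f)) (by
    have main (h : (Over.pullback g).obj T ⟶ Over.mk f) :
        ∃! k : T ⟶ Over.mk π, (Over.pullback g).map k ≫ hP.evaluation = h := by
      obtain ⟨k, ⟨hk, hk'⟩, hu⟩ := hP.existsUnique T.hom.hom _ _ h.left.hom
        ((isPullback_hom_iff hg).2 (IsPullback.of_hasPullback T.hom g)) (by
          rw [← ObjectProperty.FullSubcategory.comp_hom]
          exact congrArg _ (Over.w h))
      refine ⟨Over.homMk (ObjectProperty.homMk k) (by ext; exact hk), ?_, ?_⟩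
      · exact (hP.map_comp_evaluation_eq_iff _ _).2 hk'
      · intro k₁ h₁
        ext
        exact hu _ ⟨congrArg (·.hom) (Over.w k₁), (hP.map_comp_evaluation_eq_iff _ _).1 h₁⟩
    refine ⟨fun k k' h => (main _).unique h rfl, fun h => ?_⟩
    obtain ⟨k, hk, -⟩ := main h
    exact ⟨k, hk⟩)
  homEquiv_comp k k' := by
    change (Over.pullback g).map (k ≫ k') ≫ hP.evaluation =
      (Over.pullback g).map k ≫ (Over.pullback g).map k' ≫ hP.evaluation
    simp

lemma IsDependentProduct.dependentProduct_homEquiv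
    {Y A B P : (fibrantObjects W).FullSubcategory} {f : Y ⟶ A} {g : A ⟶ B} [HasPullbacksAlong g]
    (hg : W.rlp g.hom) {π : P ⟶ B} {Q : C} {q : Q ⟶ P.obj} {q' : Q ⟶ A.obj} {ev : Q ⟶ Y.obj}
    (hP : IsDependentProduct f.hom g.hom π.hom q q' ev) {T : Over B} (k : T ⟶ Over.mk π) :
    ((hP.dependentProduct hg).homEquiv k : (Over.pullback g).obj T ⟶ Over.mk f) =
      (Over.pullback g).map k ≫ hP.evaluation := rfl

lemma _root_.CategoryTheory.Functor.RepresentableBy.exists_iso {D : Type*} [Category* D]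
    {F : Dᵒᵖ ⥤ Type*} {Y Y' : D} (e : F.RepresentableBy Y) (e' : F.RepresentableBy Y') :
    ∃ i : Y ≅ Y', e'.homEquiv i.hom = e.homEquiv (𝟙 Y) ∧ e.homEquiv i.inv = e'.homEquiv (𝟙 Y') :=
  ⟨{ hom := e'.homEquiv.symm (e.homEquiv (𝟙 Y))
     inv := e.homEquiv.symm (e'.homEquiv (𝟙 Y'))
     hom_inv_id := e.homEquiv.injective (by
      rw [e.homEquiv_comp, Equiv.apply_symm_apply, ← e'.homEquiv_comp, Category.comp_id,
        Equiv.apply_symm_apply])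
     inv_hom_id := e'.homEquiv.injective (by
      rw [e'.homEquiv_comp, Equiv.apply_symm_apply, ← e.homEquiv_comp, Category.comp_id,
        Equiv.apply_symm_apply]) }, Equiv.apply_symm_apply _ _, Equiv.apply_symm_apply _ _⟩

/-- A morphism of dependent products induced by `u` is induced by `u` under any choice of
the dependent products. -/
lemma DependentProduct.exists_iso_conj {D : Type*} [Category* D] {Y Y' A B P P' P₀ P₀' : D}
    {f : Y ⟶ A} {f' : Y' ⟶ A} {g : A ⟶ B}
    [HasPullbacksAlong g] {π : P ⟶ B} {π' : P' ⟶ B} {π₀ : P₀ ⟶ B} {π₀' : P₀' ⟶ B}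
    (r : DependentProduct f g π) (r' : DependentProduct f' g π')
    (s : DependentProduct f g π₀) (s' : DependentProduct f' g π₀')
    (u : Over.mk f ⟶ Over.mk f') (v : Over.mk π ⟶ Over.mk π')
    (h : r'.homEquiv v =
      (r.homEquiv (𝟙 (Over.mk π)) : (Over.pullback g).obj (Over.mk π) ⟶ Over.mk f) ≫ u) :
    ∃ (e : Over.mk π ≅ Over.mk π₀) (e' : Over.mk π' ≅ Over.mk π₀'),
    s'.homEquiv (e.inv ≫ v ≫ e'.hom) =
      (s.homEquiv (𝟙 (Over.mk π₀)) : (Over.pullback g).obj (Over.mk π₀) ⟶ Over.mk f) ≫ u := by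
  obtain ⟨e, h1, h2⟩ := r.exists_iso s
  obtain ⟨e', h3, h4⟩ := r'.exists_iso s'
  refine ⟨e, e', ?_⟩
  rw [s'.homEquiv_comp, s'.homEquiv_comp, h3, ← r'.homEquiv_comp, Category.comp_id, h, ← h2,
    ← Category.comp_id e.inv, r.homEquiv_comp, Category.comp_id]
  exact (Category.assoc ((Over.pullback g).map e.inv) _ _).symm

theorem isTypeTheoreticFibrationCategory_fibrantObjects [HasTerminal C]
    (hW : ∀ ⦃X' X Y' Y : C⦄ (j : X' ⟶ Y') (a : X' ⟶ X) (b : Y' ⟶ Y) (i : X ⟶ Y),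
      IsPullback j a b i → W.rlp b → W i → W j)
    (hfac : ∀ ⦃X Y : C⦄ (f : X ⟶ Y), ∃ (Z : C) (i : X ⟶ Z) (q : Z ⟶ Y), W i ∧ W.rlp q ∧ i ≫ q = f)
    (hprod : ∀ ⦃Y A B : C⦄ (f : Y ⟶ A) (g : A ⟶ B), W.rlp g → ∃ (P Q : C) (π : P ⟶ B) (q : Q ⟶ P)
      (q' : Q ⟶ A) (ev : Q ⟶ Y), IsDependentProduct f g π q q' ev) :
    IsTypeTheoreticFibrationCategory (W.rlp.inverseImage (fibrantObjects W).ι) := by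
  have hrlp ⦃Y A B P Q : C⦄ (f : Y ⟶ A) (g : A ⟶ B) (π : P ⟶ B) (q : Q ⟶ P) (q' : Q ⟶ A)
      (ev : Q ⟶ Y) (hP : IsDependentProduct f g π q q' ev) (hf : W.rlp f) (hg : W.rlp g) :
      W.rlp π :=
    -- Here `f` is regarded as a map from `f` to the identity of `A`; the map it induces on
    -- dependent products is `π`.
    hP.rlp hW (isDependentProduct_id g) hg (u := f) (by simp) (by simp)
      (fun l _ h => by simpa [hP.w] using h) hf
  have hex ⦃Y A B : (fibrantObjects W).FullSubcategory⦄ (f : Y ⟶ A) (g : A ⟶ B)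
      (hf : W.rlp f.hom) (hg : W.rlp g.hom) :
      ∃ (P : (fibrantObjects W).FullSubcategory) (π : P ⟶ B) (Q : C) (q : Q ⟶ P.obj)
        (q' : Q ⟶ A.obj) (ev : Q ⟶ Y.obj), W.rlp π.hom ∧
        IsDependentProduct f.hom g.hom π.hom q q' ev := by
    obtain ⟨P, Q, π, q, q', ev, hP⟩ := hprod f.hom g.hom hg
    have := hrlp _ _ _ _ _ _ hP hf hg
    exact ⟨⟨P, fibrantObjects_of_rlp this B.property⟩, ObjectProperty.homMk π, Q, q, q', ev,
      this, hP⟩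
  have hiso {X Y : (fibrantObjects W).FullSubcategory} (e : X ≅ Y) : W.rlp e.hom.hom :=
    W.rlp.of_isIso ((fibrantObjects W).ι.mapIso e).hom
  constructor
  · have hT : fibrantObjects W (⊤_ C) := by
      refine ⟨_, terminalIsTerminal, ?_⟩
      rw [terminalIsTerminal.hom_ext (terminalIsTerminal.from (⊤_ C)) (𝟙 _)]
      exact W.rlp.id_mem _
    refine (show IsTerminal (⟨⊤_ C, hT⟩ : (fibrantObjects W).FullSubcategory) from
      IsTerminal.ofUniqueHom (fun X => ObjectProperty.homMk (terminal.from X.obj))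
        fun X m => by ext).hasTerminal
  · infer_instance
  · intro X Y f hf
    exact W.rlp.of_isIso ((fibrantObjects W).ι.map f)
  · rintro X T f ⟨hT⟩
    obtain ⟨T', hT', hX⟩ := X.property
    -- Fibrancy refers to a terminal object `T'` of the ambient category, while `T` is only terminal
    -- among fibrant objects. As `T'` is fibrant, the two are isomorphic.
    have hT₁ : fibrantObjects W T' := by
      refine ⟨T', hT', ?_⟩
      rw [hT'.hom_ext (hT'.from T') (𝟙 _)]
      exact W.rlp.id_mem _
    let e : T ⟶ ⟨T', hT₁⟩ := ObjectProperty.homMk (hT'.from T.obj)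
    let e' : (⟨T', hT₁⟩ : (fibrantObjects W).FullSubcategory) ⟶ T := hT.from _
    have : IsIso e' := ⟨e, by ext; exact hT'.hom_ext _ _, hT.hom_ext _ _⟩
    have h : f = ObjectProperty.homMk (hT'.from X.obj) ≫ e' := hT.hom_ext _ _
    rw [h]
    exact W.rlp.comp_mem _ _ hX (W.rlp.of_isIso ((fibrantObjects W).ι.map e'))
  · exact fun A B g hg => hasPullbacksAlong_of_rlp g hg
  · refine ⟨fun {X Y Y' S f g f' g'} sq hg => ?_⟩
    have hg : W.rlp g.hom := hg
    exact MorphismProperty.of_isPullback (P := W.rlp) ((isPullback_hom_iff hg).2 sq.flip).flip hg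
  · intro Y A B f g _ hf hg
    have hg : W.rlp g.hom := hg
    obtain ⟨P, π, Q, q, q', ev, hπ, hP⟩ := hex f g hf hg
    exact ⟨P, π, hπ, ⟨hP.dependentProduct hg⟩⟩
  · intro Y Y' A B P P' f f' g _ π π' r r' u v hf hf' hg hu huv
    have hg : W.rlp g.hom := hg
    obtain ⟨P₀, π₀, Q, q, q', ev, hπ, hP⟩ := hex f g hf hg
    obtain ⟨P₀', π₀', Q', q₁, q₁', ev', hπ', hP'⟩ := hex f' g hf' hg
    let s := hP.dependentProduct hg
    let s' := hP'.dependentProduct hg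
    obtain ⟨e, e', key⟩ := DependentProduct.exists_iso_conj r r' s s' u v huv
    -- Conjugation by the comparison isomorphisms replaces the given dependent products by the
    -- constructed ones, to which `IsDependentProduct.rlp` applies.
    have hv : v = e.hom ≫ (e.inv ≫ v ≫ e'.hom) ≫ e'.inv := by simp
    set v₀ := e.inv ≫ v ≫ e'.hom
    suffices W.rlp v₀.left.hom by
      rw [hv, Over.comp_left, Over.comp_left]
      exact W.rlp.comp_mem _ _ (hiso ((Over.forget _).mapIso e))
        (W.rlp.comp_mem _ _ this (hiso ((Over.forget _).mapIso e'.symm)))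
    rw [hP'.dependentProduct_homEquiv hg, hP.dependentProduct_homEquiv hg,
      hP'.map_comp_evaluation_eq_iff] at key
    refine hP.rlp hW hP' hg (u := u.left.hom) (congrArg (·.hom) (Over.w u))
      (congrArg (·.hom) (Over.w v₀)) (fun l hl hl' => ?_) hu
    have sq := (isPullback_hom_iff hg).2 (IsPullback.of_hasPullback π g)
    let c := hP.isPullback.isoIsPullback _ _ ((isPullback_hom_iff hg).2
      (IsPullback.of_hasPullback π₀ g))
    have := key (c.inv ≫ l) (by simp [hl, c]) (by simp [hl', c])
    rw [← cancel_epi c.inv]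
    rw [← Category.assoc, this]
    have hc : hP.evaluation.left.hom = c.inv ≫ ev := by
      change _ ≫ _ = _
      congr 1
    simp [hc]
  · intro X Y f
    obtain ⟨Z, i, q, hi, hq, hf⟩ := hfac f.hom
    refine ⟨⟨Z, fibrantObjects_of_rlp hq Y.property⟩, ObjectProperty.homMk i,
      ObjectProperty.homMk q, ?_, hq, by ext; exact hf⟩
    -- A map in `W` lifts against `g` in the ambient category, and fullness of the subcategory makes
    -- this lift a morphism of fibrant objects.
    intro A B g hg
    refine ⟨fun {a b} sq => ?_⟩
    have : HasLiftingProperty i g.hom := hg i hi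
    have sq' : CommSq a.hom i g.hom b.hom := ⟨congrArg (·.hom) sq.w⟩
    exact ⟨⟨⟨ObjectProperty.homMk sq'.lift, by ext; exact sq'.fac_left,
      by ext; exact sq'.fac_right⟩⟩⟩

/-- The class `D` is an intrinsic description of the pullbacks of `p`: stability under base change
gives one inclusion and `hclass` the other. Each universe axiom thus becomes a closure property of
`D`. -/
theorem isUniverse_fibrantObjects {E U : C} {p : E ⟶ U} (hE : fibrantObjects W E)
    (hU : fibrantObjects W U) (D : MorphismProperty C) [D.IsMultiplicative]
    [D.IsStableUnderBaseChange] (hD : D ≤ W.rlp) (hp : D p)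
    (hclass : ∀ ⦃X Y : C⦄ (q : X ⟶ Y), D q → ∃ (a : X ⟶ E) (b : Y ⟶ U), IsPullback a q p b)
    (hcancel : ∀ ⦃X Y Z : C⦄ (f : X ⟶ Y) (g : Y ⟶ Z), D g → D (f ≫ g) → D f)
    (hprod : ∀ ⦃Y A B : C⦄ (f : Y ⟶ A) (g : A ⟶ B), D f → D g → ∃ (P Q : C) (π : P ⟶ B)
      (q : Q ⟶ P) (q' : Q ⟶ A) (ev : Q ⟶ Y), D π ∧ IsDependentProduct f g π q q' ev) :
    IsUniverse (W.rlp.inverseImage (fibrantObjects W).ι)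
      (ObjectProperty.homMk p : (⟨E, hE⟩ : (fibrantObjects W).FullSubcategory) ⟶ ⟨U, hU⟩) := by
  have hiff {X Y : (fibrantObjects W).FullSubcategory} (q : X ⟶ Y) :
      pullbacksOf (ObjectProperty.homMk p :
        (⟨E, hE⟩ : (fibrantObjects W).FullSubcategory) ⟶ ⟨U, hU⟩) q ↔ D q.hom := by
    constructor
    · rintro ⟨a, b, sq⟩
      have hp' : W.rlp (ObjectProperty.homMk p :
        (⟨E, hE⟩ : (fibrantObjects W).FullSubcategory) ⟶ ⟨U, hU⟩).hom := hD _ hp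
      exact MorphismProperty.of_isPullback (P := D) ((isPullback_hom_iff hp').2 sq.flip).flip hp
    · intro hq
      obtain ⟨a, b, sq⟩ := hclass _ hq
      exact ⟨ObjectProperty.homMk a, ObjectProperty.homMk b,
        IsPullback.of_map_of_faithful (fibrantObjects W).ι sq⟩
  constructor
  · exact hD _ hp
  · exact fun X => (hiff _).2 (D.id_mem _)
  · intro X Y Z f g hf hg
    rw [hiff] at hf hg ⊢
    exact D.comp_mem _ _ hf hg
  · intro Y A B P f g _ π hf hg r
    rw [hiff] at hf hg ⊢
    obtain ⟨P', Q, π', q, q', ev, hπ, hP⟩ := hprod f.hom g.hom hf hg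
    let π₀ : (⟨P', fibrantObjects_of_rlp (hD _ hπ) B.property⟩ :
      (fibrantObjects W).FullSubcategory) ⟶ B := ObjectProperty.homMk π'
    obtain ⟨e, -⟩ := r.exists_iso (IsDependentProduct.dependentProduct (π := π₀) (hD _ hg) hP)
    let e' := (fibrantObjects W).ι.mapIso ((Over.forget _).mapIso e)
    have h : e'.hom ≫ π' = π.hom := congrArg (·.hom) (Over.w e.hom)
    rw [← h]
    exact D.comp_mem _ _ (D.of_isIso e'.hom) hπ
  · intro X Y Z a b f ha hb hf
    rw [hiff] at ha hb
    -- By cancellation `f` is itself in `D`, so the identity followed by `f` is the required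
    -- factorization.
    refine ⟨X, 𝟙 X, f, ?_, (hiff _).2 (hcancel _ _ hb ?_), by simp⟩
    · exact MorphismProperty.llp_of_isIso _ _
    · rw [← hf] at ha
      exact ha

end Fibrant

/-! ### Groupoids described by their arrows -/

/-- A groupoid, described by the set of its arrows and the relation `Comp x y z`, saying that
`z` is the composition of `x` followed by `y`. Objects are identified with identity arrows. -/
class SGroupoid (M : Type*) where
  Comp : M → M → M → Prop
  comp_unique {x y z z' : M} : Comp x y z → Comp x y z' → z = z'
  left_cancel {x y y' z : M} : Comp x y z → Comp x y' z → y = y'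
  right_cancel {x x' y z : M} : Comp x y z → Comp x' y z → x = x'
  exists_src (x : M) : ∃ d, Comp d d d ∧ Comp d x x
  exists_tgt (x : M) : ∃ c, Comp c c c ∧ Comp x c x
  exists_comp {x c y : M} : Comp x c x → Comp c y y → ∃ z, Comp x y z
  exists_mid {x y z : M} : Comp x y z → ∃ c, Comp x c x ∧ Comp c y y
  assoc {x y z a b c : M} : Comp x y a → Comp y z b → Comp a z c → Comp x b c
  assoc' {x y z a b c : M} : Comp x y a → Comp y z b → Comp x b c → Comp a z c
  exists_inv (x : M) : ∃ y d, Comp x y d ∧ Comp d x x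

namespace SGroupoid

section API

variable {M : Type*} [SGroupoid M]

/-- The source of an arrow (as an identity arrow). -/
noncomputable def src (x : M) : M := (exists_src x).choose

/-- The target of an arrow (as an identity arrow). -/
noncomputable def tgt (x : M) : M := (exists_tgt x).choose

/-- The inverse of an arrow. -/
noncomputable def inv (x : M) : M := (exists_inv x).choose

open Classical in
/-- The composition of two arrows (with a junk value if they are not composable). -/
noncomputable def mul (x y : M) : M := if h : ∃ z, Comp x y z then h.choose else x

scoped infixl:70 " ⊙ " => mul

lemma comp_src (x : M) : Comp (src x) x x := (exists_src x).choose_spec.2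

lemma comp_tgt (x : M) : Comp x (tgt x) x := (exists_tgt x).choose_spec.2

lemma eq_src {d x : M} (h : Comp d x x) : d = src x := right_cancel h (comp_src x)

lemma eq_tgt {c x : M} (h : Comp x c x) : c = tgt x := left_cancel h (comp_tgt x)

lemma comp_src_src (x : M) : Comp (src x) (src x) (src x) := (exists_src x).choose_spec.1

lemma comp_tgt_tgt (x : M) : Comp (tgt x) (tgt x) (tgt x) := (exists_tgt x).choose_spec.1

@[simp, grind =] lemma src_src (x : M) : src (src x) = src x := (eq_src (comp_src_src x)).symm

@[simp, grind =] lemma tgt_src (x : M) : tgt (src x) = src x := (eq_tgt (comp_src_src x)).symm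

@[simp, grind =] lemma src_tgt (x : M) : src (tgt x) = tgt x := (eq_src (comp_tgt_tgt x)).symm

@[simp, grind =] lemma tgt_tgt (x : M) : tgt (tgt x) = tgt x := (eq_tgt (comp_tgt_tgt x)).symm

lemma tgt_eq_src {x y z : M} (h : Comp x y z) : tgt x = src y := by
  obtain ⟨c, h1, h2⟩ := exists_mid h
  rw [← eq_tgt h1, ← eq_src h2]

lemma comp_mul {x y : M} (h : tgt x = src y) : Comp x y (x ⊙ y) := by
  have : ∃ z, Comp x y z := exists_comp (comp_tgt x) (h ▸ comp_src y)
  rw [mul, dif_pos this]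
  exact this.choose_spec

lemma comp_iff {x y z : M} : Comp x y z ↔ tgt x = src y ∧ x ⊙ y = z :=
  ⟨fun h => ⟨tgt_eq_src h, comp_unique (comp_mul (tgt_eq_src h)) h⟩,
    fun ⟨h, h'⟩ => h' ▸ comp_mul h⟩

@[simp, grind =] lemma src_mul_self (x : M) : src x ⊙ x = x := (comp_iff.1 (comp_src x)).2

@[simp, grind =] lemma mul_tgt_self (x : M) : x ⊙ tgt x = x := (comp_iff.1 (comp_tgt x)).2

@[grind =] lemma src_mul {x y : M} (h : tgt x = src y) : src (x ⊙ y) = src x :=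
  (eq_src (assoc (comp_src x) (comp_mul h) (comp_mul h))).symm

@[grind =] lemma tgt_mul {x y : M} (h : tgt x = src y) : tgt (x ⊙ y) = tgt y :=
  (eq_tgt (assoc' (comp_mul h) (comp_tgt y) (comp_mul h))).symm

@[grind =] lemma mul_assoc {x y z : M} (h : tgt x = src y) (h' : tgt y = src z) :
    x ⊙ y ⊙ z = x ⊙ (y ⊙ z) :=
  ((comp_iff.1 (assoc (comp_mul h) (comp_mul h') (comp_mul (by rw [tgt_mul h, h'])))).2).symm

lemma comp_inv (x : M) : Comp x (inv x) (src x) := by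
  obtain ⟨d, h, h'⟩ := (exists_inv x).choose_spec
  rwa [← eq_src h']

@[simp, grind =] lemma src_inv (x : M) : src (inv x) = tgt x := (tgt_eq_src (comp_inv x)).symm

@[simp, grind =] lemma mul_inv (x : M) : x ⊙ inv x = src x := (comp_iff.1 (comp_inv x)).2

@[simp, grind =] lemma tgt_inv (x : M) : tgt (inv x) = src x := by
  rw [← tgt_mul (src_inv x).symm, mul_inv, tgt_src]

@[simp, grind =] lemma inv_mul (x : M) : inv x ⊙ x = tgt x := by
  have h : Comp x (inv x ⊙ x) x := comp_iff.2 ⟨by simp [src_mul], by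
    rw [← mul_assoc (by simp) (by simp), mul_inv, src_mul_self]⟩
  exact eq_tgt h

lemma mul_left_cancel {x y z : M} (hy : tgt x = src y) (hz : tgt x = src z)
    (h : x ⊙ y = x ⊙ z) : y = z :=
  left_cancel (comp_mul hy) (h ▸ comp_mul hz)

lemma eq_inv_of_mul {x y : M} (h : tgt x = src y) (h' : x ⊙ y = src x) : y = inv x :=
  mul_left_cancel h (by simp) (by rw [h', mul_inv])

@[simp, grind =] lemma inv_inv (x : M) : inv (inv x) = x :=
  (eq_inv_of_mul (by simp) (by simp)).symm

@[grind =] lemma inv_mul_cancel_left {x y : M} (h : tgt x = src y) :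
    inv x ⊙ (x ⊙ y) = y := by
  rw [← mul_assoc (by simp) h, inv_mul, h, src_mul_self]

@[grind =] lemma mul_inv_cancel_left {x y : M} (h : src x = src y) :
    x ⊙ (inv x ⊙ y) = y := by
  rw [← mul_assoc (by simp) (by simpa), mul_inv, h, src_mul_self]

@[grind =] lemma inv_mul_rev {x y : M} (h : tgt x = src y) : inv (x ⊙ y) = inv y ⊙ inv x :=
  (eq_inv_of_mul (by simp [src_mul, tgt_mul, h]) (by
    rw [mul_assoc h (by simp [src_mul, h]), mul_inv_cancel_left (by simp [h]), mul_inv,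
      src_mul h])).symm

lemma src_conj {p x q : M} (h : tgt p = src x) (h' : tgt q = tgt x) :
    src (p ⊙ x ⊙ inv q) = src p := by
  grind

lemma tgt_conj {p x q : M} (h : tgt p = src x) (h' : tgt q = tgt x) :
    tgt (p ⊙ x ⊙ inv q) = src q := by
  grind

lemma conj_mul {p x q y z : M} (h : tgt p = src x) (h' : tgt q = tgt x) (hxy : tgt x = src y)
    (h'' : tgt z = tgt y) :
    (p ⊙ x ⊙ inv q) ⊙ (q ⊙ y ⊙ inv z) = p ⊙ (x ⊙ y) ⊙ inv z := by
  grind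

lemma src_conj' {p x q : M} (h : src p = src x) (h' : tgt x = src q) :
    src (inv p ⊙ x ⊙ q) = tgt p := by
  grind

lemma tgt_conj' {p x q : M} (h : src p = src x) (h' : tgt x = src q) :
    tgt (inv p ⊙ x ⊙ q) = tgt q := by
  grind

lemma conj_mul' {p x q y z : M} (h : src p = src x) (h' : tgt x = src q) (hxy : tgt x = src y)
    (h'' : tgt y = src z) :
    (inv p ⊙ x ⊙ q) ⊙ (inv q ⊙ y ⊙ z) = inv p ⊙ (x ⊙ y) ⊙ z := by
  grind

lemma conj_conj {p x q : M} (h : tgt p = src x) (h' : tgt q = tgt x) :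
    inv p ⊙ (p ⊙ x ⊙ inv q) ⊙ q = x := by
  grind

lemma inv_conj' {p x q : M} (h : src p = src x) (h' : tgt x = src q) :
    inv (inv p ⊙ x ⊙ q) = inv q ⊙ (inv x ⊙ p) := by
  rw [inv_mul_rev (by rw [tgt_mul (by simpa), h']), inv_mul_rev (by simpa), inv_inv]

@[simp, grind =] lemma inv_src (x : M) : inv (src x) = src x :=
  (eq_inv_of_mul (by simp) (by simpa using src_mul_self (src x))).symm

@[simp, grind =] lemma inv_tgt (x : M) : inv (tgt x) = tgt x := by
  rw [← src_tgt, inv_src]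

end API

/-- Functors, as maps of sets of arrows. -/
structure IsFunctor {M N : Type*} [SGroupoid M] [SGroupoid N] (F : M → N) : Prop where
  comp {x y z : M} : Comp x y z → Comp (F x) (F y) (F z)

namespace IsFunctor

variable {M N : Type*} [SGroupoid M] [SGroupoid N] {F : M → N} (hF : IsFunctor F)
include hF

lemma map_src (x : M) : F (src x) = src (F x) := eq_src (hF.comp (comp_src x))

lemma map_tgt (x : M) : F (tgt x) = tgt (F x) := eq_tgt (hF.comp (comp_tgt x))

lemma tgt_eq_src {x y : M} (h : tgt x = src y) : tgt (F x) = src (F y) := by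
  rw [← hF.map_tgt, h, hF.map_src]

lemma map_mul {x y : M} (h : tgt x = src y) : F (x ⊙ y) = F x ⊙ F y :=
  (comp_iff.1 (hF.comp (comp_mul h))).2.symm

lemma map_inv (x : M) : F (inv x) = inv (F x) :=
  eq_inv_of_mul (hF.tgt_eq_src (by simp))
    (by rw [← hF.map_mul (by simp), mul_inv, hF.map_src])

/-- A functor which is bijective on arrows reflects compositions. -/
lemma comp_of_injective (h : Function.Injective F) {x y z : M} (H : Comp (F x) (F y) (F z)) :
    Comp x y z := by
  have hxy : tgt x = src y := h (by rw [hF.map_tgt, hF.map_src, SGroupoid.tgt_eq_src H])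
  refine comp_iff.2 ⟨hxy, h ?_⟩
  rw [hF.map_mul hxy, (comp_iff.1 H).2]

end IsFunctor

lemma IsFunctor.of_mul {M N : Type*} [SGroupoid M] [SGroupoid N] {F : M → N}
    (h : ∀ x y : M, tgt x = src y → tgt (F x) = src (F y) ∧ F (x ⊙ y) = F x ⊙ F y) :
    IsFunctor F :=
  ⟨fun {x y z} H => by
    obtain ⟨h1, rfl⟩ := comp_iff.1 H
    exact comp_iff.2 ⟨(h x y h1).1, (h x y h1).2.symm⟩⟩

lemma IsFunctor.comp' {M N K : Type*} [SGroupoid M] [SGroupoid N] [SGroupoid K] {F : M → N}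
    {G : N → K} (hG : IsFunctor G) (hF : IsFunctor F) : IsFunctor (fun x => G (F x)) :=
  ⟨fun h => hG.comp (hF.comp h)⟩

instance (M N : Type*) [SGroupoid M] [SGroupoid N] : SGroupoid (M × N) where
  Comp x y z := Comp x.1 y.1 z.1 ∧ Comp x.2 y.2 z.2
  comp_unique h h' := Prod.ext (comp_unique h.1 h'.1) (comp_unique h.2 h'.2)
  left_cancel h h' := Prod.ext (left_cancel h.1 h'.1) (left_cancel h.2 h'.2)
  right_cancel h h' := Prod.ext (right_cancel h.1 h'.1) (right_cancel h.2 h'.2)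
  exists_src x := ⟨(src x.1, src x.2), ⟨comp_src_src _, comp_src_src _⟩, comp_src _, comp_src _⟩
  exists_tgt x := ⟨(tgt x.1, tgt x.2), ⟨comp_tgt_tgt _, comp_tgt_tgt _⟩, comp_tgt _, comp_tgt _⟩
  exists_comp h h' := by
    obtain ⟨a, ha⟩ := exists_comp h.1 h'.1
    obtain ⟨b, hb⟩ := exists_comp h.2 h'.2
    exact ⟨(a, b), ha, hb⟩
  exists_mid h := by
    obtain ⟨a, ha⟩ := exists_mid h.1
    obtain ⟨b, hb⟩ := exists_mid h.2
    exact ⟨(a, b), ⟨ha.1, hb.1⟩, ha.2, hb.2⟩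
  assoc h h' h'' := ⟨assoc h.1 h'.1 h''.1, assoc h.2 h'.2 h''.2⟩
  assoc' h h' h'' := ⟨assoc' h.1 h'.1 h''.1, assoc' h.2 h'.2 h''.2⟩
  exists_inv x := ⟨(inv x.1, inv x.2), (src x.1, src x.2), ⟨comp_inv _, comp_inv _⟩,
    comp_src _, comp_src _⟩

lemma isFunctor_fst (M N : Type*) [SGroupoid M] [SGroupoid N] :
    IsFunctor (Prod.fst : M × N → M) := ⟨fun h => h.1⟩

lemma isFunctor_snd (M N : Type*) [SGroupoid M] [SGroupoid N] :
    IsFunctor (Prod.snd : M × N → N) := ⟨fun h => h.2⟩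

lemma src_prod {M N : Type*} [SGroupoid M] [SGroupoid N] (x : M × N) :
    src x = (src x.1, src x.2) :=
  Prod.ext ((isFunctor_fst M N).map_src x) ((isFunctor_snd M N).map_src x)

end SGroupoid

open SGroupoid

/-- A groupoid with an involution. -/
class InvGroupoid (M : Type*) extends SGroupoid M where
  σ : M → M
  σ_σ (x : M) : σ (σ x) = x
  comp_σ {x y z : M} : Comp x y z → Comp (σ x) (σ y) (σ z)

namespace InvGroupoid

attribute [simp, grind =] σ_σ

lemma isFunctor_σ (M : Type*) [InvGroupoid M] : IsFunctor (σ : M → M) := ⟨comp_σ⟩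

@[grind =] lemma σ_src {M : Type*} [InvGroupoid M] (x : M) : σ (src x) = src (σ x) :=
  (isFunctor_σ M).map_src x

@[grind =] lemma σ_tgt {M : Type*} [InvGroupoid M] (x : M) : σ (tgt x) = tgt (σ x) :=
  (isFunctor_σ M).map_tgt x

@[grind =] lemma σ_inv {M : Type*} [InvGroupoid M] (x : M) : σ (inv x) = inv (σ x) :=
  (isFunctor_σ M).map_inv x

@[grind =] lemma σ_mul {M : Type*} [InvGroupoid M] {x y : M} (h : tgt x = src y) :
    σ (x ⊙ y) = σ x ⊙ σ y :=
  (isFunctor_σ M).map_mul h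

/-- Equivariant functors. -/
structure IsEquivariant {M N : Type*} [InvGroupoid M] [InvGroupoid N] (F : M → N) : Prop
    extends IsFunctor F where
  map_σ (x : M) : F (σ x) = σ (F x)

/-- The product of a groupoid with involution `Y` and of the groupoid `X × X` with the involution
exchanging the factors. -/
instance (Y X : Type*) [InvGroupoid Y] [SGroupoid X] : InvGroupoid (Y × X × X) where
  σ x := (σ x.1, x.2.2, x.2.1)
  σ_σ x := by simp
  comp_σ h := ⟨comp_σ h.1, h.2.2, h.2.1⟩

end InvGroupoid

open InvGroupoid

/-! ### Acyclic cofibrations, discrete fibrations and the lifting property -/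

/-- Equivalences which are injective on objects: full subgroupoids meeting each isomorphism
class. -/
structure IsAcyclicCofibration {M N : Type*} [SGroupoid M] [SGroupoid N] (i : M → N) : Prop
    extends IsFunctor i where
  injective : Function.Injective i
  full (n : N) : src n ∈ Set.range i → tgt n ∈ Set.range i → n ∈ Set.range i
  essSurj (n : N) : ∃ k, src k ∈ Set.range i ∧ tgt k = src n

/-- Functors with the lifting property for isomorphisms. -/
def IsIsofibration {M N : Type*} [SGroupoid M] [SGroupoid N] (q : M → N) : Prop :=
  ∀ (x : M) (n : N), src x = x → src n = q x → ∃ m, src m = x ∧ q m = n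

/-- Functors with the unique lifting property for isomorphisms. -/
def IsDiscreteFibration {M N : Type*} [SGroupoid M] [SGroupoid N] (q : M → N) : Prop :=
  ∀ (x : M) (n : N), src x = x → src n = q x → ∃! m, src m = x ∧ q m = n

lemma IsDiscreteFibration.isIsofibration {M N : Type*} [SGroupoid M] [SGroupoid N] {q : M → N}
    (hq : IsDiscreteFibration q) : IsIsofibration q :=
  fun x n hx hn => (hq x n hx hn).exists

lemma IsDiscreteFibration.ext {M N : Type*} [SGroupoid M] [SGroupoid N] {q : M → N}
    (hq : IsDiscreteFibration q) (hq' : IsFunctor q) {m m' : M} (h : src m = src m')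
    (h' : q m = q m') : m = m' :=
  (hq (src m') (q m') (by simp) (hq'.map_src _).symm).unique ⟨h, h'⟩ ⟨rfl, rfl⟩

/-- The right lifting property with respect to the equivariant acyclic cofibrations. -/
def HasAcyclicRLP {X Y : Type u} [InvGroupoid X] [InvGroupoid Y] (q : X → Y) : Prop :=
  ∀ ⦃A B : Type u⦄ [InvGroupoid A] [InvGroupoid B] (i : A → B) (a : A → X) (b : B → Y),
    IsEquivariant i → IsAcyclicCofibration i → IsEquivariant a → IsEquivariant b →
    (∀ x, q (a x) = b (i x)) →
    ∃ l : B → X, IsEquivariant l ∧ (∀ x, l (i x) = a x) ∧ ∀ y, q (l y) = b y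

/-- An acyclic cofibration is the inclusion of a strong deformation retract. -/
lemma IsAcyclicCofibration.exists_retraction {A B : Type*} [SGroupoid A] [SGroupoid B] {i : A → B}
    (hi : IsAcyclicCofibration i) : ∃ (r : B → A) (θ : B → B), IsFunctor r ∧ (∀ x, r (i x) = x) ∧
      (∀ y, θ (src y) = θ y) ∧ (∀ y, src (θ y) = i (src (r y))) ∧ (∀ y, tgt (θ y) = src y) ∧
      (∀ x, θ (i x) = src (i x)) ∧ (∀ y, i (r y) = θ y ⊙ y ⊙ inv (θ (tgt y))) := by
  -- Every object is joined to the image of `i` by an arrow, taken to be an identity on objects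
  -- already in the image. This normalization makes `r` a strict retraction and `θ` trivial on the
  -- image; neither is claimed to be equivariant.
  have h (y : B) : ∃ k, src k ∈ Set.range i ∧ tgt k = src y ∧
      (src y ∈ Set.range i → k = src y) := by
    by_cases hy : src y ∈ Set.range i
    · exact ⟨src y, by simpa, by simp, fun _ => rfl⟩
    · obtain ⟨k, hk, hk'⟩ := hi.essSurj y
      exact ⟨k, hk, hk', fun h => absurd h hy⟩
  choose k hk hk' hk'' using h
  have hθ (y : B) : k (src (src y)) = k (src y) := by rw [src_src]
  have ht (y : B) : tgt (k (src y)) = src y := by rw [hk', src_src]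
  have ht' (y : B) : tgt (k (src (tgt y))) = tgt y := by rw [ht, src_tgt]
  have h1 (y : B) : src (k (src y) ⊙ y ⊙ inv (k (src (tgt y)))) = src (k (src y)) :=
    src_conj (ht y) (ht' y)
  have h2 (y : B) : tgt (k (src y) ⊙ y ⊙ inv (k (src (tgt y)))) = src (k (src (tgt y))) :=
    tgt_conj (ht y) (ht' y)
  have h3 (y : B) : ∃ x, i x = k (src y) ⊙ y ⊙ inv (k (src (tgt y))) :=
    hi.full _ (h1 y ▸ hk _) (h2 y ▸ hk _)
  choose r hr using h3
  have hki (x : A) : k (src (i x)) = src (i x) := by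
    rw [hk'' _ (by rw [src_src, ← hi.map_src]; exact ⟨_, rfl⟩), src_src]
  refine ⟨r, fun y => k (src y), ⟨fun {x y z} H => ?_⟩, fun x => hi.injective ?_, hθ, ?_, ?_, hki, hr⟩
  · refine hi.comp_of_injective hi.injective ?_
    obtain ⟨h, rfl⟩ := comp_iff.1 H
    rw [hr, hr, hr, comp_iff, src_mul h, tgt_mul h, h2, h1, h, src_src]
    exact ⟨rfl, h ▸ (by simpa [h] using conj_mul (ht x) (ht' x) h (ht' y))⟩
  · rw [hr, hki, ← hi.map_tgt, hki, hi.map_tgt]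
    simp
  · intro y
    rw [hi.map_src, hr, h1]
  · intro y
    simp [hk']

/-- Lift the contraction `θ` to arrows `ξ` of `X` and conjugate `a ∘ r` by them. The retraction need
not commute with the involution, but the resulting lift does: by uniqueness of lifts only the
endpoints of arrows have to be compared. -/
lemma IsDiscreteFibration.hasAcyclicRLP {X Y : Type u} [InvGroupoid X] [InvGroupoid Y] {q : X → Y}
    (hq : IsDiscreteFibration q) (hq' : IsEquivariant q) : HasAcyclicRLP q := by
  intro A B _ _ i a b hi' hi ha hb w
  obtain ⟨r, θ, hr, hri, hθ, hsθ, htθ, hθi, hir⟩ := hi.exists_retraction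
  have h (y : B) : ∃ m, src m = a (src (r y)) ∧ q m = b (θ y) :=
    (hq _ _ (by rw [← ha.map_src, src_src]) (by rw [w, ← hb.map_src, hsθ])).exists
  choose ξ hξ hξ' using h
  have hξs (y : B) : ξ (src y) = ξ y := by
    refine hq.ext hq'.toIsFunctor ?_ ?_
    · rw [hξ, hξ, hr.map_src, src_src]
    · rw [hξ', hξ', hθ]
  have hξi (x : A) : ξ (i x) = a (src x) := by
    refine hq.ext hq'.toIsFunctor ?_ ?_
    · rw [hξ, hri, ← ha.map_src, src_src]
    · rw [hξ', hθi, w, hi.map_src]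
  have e1 (y : B) : src (a (r y)) = src (ξ y) := by rw [hξ, ha.map_src]
  have e2 (y : B) : tgt (a (r y)) = src (ξ (tgt y)) := by
    rw [hξ, hr.map_tgt, src_tgt, ha.map_tgt]
  -- As `ξ y` lies over `b (θ y)` and `i (r y)` is the conjugate of `y` by `θ`, this arrow lies over
  -- `b y`.
  let l (y : B) := inv (ξ y) ⊙ a (r y) ⊙ ξ (tgt y)
  have hls (y : B) : src (l y) = tgt (ξ y) := src_conj' (e1 y).symm (e2 y)
  have hlt (y : B) : tgt (l y) = tgt (ξ (tgt y)) := tgt_conj' (e1 y).symm (e2 y)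
  have hl : IsFunctor l := IsFunctor.of_mul fun x y hxy => by
    have h1 : ξ (tgt x) = ξ y := by rw [hxy, hξs]
    have h2 : ξ (x ⊙ y) = ξ x := by rw [← hξs, src_mul hxy, hξs]
    have h4 := ha.tgt_eq_src (hr.tgt_eq_src hxy)
    refine ⟨by rw [hls, hlt, h1], ?_⟩
    simp only [l]
    rw [h2, hr.map_mul hxy, ha.map_mul (hr.tgt_eq_src hxy), tgt_mul hxy,
      ← conj_mul' (e1 x).symm (e2 x) h4 (e2 y), h1]
  have hql (y : B) : q (l y) = b y := by
    have h2 : tgt (θ (tgt y)) = tgt y := by rw [htθ, src_tgt]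
    have h3 := src_conj (htθ y) h2
    have h4 := tgt_conj (htθ y) h2
    simp only [l]
    rw [hq'.map_mul (by rw [tgt_mul (by simp [e1]), e2]), hq'.map_mul (by simp [e1]), hq'.map_inv,
      hξ', w, hξ', hir, ← hb.map_inv, ← hb.map_mul (by simp [h3]),
      ← hb.map_mul (by rw [tgt_mul (by simp [h3]), h4]), conj_conj (htθ y) h2]
  -- The arrows `θ (σ y)` and `σ (θ y)` end at the same object and start in the image of `i`, so
  -- fullness makes their difference some `i m`. Unique lifting then gives `ξ (σ y) = a m ⊙ σ (ξ
  -- y)`, and the targets agree.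
  have key (y : B) : tgt (ξ (σ y)) = tgt (σ (ξ y)) := by
    have h1 : tgt (θ (σ y)) = tgt (σ (θ y)) := by rw [htθ, ← σ_src, ← htθ y, σ_tgt]
    have h2 : tgt (θ (σ y)) = src (inv (σ (θ y))) := by rw [h1, src_inv]
    have h3 : src (θ (σ y) ⊙ inv (σ (θ y))) = i (src (r (σ y))) := by rw [src_mul h2, hsθ]
    have h4 : tgt (θ (σ y) ⊙ inv (σ (θ y))) = i (σ (src (r y))) := by
      rw [tgt_mul h2, tgt_inv, ← σ_src, hsθ, hi'.map_σ]
    obtain ⟨m, hm⟩ := hi.full (θ (σ y) ⊙ inv (σ (θ y))) (h3 ▸ ⟨_, rfl⟩) (h4 ▸ ⟨_, rfl⟩)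
    have hm1 : tgt m = σ (src (r y)) := hi.injective (by rw [hi.map_tgt, hm, h4])
    have hm2 : src m = src (r (σ y)) := hi.injective (by rw [hi.map_src, hm, h3])
    have hc : tgt (a m) = src (σ (ξ y)) := by
      rw [← ha.map_tgt, hm1, ha.map_σ, ← σ_src, hξ]
    have h5 : tgt (i m) = src (σ (θ y)) := by rw [hm, tgt_mul h2, tgt_inv]
    have : ξ (σ y) = a m ⊙ σ (ξ y) := by
      refine hq.ext hq'.toIsFunctor ?_ ?_
      · rw [hξ, src_mul hc, ← ha.map_src, hm2]
      · rw [hξ', hq'.map_mul hc, hq'.map_σ, hξ', w, ← hb.map_σ, ← hb.map_mul h5, hm,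
          mul_assoc h2 (by simp), inv_mul, ← h1, mul_tgt_self]
    rw [this, tgt_mul hc]
  refine ⟨l, ⟨hl, fun y => ?_⟩, fun x => ?_, hql⟩
  · refine hq.ext hq'.toIsFunctor ?_ ?_
    · rw [hls, key, ← σ_src, hls, σ_tgt]
    · rw [hql, hq'.map_σ, hql, hb.map_σ]
  · simp only [l]
    rw [hξi, hri, ← hi.map_tgt, hξi, src_tgt, ha.map_src, ha.map_tgt, inv_src,
      src_mul_self, mul_tgt_self]

/-- An equivariant map to `X × X` with the swap is the same as a plain functor to `X`, so it can be
extended along the non-equivariant retraction `r`. -/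
lemma hasAcyclicRLP_fst (Y X : Type u) [InvGroupoid Y] [SGroupoid X] :
    HasAcyclicRLP (Prod.fst : Y × X × X → Y) := by
  intro A B _ _ i a b hi' hi ha hb w
  obtain ⟨r, -, hr, hri, -⟩ := hi.exists_retraction
  refine ⟨fun y => (b y, (a (r y)).2.1, (a (r (σ y))).2.1), ⟨⟨fun h => ⟨hb.comp h,
    (ha.comp (hr.comp h)).2.1, (ha.comp (hr.comp (comp_σ h))).2.1⟩⟩, fun y => ?_⟩, fun x => ?_,
    fun y => rfl⟩
  · rw [σ_σ, hb.map_σ]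
    rfl
  · change (b (i x), (a (r (i x))).2.1, (a (r (σ (i x)))).2.1) = a x
    rw [← hi'.map_σ, hri, hri, ha.map_σ, ← w]
    rfl

/-- If `(q, e, e ∘ σ) : Z → Y × (X × X)` is a discrete fibration, then `q` is an injective
fibration. -/
lemma hasAcyclicRLP_of_discrete {Z Y X : Type u} [InvGroupoid Z] [InvGroupoid Y] [SGroupoid X]
    {q : Z → Y} {e : Z → X} (hq : IsEquivariant q) (he : IsFunctor e)
    (h : IsDiscreteFibration (fun z => (q z, e z, e (σ z)))) : HasAcyclicRLP q := by
  have h' : IsEquivariant (fun z => (q z, e z, e (σ z))) :=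
    ⟨⟨fun H => ⟨hq.comp H, he.comp H, he.comp (comp_σ H)⟩⟩, fun z => by
      rw [σ_σ, hq.map_σ]; rfl⟩
  intro A B _ _ i a b hi' hi ha hb w
  -- The lift is made in two stages, first into the cofree object `Y × X × X` over `Y` and then
  -- along the discrete fibration.
  obtain ⟨l, hl, hl', hl''⟩ := hasAcyclicRLP_fst Y X i (fun x => (q (a x), e (a x), e (σ (a x)))) b
    hi' hi ⟨⟨fun H => h'.comp (ha.comp H)⟩, fun x => by rw [ha.map_σ, h'.map_σ]⟩ hb w
  obtain ⟨k, hk, hk', hk''⟩ := h.hasAcyclicRLP h' i a l hi' hi ha hl fun x => (hl' x).symm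
  exact ⟨k, hk, hk', fun y => by rw [← hl'', ← hk'']⟩

/-! ### Action groupoids and the factorization -/

/-- An action of a groupoid `B` on a set, which is the subset `valid` of the type `E`. -/
structure GroupoidAction (B E : Type*) [SGroupoid B] where
  valid : E → Prop
  anchor : E → B
  act : E → B → E
  valid_act {x : E} {n : B} : valid x → anchor x = src n → valid (act x n)
  anchor_act {x : E} {n : B} : valid x → anchor x = src n → anchor (act x n) = tgt n
  act_src {x : E} {n : B} : valid x → anchor x = src n → act x (src n) = x
  act_mul {x : E} {m n : B} : valid x → anchor x = src m → tgt m = src n →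
    act x (m ⊙ n) = act (act x m) n

namespace GroupoidAction

/-- The arrows of the action groupoid. -/
@[ext]
structure Total {B E : Type*} [SGroupoid B] (α : GroupoidAction B E) where
  /-- the element acted upon -/
  pt : E
  /-- the underlying arrow -/
  arr : B
  valid : α.valid pt
  anchor_eq : α.anchor pt = src arr

variable {B E : Type*} [SGroupoid B] {α : GroupoidAction B E}

/-- An element of `Total` stands for the arrow from `pt` to `act pt arr`; the target is not stored.
-/
instance : SGroupoid α.Total where
  Comp x y z := Comp x.arr y.arr z.arr ∧ z.pt = x.pt ∧ y.pt = α.act x.pt x.arr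
  comp_unique h h' := Total.ext (h.2.1.trans h'.2.1.symm) (comp_unique h.1 h'.1)
  left_cancel h h' := Total.ext (h.2.2.trans h'.2.2.symm) (left_cancel h.1 h'.1)
  right_cancel h h' := Total.ext (h.2.1.symm.trans h'.2.1) (right_cancel h.1 h'.1)
  exists_src x := ⟨⟨x.pt, src x.arr, x.valid, by simpa using x.anchor_eq⟩,
    ⟨comp_src_src _, rfl, (α.act_src x.valid x.anchor_eq).symm⟩,
    ⟨comp_src _, rfl, (α.act_src x.valid x.anchor_eq).symm⟩⟩
  exists_tgt x := by
    have h : α.anchor (α.act x.pt x.arr) = src (tgt x.arr) := by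
      rw [α.anchor_act x.valid x.anchor_eq, src_tgt]
    refine ⟨⟨α.act x.pt x.arr, tgt x.arr, α.valid_act x.valid x.anchor_eq, h⟩,
      ⟨comp_tgt_tgt _, rfl, ?_⟩, ⟨comp_tgt _, rfl, rfl⟩⟩
    have := α.act_src (α.valid_act x.valid x.anchor_eq) h
    rw [src_tgt] at this
    exact this.symm
  exists_comp {x c y} h h' := by
    obtain ⟨n, hn⟩ := exists_comp h.1 h'.1
    refine ⟨⟨x.pt, n, x.valid, ?_⟩, hn, rfl, h'.2.1.trans h.2.2⟩
    obtain ⟨h1, h2⟩ := comp_iff.1 hn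
    rw [← h2, src_mul h1]
    exact x.anchor_eq
  exists_mid {x y z} h := by
    have h1 : α.anchor (α.act x.pt x.arr) = src (tgt x.arr) := by
      rw [α.anchor_act x.valid x.anchor_eq, src_tgt]
    refine ⟨⟨α.act x.pt x.arr, tgt x.arr, α.valid_act x.valid x.anchor_eq, h1⟩,
      ⟨comp_tgt _, rfl, rfl⟩, ?_, h.2.2, ?_⟩
    · simpa only [SGroupoid.tgt_eq_src h.1] using comp_src y.arr
    · have := α.act_src (α.valid_act x.valid x.anchor_eq) h1
      rw [src_tgt] at this
      exact h.2.2.trans this.symm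
  assoc {x y z a b c} h h' h'' := ⟨assoc h.1 h'.1 h''.1, h''.2.1.trans h.2.1,
    h'.2.1.trans h.2.2⟩
  assoc' {x y z a b c} h h' h'' := ⟨assoc' h.1 h'.1 h''.1, h''.2.1.trans h.2.1.symm, by
    obtain ⟨h1, h2⟩ := comp_iff.1 h.1
    rw [h'.2.2, h.2.2, h.2.1, ← h2, α.act_mul x.valid x.anchor_eq h1]⟩
  exists_inv x := ⟨⟨α.act x.pt x.arr, inv x.arr, α.valid_act x.valid x.anchor_eq, by
      rw [α.anchor_act x.valid x.anchor_eq, src_inv]⟩,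
    ⟨x.pt, src x.arr, x.valid, by simpa using x.anchor_eq⟩, ⟨comp_inv _, rfl, rfl⟩,
    ⟨comp_src _, rfl, (α.act_src x.valid x.anchor_eq).symm⟩⟩

lemma isFunctor_arr : IsFunctor (Total.arr : α.Total → B) := ⟨fun h => h.1⟩

lemma Total.src_eq (z : α.Total) : (src z).pt = z.pt := (comp_src z).2.1.symm

lemma Total.tgt_eq (z : α.Total) : (tgt z).pt = α.act z.pt z.arr := (comp_tgt z).2.2

lemma isDiscreteFibration_arr : IsDiscreteFibration (Total.arr : α.Total → B) := by
  intro x n hx hn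
  refine ⟨⟨x.pt, n, x.valid, ?_⟩, ⟨?_, rfl⟩, ?_⟩
  · rw [x.anchor_eq, hn, ← isFunctor_arr.map_src, hx]
  · refine Total.ext (Total.src_eq _) ?_
    exact (isFunctor_arr.map_src _).trans hn
  · rintro m ⟨rfl, rfl⟩
    exact Total.ext (Total.src_eq _).symm rfl

end GroupoidAction

section Factorization

variable {X Y : Type u} [InvGroupoid X] [InvGroupoid Y] {f : X → Y}

/-- The action of `Y × (X × X)` on the pairs `(a : f x₀ ⟶ y, t : x₀ ⟶ σ x₁)`. -/
noncomputable def factorizationAction (hf : IsEquivariant f) :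
    GroupoidAction (Y × X × X) (Y × X) where
  valid x := src x.1 = f (src x.2)
  anchor x := (tgt x.1, src x.2, σ (tgt x.2))
  act x n := (inv (f n.2.1) ⊙ x.1 ⊙ n.1, inv n.2.1 ⊙ x.2 ⊙ σ n.2.2)
  valid_act {x n} h h' := by
    obtain ⟨a, t⟩ := x
    obtain ⟨n, m, m'⟩ := n
    simp only [src_prod, Prod.mk.injEq] at h h' ⊢
    rw [src_conj' (by rw [← hf.map_src, ← h'.2.1, h]) h'.1,
      src_conj' h'.2.1.symm (by rw [← σ_src, ← h'.2.2, σ_σ]), hf.map_tgt]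
  anchor_act {x n} h h' := by
    obtain ⟨a, t⟩ := x
    obtain ⟨n, m, m'⟩ := n
    simp only [src_prod, Prod.mk.injEq] at h h'
    have h1 : tgt t = src (σ m') := by rw [← σ_src, ← h'.2.2, σ_σ]
    refine Prod.ext ?_ (Prod.ext ?_ ?_)
    · rw [(isFunctor_fst _ _).map_tgt]
      exact tgt_conj' (by rw [← hf.map_src, ← h'.2.1, h]) h'.1
    · rw [(isFunctor_snd _ _).map_tgt, (isFunctor_fst _ _).map_tgt]
      exact src_conj' h'.2.1.symm h1
    · rw [(isFunctor_snd _ _).map_tgt, (isFunctor_snd _ _).map_tgt]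
      change σ (tgt (inv m ⊙ t ⊙ σ m')) = _
      rw [tgt_conj' h'.2.1.symm h1, σ_tgt, σ_σ]
  act_src {x n} h h' := by
    obtain ⟨a, t⟩ := x
    obtain ⟨n, m, m'⟩ := n
    simp only [src_prod, Prod.mk.injEq] at h h' ⊢
    rw [← h'.1, ← h'.2.1, ← h'.2.2, ← h]
    simp
  act_mul {x m n} h h' hmn := by
    obtain ⟨a, t⟩ := x
    obtain ⟨m, k, k'⟩ := m
    obtain ⟨n, l, l'⟩ := n
    simp only [src_prod, Prod.mk.injEq] at h h'
    have h1 : tgt m = src n := by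
      have := congrArg Prod.fst hmn
      rwa [(isFunctor_fst _ _).map_tgt, (isFunctor_fst _ _).map_src] at this
    have h2 : tgt k = src l := by
      have := congrArg (fun x => x.2.1) hmn
      rwa [((isFunctor_fst _ _).comp' (isFunctor_snd _ _)).map_tgt,
        ((isFunctor_fst _ _).comp' (isFunctor_snd _ _)).map_src] at this
    have h3 : tgt k' = src l' := by
      have := congrArg (fun x => x.2.2) hmn
      rwa [((isFunctor_snd _ _).comp' (isFunctor_snd _ _)).map_tgt,
        ((isFunctor_snd _ _).comp' (isFunctor_snd _ _)).map_src] at this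
    have e := comp_mul hmn
    have e1 : ((m, k, k') ⊙ (n, l, l')).1 = m ⊙ n := (comp_iff.1 e.1).2.symm
    have e2 : ((m, k, k') ⊙ (n, l, l')).2.1 = k ⊙ l := (comp_iff.1 e.2.1).2.symm
    have e3 : ((m, k, k') ⊙ (n, l, l')).2.2 = k' ⊙ l' := (comp_iff.1 e.2.2).2.symm
    simp only [e1, e2, e3]
    have key {M : Type u} [SGroupoid M] {k l a m n : M} (h1 : tgt k = src l) (h2 : src k = src a)
        (h3 : tgt a = src m) (h4 : tgt m = src n) :
        inv (k ⊙ l) ⊙ a ⊙ (m ⊙ n) = inv l ⊙ (inv k ⊙ a ⊙ m) ⊙ n := by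
      grind
    refine Prod.ext ?_ ?_
    · rw [hf.map_mul h2, key (hf.tgt_eq_src h2) (by rw [← hf.map_src, ← h'.2.1, h]) h'.1 h1]
    · rw [σ_mul h3, key h2 h'.2.1.symm (by rw [← σ_src, ← h'.2.2, σ_σ])
        ((isFunctor_σ X).tgt_eq_src h3)]

/-- The middle object of the factorization of `f`. -/
abbrev Factorization (hf : IsEquivariant f) : Type u := (factorizationAction hf).Total

lemma Factorization.src_pt_fst {hf : IsEquivariant f} (z : Factorization hf) :
    src z.pt.1 = f (src z.pt.2) := z.valid

lemma Factorization.src_fst {hf : IsEquivariant f} (z : Factorization hf) :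
    src z.arr.1 = tgt z.pt.1 := by
  have := congrArg Prod.fst z.anchor_eq
  rw [src_prod] at this
  exact this.symm

lemma Factorization.src_snd_fst {hf : IsEquivariant f} (z : Factorization hf) :
    src z.arr.2.1 = src z.pt.2 := by
  have := congrArg (fun x => x.2.1) z.anchor_eq
  rw [src_prod, src_prod] at this
  exact this.symm

lemma Factorization.src_snd_snd {hf : IsEquivariant f} (z : Factorization hf) :
    src z.arr.2.2 = σ (tgt z.pt.2) := by
  have := congrArg (fun x => x.2.2) z.anchor_eq
  rw [src_prod, src_prod] at this
  exact this.symm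

namespace Factorization

/-- The involution on elements. -/
noncomputable def flip (f : X → Y) (x : Y × X) : Y × X := (σ (inv (f x.2) ⊙ x.1), σ (inv x.2))

lemma flip_flip (hf : IsEquivariant f) {x : Y × X} (hx : src x.1 = f (src x.2)) :
    flip f (flip f x) = x := by
  obtain ⟨a, t⟩ := x
  simp only [flip]
  have h : src (f t) = src a := by rw [← hf.map_src, ← hx]
  refine Prod.ext ?_ ?_
  · have e : inv (f (σ (inv t))) = σ (f t) := by
      rw [hf.map_σ, hf.map_inv, ← σ_inv, SGroupoid.inv_inv]
    dsimp only
    rw [e, ← σ_mul (by rw [src_mul (by simpa), src_inv]), σ_σ, mul_inv_cancel_left h]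
  · dsimp only
    rw [σ_inv t, SGroupoid.inv_inv, σ_σ]

/-- Compatibility of `flip` with the action, twisted by the involution of `Y × X × X`; this is what
makes the involution of the middle object functorial. -/
lemma flip_act (hf : IsEquivariant f) (x : Factorization hf) :
    flip f ((factorizationAction hf).act x.pt x.arr) =
      (factorizationAction hf).act (flip f x.pt) (σ x.arr) := by
  have h1 := x.src_pt_fst
  have h2 := x.src_fst
  have h3 := x.src_snd_fst
  have h4 := x.src_snd_snd
  obtain ⟨⟨a, t⟩, ⟨n, m, m'⟩, h6, h7⟩ := x
  simp only at h1 h2 h3 h4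
  have h5 : src (σ m') = tgt t := by rw [← σ_src, h4, σ_σ]
  have e1 : f (inv m ⊙ t ⊙ σ m') = inv (f m) ⊙ f t ⊙ σ (f m') := by
    rw [hf.map_mul (by rw [tgt_mul (by simp [h3]), h5]), hf.map_mul (by simp [h3]), hf.map_inv,
      hf.map_σ]
  have key {M : Type u} [SGroupoid M] {m t k a n : M} (h : src m = src t) (h' : tgt t = src k)
      (h₁ : src m = src a) (h₂ : tgt a = src n) :
      inv (inv m ⊙ t ⊙ k) ⊙ (inv m ⊙ a ⊙ n) = inv k ⊙ ((inv t ⊙ a) ⊙ n) := by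
    grind
  have g1 : src (f m) = src (f t) := by rw [← hf.map_src, h3, hf.map_src]
  have g2 : tgt (f t) = src (σ (f m')) := by rw [← hf.map_tgt, ← h5, hf.map_src, hf.map_σ]
  have g3 : src (f m) = src a := by rw [← hf.map_src, h3, h1]
  have g4 : tgt (inv (f t)) = src a := by rw [tgt_inv, ← g1, g3]
  have g5 : tgt (inv (f t) ⊙ a) = src n := by rw [tgt_mul g4, h2]
  have g6 : src (f m') = src (σ (inv (f t) ⊙ a)) := by
    rw [← σ_src, src_mul g4, src_inv, g2, σ_src, σ_σ]
  refine Prod.ext ?_ ?_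
  · change σ (inv (f (inv m ⊙ t ⊙ σ m')) ⊙ (inv (f m) ⊙ a ⊙ n)) =
      inv (f m') ⊙ σ (inv (f t) ⊙ a) ⊙ σ n
    rw [e1, key g1 g2 g3 h2.symm, σ_mul (by rw [tgt_inv, src_mul g5, src_mul g4, src_inv, g2]),
      σ_inv, σ_σ, σ_mul g5, SGroupoid.mul_assoc (by rw [tgt_inv, g6]) ((isFunctor_σ Y).tgt_eq_src g5)]
  · change σ (inv (inv m ⊙ t ⊙ σ m')) = inv m' ⊙ σ (inv t) ⊙ σ m
    rw [inv_conj' h3 h5.symm, σ_mul (by rw [tgt_inv, src_mul (by simp [h3]), src_inv, h5]), σ_inv, σ_σ,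
      σ_mul (by simp [h3]), SGroupoid.mul_assoc (by rw [tgt_inv, ← σ_src, src_inv, h4])
        ((isFunctor_σ X).tgt_eq_src (by simp [h3]))]

/-- An element is a pair `a : f x₀ → y`, `t : x₀ → σ x₁`. The involution exchanges `x₀` and `x₁` and
replaces `y` by `σ y`: the new pair consists of `σ (f(t)⁻¹ a) : f x₁ → σ y` and `σ (t⁻¹) : x₁ → σ
x₀`. -/
noncomputable instance (hf : IsEquivariant f) : InvGroupoid (Factorization hf) where
  σ z :=
    { pt := flip f z.pt
      arr := σ z.arr
      valid := by
        change src (σ (inv (f z.pt.2) ⊙ z.pt.1)) = f (src (σ (inv z.pt.2)))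
        rw [← σ_src, src_mul (by rw [tgt_inv, z.src_pt_fst, hf.map_src]), src_inv, ← σ_src,
          src_inv, hf.map_σ, hf.map_tgt]
      anchor_eq := by
        have h1 := z.src_fst
        have h2 := z.src_snd_fst
        have h3 := z.src_snd_snd
        rw [src_prod, src_prod]
        change (tgt (σ (inv (f z.pt.2) ⊙ z.pt.1)), src (σ (inv z.pt.2)), σ (tgt (σ (inv z.pt.2)))) =
          (src (σ z.arr.1), src z.arr.2.2, src z.arr.2.1)
        rw [← σ_tgt, ← σ_src, ← σ_src, ← σ_tgt,
          tgt_mul (by rw [tgt_inv, z.src_pt_fst, hf.map_src]), h1, h2, h3]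
        simp }
  σ_σ z := GroupoidAction.Total.ext (flip_flip hf z.src_pt_fst) (σ_σ z.arr)
  comp_σ {x y z} h := ⟨comp_σ h.1, congrArg (flip f) h.2.1,
    (congrArg (flip f) h.2.2).trans (flip_act hf x)⟩

lemma isEquivariant_fst (hf : IsEquivariant f) :
    IsEquivariant (fun z : Factorization hf => z.arr.1) where
  comp h := h.1.1
  map_σ _ := rfl

/-- With `e` the `x₀`-coordinate, `e ∘ σ` is the `x₁`-coordinate, so `(q, e, e ∘ σ)` is the
projection of the action groupoid, which is a discrete fibration. -/
lemma hasAcyclicRLP_fst (hf : IsEquivariant f) :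
    HasAcyclicRLP (fun z : Factorization hf => z.arr.1) :=
  hasAcyclicRLP_of_discrete (e := fun z => z.arr.2.1) (isEquivariant_fst hf) ⟨fun h => h.1.2.1⟩
    GroupoidAction.isDiscreteFibration_arr

lemma isIsofibration_fst (hf : IsEquivariant f) :
    IsIsofibration (fun z : Factorization hf => z.arr.1) := by
  intro z n hz hn
  have h : src z.arr = z.arr := by rw [← GroupoidAction.isFunctor_arr.map_src, hz]
  obtain ⟨m, hm, hm'⟩ := (GroupoidAction.isDiscreteFibration_arr z (n, z.arr.2) hz (by
    rw [src_prod] at h ⊢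
    have h' := congrArg Prod.snd h
    exact Prod.ext hn h')).exists
  exact ⟨m, hm, congrArg Prod.fst hm'⟩

/-- The inclusion of the source of `f` into the middle object of the factorization. -/
noncomputable def incl (hf : IsEquivariant f) (x : X) : Factorization hf where
  pt := (f (src x), src x)
  arr := (f x, x, σ x)
  valid := by
    change src (f (src x)) = f (src (src x))
    rw [hf.map_src, src_src, src_src, hf.map_src]
  anchor_eq := by
    change (tgt (f (src x)), src (src x), σ (tgt (src x))) = _
    rw [src_prod, src_prod, hf.map_src, tgt_src, src_src, tgt_src, σ_src]

lemma isEquivariant_incl (hf : IsEquivariant f) : IsEquivariant (incl hf) where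
  comp {x y z} h := by
    obtain ⟨hxy, rfl⟩ := comp_iff.1 h
    refine ⟨⟨hf.comp h, h, comp_σ h⟩, ?_, ?_⟩
    · change (f (src _), src _) = (f (src _), src _)
      rw [src_mul hxy]
    · change (f (src y), src y) = (inv (f x) ⊙ f (src x) ⊙ f x, inv x ⊙ src x ⊙ σ (σ x))
      rw [σ_σ, hf.map_src, hf.map_src, SGroupoid.mul_assoc (by simp) (by simp),
        SGroupoid.mul_assoc (by simp) (by simp)]
      simp [hxy, hf.tgt_eq_src hxy]
  map_σ x := by
    refine GroupoidAction.Total.ext ?_ ?_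
    · change (f (src (σ x)), src (σ x)) = (σ (inv (f (src x)) ⊙ f (src x)), σ (inv (src x)))
      rw [inv_mul, inv_src, σ_src, hf.map_src, hf.map_src, tgt_src, hf.map_σ, σ_src]
    · exact Prod.ext (hf.map_σ x) (Prod.ext rfl (σ_σ x))

/-- The image of `x` has `x₀ = x`, `x₁ = σ x` and identities for `a` and `t`. A general pair `(a,
t)` differs from the image of `x₀` only by the arrows `a` and `t` themselves, which provide the
connecting arrow. -/
lemma isAcyclicCofibration_incl (hf : IsEquivariant f) : IsAcyclicCofibration (incl hf) where
  toIsFunctor := (isEquivariant_incl hf).toIsFunctor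
  injective x y h := congrArg (fun z => z.arr.2.1) h
  full n := by
    rintro ⟨x, hx⟩ ⟨y, hy⟩
    have h1 : (f (src x), src x) = n.pt :=
      (congrArg (fun z => z.pt) hx).trans (GroupoidAction.Total.src_eq n)
    have h2 : (f (src y), src y) = (factorizationAction hf).act n.pt n.arr :=
      (congrArg (fun z => z.pt) hy).trans (GroupoidAction.Total.tgt_eq n)
    have h3 := n.src_fst
    have h4 := n.src_snd_fst
    have h5 := n.src_snd_snd
    obtain ⟨pt, ⟨k, m, m'⟩, h6, h7⟩ := n
    dsimp only at h1 h2 h3 h4 h5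
    subst h1
    replace h2 : (f (src y), src y) = (inv (f m) ⊙ f (src x) ⊙ k, inv m ⊙ src x ⊙ σ m') := h2
    obtain ⟨h8, h9⟩ := Prod.mk.inj h2
    simp only [hf.map_src, tgt_src, src_src] at h3 h4 h5 h8 h9
    -- If `m⁻¹ k` is an identity then `k = m`. Used in `Y` and in `X`, this forces an arrow between
    -- objects of the image to have coordinates `(f m, m, σ m)`.
    have key {M : Type u} [SGroupoid M] {d m k y : M} (h : d = src m) (h' : src m = src k)
        (e : src y = inv m ⊙ d ⊙ k) : k = m := by
      have h1 : inv m ⊙ d = inv m := by rw [h, ← tgt_inv, mul_tgt_self]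
      have h2 : src y = tgt m := by
        have := congrArg src e
        rwa [src_src, h1, src_mul (by rw [tgt_inv, h']), src_inv] at this
      rw [← mul_inv_cancel_left h', ← h1, ← e, h2, mul_tgt_self]
    have e1 : k = f m := key (by rw [← hf.map_src, ← hf.map_src, h4])
      (by rw [h3, ← hf.map_src, ← hf.map_src, h4]) h8
    have e2 : m' = σ m := by
      rw [← key h4.symm (by rw [h4, ← σ_src, h5, σ_σ]) h9, σ_σ]
    refine ⟨m, GroupoidAction.Total.ext ?_ ?_⟩
    · change (f (src m), src m) = (f (src x), src x)
      rw [h4]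
    · change (f m, m, σ m) = (k, m, m')
      rw [e1, e2]
  essSurj n := by
    have h1 := n.src_pt_fst
    have h2 := n.anchor_eq
    have h3 : src (f (src n.pt.2)) = src n.pt.1 := by rw [h1, ← hf.map_src, src_src]
    -- The arrow `(a, id, σ t)` leads from the image of `x₀` to the given element `(a, t)`.
    refine ⟨⟨(f (src n.pt.2), src n.pt.2), (n.pt.1, src n.pt.2, σ n.pt.2), ?_, ?_⟩, ⟨src n.pt.2, ?_⟩,
      ?_⟩
    · change src (f (src n.pt.2)) = f (src (src n.pt.2))
      rw [h3, src_src, h1]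
    · change (tgt (f (src n.pt.2)), src (src n.pt.2), σ (tgt (src n.pt.2))) = _
      rw [src_prod, src_prod, hf.map_src, tgt_src, src_src, tgt_src, ← σ_src, ← hf.map_src, h1]
    · refine GroupoidAction.Total.ext ?_ ?_
      · refine Eq.trans ?_ (GroupoidAction.Total.src_eq _).symm
        change (f (src (src n.pt.2)), src (src n.pt.2)) = (f (src n.pt.2), src n.pt.2)
        rw [src_src]
      · refine Eq.trans ?_ (GroupoidAction.isFunctor_arr.map_src _).symm
        change (f (src n.pt.2), src n.pt.2, σ (src n.pt.2)) = src (n.pt.1, src n.pt.2, σ n.pt.2)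
        rw [src_prod, src_prod, h1, src_src, σ_src]
    · refine GroupoidAction.Total.ext ?_ ?_
      · refine (GroupoidAction.Total.tgt_eq _).trans
          (Eq.trans ?_ (GroupoidAction.Total.src_eq _).symm)
        change (inv (f (src n.pt.2)) ⊙ f (src n.pt.2) ⊙ n.pt.1,
          inv (src n.pt.2) ⊙ src n.pt.2 ⊙ σ (σ n.pt.2)) = n.pt
        refine Prod.ext ?_ ?_
        · dsimp only
          rw [inv_mul, hf.map_src, tgt_src, ← hf.map_src, ← h1, src_mul_self]
        · dsimp only
          rw [inv_mul, tgt_src, σ_σ, src_mul_self]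
      · refine (GroupoidAction.isFunctor_arr.map_tgt _).trans
          (Eq.trans ?_ (GroupoidAction.isFunctor_arr.map_src _).symm)
        rw [← h2]
        change tgt _ = (tgt n.pt.1, src n.pt.2, σ (tgt n.pt.2))
        refine Prod.ext ?_ (Prod.ext ?_ ?_)
        · rw [(isFunctor_fst _ _).map_tgt]
        · rw [(isFunctor_snd _ _).map_tgt, (isFunctor_fst _ _).map_tgt]
          exact tgt_src _
        · rw [(isFunctor_snd _ _).map_tgt, (isFunctor_snd _ _).map_tgt]
          exact (σ_tgt _).symm

end Factorization

end Factorization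

/-! ### Dependent products of groupoids -/

namespace SGroupoid

variable {M : Type*} [SGroupoid M] {x y z : M}

lemma comp_rotate_right (h : Comp x y z) : Comp z (inv y) x :=
  assoc' h (comp_inv y) (tgt_eq_src h ▸ comp_tgt x)

lemma comp_rotate_left (h : Comp x y z) : Comp (inv x) z y := by
  have h' := comp_mul (show tgt (inv x) = src x by simp)
  rw [inv_mul, tgt_eq_src h] at h'
  exact assoc h' h (comp_src y)

lemma src_eq_of_comp (h : Comp x y z) : src z = src x :=
  (eq_src (assoc (comp_src x) h h)).symm

lemma tgt_eq_of_comp (h : Comp x y z) : tgt z = tgt y :=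
  (eq_tgt (assoc' h (comp_tgt y) h)).symm

end SGroupoid

lemma IsIsofibration.exists_src_eq {A B : Type*} [SGroupoid A] [SGroupoid B] {g : A → B}
    (hg : IsIsofibration g) (hg' : IsFunctor g) {a : A} {b : B} (h : src b = src (g a)) :
    ∃ a', src a' = src a ∧ g a' = b :=
  hg (src a) b (src_src a) (by rw [h, hg'.map_src])

lemma IsIsofibration.exists_tgt_eq {A B : Type*} [SGroupoid A] [SGroupoid B] {g : A → B}
    (hg : IsIsofibration g) (hg' : IsFunctor g) {a : A} {b : B} (h : tgt b = src (g a)) :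
    ∃ a', tgt a' = src a ∧ g a' = b := by
  obtain ⟨a', h1, h2⟩ := hg.exists_src_eq hg' (a := a) (b := inv b) (by rw [src_inv, h])
  exact ⟨inv a', by simpa, by rw [hg'.map_inv, h2, SGroupoid.inv_inv]⟩

/-- A section of `f` over the fiber of `g` above an arrow. -/
structure FiberSection {Y A B : Type*} (f : Y → A) (g : A → B) where
  base : B
  sec (a : A) (h : g a = base) : Y
  map_sec (a : A) (h : g a = base) : f (sec a h) = a

namespace FiberSection

variable {Y A B : Type*} {f : Y → A} {g : A → B}

lemma ext' {p q : FiberSection f g} (h : p.base = q.base)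
    (h' : ∀ a ha ha', p.sec a ha = q.sec a ha') : p = q := by
  obtain ⟨b, s, hs⟩ := p
  obtain ⟨b', s', hs'⟩ := q
  obtain rfl : b = b' := h
  obtain rfl : s = s' := funext fun a => funext fun ha => h' a ha ha
  rfl

variable [SGroupoid Y] [SGroupoid A] [SGroupoid B]

/-- The composition relation for sections. -/
structure Composes (p q r : FiberSection f g) : Prop where
  base : Comp p.base q.base r.base
  sec {a b c : A} (ha : g a = p.base) (hb : g b = q.base) (hc : g c = r.base) :
    Comp a b c → Comp (p.sec a ha) (q.sec b hb) (r.sec c hc)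

section

variable (hg : IsFunctor g) (hg' : IsIsofibration g) {p q r x y z a b c : FiberSection f g}
include hg hg'

/-- The relation constrains `r` only at composites of arrows over `p.base` and `q.base`. Since `g`
is an isofibration, every arrow over `r.base` is such a composite, so all values of `r` are
determined. -/
lemma Composes.unique (h : Composes p q r) {r' : FiberSection f g} (h' : Composes p q r') :
    r = r' := by
  refine ext' (comp_unique h.base h'.base) fun c hc hc' => ?_
  obtain ⟨a, ha, ha'⟩ := hg'.exists_src_eq hg (a := c) (b := p.base)
    (by rw [hc, src_eq_of_comp h.base])
  have H := comp_mul (x := inv a) (y := c) (by rw [tgt_inv, ha])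
  have H' := comp_rotate_left H
  rw [SGroupoid.inv_inv] at H'
  have hb : g (inv a ⊙ c) = q.base := left_cancel (ha' ▸ hc ▸ hg.comp H') h.base
  exact comp_unique (h.sec ha' hb hc H') (h'.sec ha' hb hc' H')

lemma Composes.left_cancel (h : Composes p q r) {q' : FiberSection f g} (h' : Composes p q' r) :
    q = q' := by
  refine ext' (SGroupoid.left_cancel h.base h'.base) fun b hb hb' => ?_
  obtain ⟨a, ha, ha'⟩ := hg'.exists_tgt_eq hg (a := b) (b := p.base)
    (by rw [hb, tgt_eq_src h.base])
  have H := comp_mul ha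
  have hc : g (a ⊙ b) = r.base := comp_unique (ha' ▸ hb ▸ hg.comp H) h.base
  exact SGroupoid.left_cancel (h.sec ha' hb hc H) (h'.sec ha' hb' hc H)

lemma Composes.right_cancel (h : Composes p q r) {p' : FiberSection f g} (h' : Composes p' q r) :
    p = p' := by
  refine ext' (SGroupoid.right_cancel h.base h'.base) fun a ha ha' => ?_
  obtain ⟨b, hb, hb'⟩ := hg'.exists_src_eq hg (a := tgt a) (b := q.base)
    (by rw [hg.map_tgt, ha, src_tgt, tgt_eq_src h.base])
  rw [src_tgt] at hb
  have H := comp_mul hb.symm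
  have hc : g (a ⊙ b) = r.base := comp_unique (ha ▸ hb' ▸ hg.comp H) h.base
  exact SGroupoid.right_cancel (h.sec ha hb' hc H) (h'.sec ha' hb' hc H)

omit hg' in
lemma Composes.base_of_comp (h : Composes p q r) {a b c : A} (ha : g a = p.base)
    (hb : g b = q.base) (H : SGroupoid.Comp a b c) : g c = r.base :=
  comp_unique (ha ▸ hb ▸ hg.comp H) h.base

lemma Composes.assoc (h : Composes x y a) (h' : Composes y z b) (h'' : Composes a z c) :
    Composes x b c := by
  refine ⟨SGroupoid.assoc h.base h'.base h''.base, fun {u vw w} hu hvw hw H => ?_⟩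
  obtain ⟨v, hv, hv'⟩ := hg'.exists_src_eq hg (a := vw) (b := y.base)
    (by rw [hvw, src_eq_of_comp h'.base])
  have H1 := comp_mul (x := inv v) (y := vw) (by rw [tgt_inv, hv])
  have H2 := comp_rotate_left H1
  rw [SGroupoid.inv_inv] at H2
  set t := inv v ⊙ vw
  have ht : g t = z.base := SGroupoid.left_cancel (hv' ▸ hvw ▸ hg.comp H2) h'.base
  have H3 := comp_mul (x := u) (y := v) (by rw [tgt_eq_src H, hv])
  have huv := h.base_of_comp hg hu hv' H3
  have H4 : SGroupoid.Comp (u ⊙ v) t w := SGroupoid.assoc' H3 H2 H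
  exact SGroupoid.assoc (h.sec hu hv' huv H3) (h'.sec hv' ht hvw H2) (h''.sec huv ht hw H4)

lemma Composes.assoc' (h : Composes x y a) (h' : Composes y z b) (h'' : Composes x b c) :
    Composes a z c := by
  refine ⟨SGroupoid.assoc' h.base h'.base h''.base, fun {uv t w} huv ht hw H => ?_⟩
  obtain ⟨u, hu, hu'⟩ := hg'.exists_src_eq hg (a := uv) (b := x.base)
    (by rw [huv, src_eq_of_comp h.base])
  have H1 := comp_mul (x := inv u) (y := uv) (by rw [tgt_inv, hu])
  have H2 := comp_rotate_left H1
  rw [SGroupoid.inv_inv] at H2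
  set v := inv u ⊙ uv
  have hv : g v = y.base := SGroupoid.left_cancel (hu' ▸ huv ▸ hg.comp H2) h.base
  have H3 := comp_mul (x := v) (y := t) (by rw [← tgt_eq_of_comp H2, tgt_eq_src H])
  have hvt := h'.base_of_comp hg hv ht H3
  have H4 : SGroupoid.Comp u (v ⊙ t) w := SGroupoid.assoc H2 H3 H
  exact SGroupoid.assoc' (h.sec hu' hv huv H2) (h'.sec hv ht hvt H3) (h''.sec hu' hvt hw H4)

/-- The value at `w` is computed from one factorization `w = u ⊙ v`. Another factorization differs
by an arrow `m` over the unit `c.base`, and `p` and `q` both absorb `c`, so the factor `c.sec m` can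
be moved across and the value is independent of the choice. -/
lemma exists_composes (hf : IsFunctor f) (h : Composes p c p) (h' : Composes c q q) :
    ∃ r, Composes p q r := by
  have hpq : tgt p.base = src q.base := by rw [← eq_tgt h.base, eq_src h'.base]
  have key (w : A) (hw : g w = p.base ⊙ q.base) : ∃ y, f y = w ∧
      ∀ u v (hu : g u = p.base) (hv : g v = q.base), SGroupoid.Comp u v w →
        SGroupoid.Comp (p.sec u hu) (q.sec v hv) y := by
    obtain ⟨u, hu, hu'⟩ := hg'.exists_src_eq hg (a := w) (b := p.base)
      (by rw [hw, src_mul hpq])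
    have H1 := comp_mul (x := inv u) (y := w) (by rw [tgt_inv, hu])
    have H2 := comp_rotate_left H1
    rw [SGroupoid.inv_inv] at H2
    set v := inv u ⊙ w
    have hv : g v = q.base := SGroupoid.left_cancel (hu' ▸ hg.comp H2) (hw ▸ comp_mul hpq)
    have hm (u : A) (hu : g u = p.base) : g (tgt u) = c.base := by
      rw [hg.map_tgt, hu, eq_tgt h.base]
    have e : tgt (p.sec u hu') = src (q.sec v hv) := by
      rw [← eq_tgt (h.sec hu' (hm u hu') hu' (comp_tgt u)),
        eq_src (h'.sec (hm u hu') hv hv (tgt_eq_src H2 ▸ comp_src v))]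
    refine ⟨p.sec u hu' ⊙ q.sec v hv, ?_, fun u₁ v₁ hu₁ hv₁ H => ?_⟩
    · rw [hf.map_mul e, p.map_sec, q.map_sec, (comp_iff.1 H2).2]
    · have E1 := comp_mul (x := inv u) (y := u₁) (by rw [tgt_inv, hu, src_eq_of_comp H])
      have E2 := comp_rotate_left E1
      rw [SGroupoid.inv_inv] at E2
      set m := inv u ⊙ u₁
      have hm : g m = c.base := SGroupoid.left_cancel (hg.comp E2) (hu₁.symm ▸ hu'.symm ▸ h.base)
      have E3 : SGroupoid.Comp m v₁ v := by
        have := comp_mul (x := m) (y := v₁) (by rw [← tgt_eq_of_comp E2, tgt_eq_src H])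
        rwa [← SGroupoid.left_cancel (SGroupoid.assoc E2 this H) H2]
      exact SGroupoid.assoc' (h.sec hu' hm hu₁ E2) (h'.sec hm hv₁ hv E3) (comp_mul e)
  choose s hs hs' using key
  exact ⟨⟨p.base ⊙ q.base, s, hs⟩, comp_mul hpq, fun {u v w} hu hv hw H => hs' w hw u v hu hv H⟩

/-- This identifies the target of `p` with the source of `q`. To compare the two units at `m`,
extend `m` to a composable triple `u`, `m`, `v` over the bases and cancel in the associativity of
the values. -/
lemma Composes.unit_eq (h : Composes p q r) (hc : Composes p c p) (hx : Composes x q q) :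
    c = x := by
  have e : c.base = x.base := by rw [eq_tgt hc.base, eq_src hx.base, tgt_eq_src h.base]
  refine ext' e fun m hm hm' => ?_
  have hm₁ : g (src m) = c.base := by
    rw [hg.map_src, hm, eq_tgt hc.base, src_tgt]
  have hm₂ : g (tgt m) = c.base := by
    rw [hg.map_tgt, hm, eq_tgt hc.base, tgt_tgt]
  obtain ⟨u, hu, hu'⟩ := hg'.exists_tgt_eq hg (a := src m) (b := p.base)
    (by rw [hm₁, eq_tgt hc.base, src_tgt])
  obtain ⟨v, hv, hv'⟩ := hg'.exists_src_eq hg (a := tgt m) (b := q.base)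
    (by rw [hm₂, e, eq_src hx.base, src_src])
  rw [src_src] at hu
  rw [src_tgt] at hv
  have H1 := comp_mul hu
  have H2 := comp_mul hv.symm
  have h1 := hc.base_of_comp hg hu' hm H1
  have h2 := hx.base_of_comp hg hm' hv' H2
  have H3 := comp_mul (x := u ⊙ m) (y := v) (by rw [tgt_mul hu, hv])
  have h3 := h.base_of_comp hg h1 hv' H3
  have H4 := SGroupoid.assoc H1 H2 H3
  have E1 := hc.sec hu' hm h1 H1
  have E2 := h.sec h1 hv' h3 H3
  have E3 := comp_mul (x := c.sec m hm) (y := q.sec v hv')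
    (by rw [← tgt_eq_of_comp E1, tgt_eq_src E2])
  rw [SGroupoid.left_cancel (SGroupoid.assoc E1 E3 E2) (h.sec hu' h2 h3 H4)] at E3
  exact SGroupoid.right_cancel E3 (hx.sec hm' hv' h2 H2)

end

/-- The inverse of a section. -/
noncomputable def inverse (hf : IsFunctor f) (hg : IsFunctor g) (p : FiberSection f g) :
    FiberSection f g where
  base := inv p.base
  sec a h := inv (p.sec (inv a) (by rw [hg.map_inv, h, SGroupoid.inv_inv]))
  map_sec a h := by rw [hf.map_inv, p.map_sec, SGroupoid.inv_inv]

lemma Composes.inverse {p d : FiberSection f g} (hf : IsFunctor f) (hg : IsFunctor g)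
    (h : Composes d p p) : Composes p (p.inverse hf hg) d where
  base := comp_rotate_right h.base
  sec {u v w} hu hv hw H := comp_rotate_right
    (h.sec hw (by rw [hg.map_inv, hv]; exact SGroupoid.inv_inv _) hu (comp_rotate_right H))

lemma Composes.inverse_left {p c : FiberSection f g} (hf : IsFunctor f) (hg : IsFunctor g)
    (h : Composes p c p) : Composes c (p.inverse hf hg) (p.inverse hf hg) where
  base := by
    exact comp_rotate_right (comp_rotate_left h.base)
  sec {u v w} hu hv hw H := comp_rotate_right (comp_rotate_left
    (h.sec (by rw [hg.map_inv, hw]; exact SGroupoid.inv_inv _) hu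
      (by rw [hg.map_inv, hv]; exact SGroupoid.inv_inv _)
      (comp_rotate_left (comp_rotate_right H))))

lemma Composes.inverse_right {p d : FiberSection f g} (hf : IsFunctor f) (hg : IsFunctor g)
    (h : Composes d p p) : Composes (p.inverse hf hg) d (p.inverse hf hg) where
  base := comp_rotate_left (comp_rotate_right h.base)
  sec {u v w} hu hv hw H := comp_rotate_left (comp_rotate_right
    (h.sec hv (by rw [hg.map_inv, hw]; exact SGroupoid.inv_inv _)
      (by rw [hg.map_inv, hu]; exact SGroupoid.inv_inv _)
      (comp_rotate_right (comp_rotate_left H))))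

end FiberSection

/-- The arrows of the dependent product of `f` along `g`: the sections having a source and
a target. -/
@[ext]
structure PiArrow {Y A B : Type*} [SGroupoid Y] [SGroupoid A] [SGroupoid B] (f : Y → A)
    (g : A → B) where
  toFiberSection : FiberSection f g
  exists_src : ∃ d : FiberSection f g, d.Composes d d ∧
    d.Composes toFiberSection toFiberSection
  exists_tgt : ∃ c : FiberSection f g, c.Composes c c ∧
    toFiberSection.Composes c toFiberSection

namespace PiArrow

section

variable {Y A B : Type*} [SGroupoid Y] [SGroupoid A] [SGroupoid B] {f : Y → A} {g : A → B}

/-- The section given by an arrow which is its own source and target. -/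
def ofUnit {d : FiberSection f g} (h : d.Composes d d) : PiArrow f g := ⟨d, ⟨d, h, h⟩, ⟨d, h, h⟩⟩

/-- The groupoid structure on the dependent product along an isofibration. -/
@[reducible]
def sGroupoid (hf : IsFunctor f) (hg : IsFunctor g) (hg' : IsIsofibration g) :
    SGroupoid (PiArrow f g) where
  Comp p q r := p.toFiberSection.Composes q.toFiberSection r.toFiberSection
  comp_unique h h' := PiArrow.ext (h.unique hg hg' h')
  left_cancel h h' := PiArrow.ext (h.left_cancel hg hg' h')
  right_cancel h h' := PiArrow.ext (h.right_cancel hg hg' h')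
  exists_src p := by
    obtain ⟨d, hd, hd'⟩ := p.exists_src
    exact ⟨ofUnit hd, hd, hd'⟩
  exists_tgt p := by
    obtain ⟨c, hc, hc'⟩ := p.exists_tgt
    exact ⟨ofUnit hc, hc, hc'⟩
  exists_comp {p c q} h h' := by
    obtain ⟨r, hr⟩ := FiberSection.exists_composes hg hg' hf h h'
    obtain ⟨d, hd, hd'⟩ := p.exists_src
    obtain ⟨e, he, he'⟩ := q.exists_tgt
    exact ⟨⟨r, ⟨d, hd, hd'.assoc hg hg' hr hr⟩, ⟨e, he, hr.assoc' hg hg' he' hr⟩⟩, hr⟩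
  exists_mid {p q r} h := by
    obtain ⟨c, hc, hc'⟩ := p.exists_tgt
    obtain ⟨d, hd, hd'⟩ := q.exists_src
    obtain rfl := h.unit_eq hg hg' hc' hd'
    exact ⟨ofUnit hc, hc', hd'⟩
  assoc h h' h'' := h.assoc hg hg' h' h''
  assoc' h h' h'' := h.assoc' hg hg' h' h''
  exists_inv p := by
    obtain ⟨d, hd, hd'⟩ := p.exists_src
    obtain ⟨c, hc, hc'⟩ := p.exists_tgt
    exact ⟨⟨p.toFiberSection.inverse hf hg, ⟨c, hc, hc'.inverse_left hf hg⟩,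
      ⟨d, hd, hd'.inverse_right hf hg⟩⟩, ofUnit hd, hd'.inverse hf hg, hd'⟩

end

section

variable {Y A B : Type*} [InvGroupoid Y] [InvGroupoid A] [InvGroupoid B] {f : Y → A} {g : A → B}

/-- The involution on sections. -/
def conj (hf : IsEquivariant f) (hg : IsEquivariant g) (p : FiberSection f g) :
    FiberSection f g where
  base := σ p.base
  sec a h := σ (p.sec (σ a) (by rw [hg.map_σ, h, σ_σ]))
  map_sec a h := by rw [hf.map_σ, p.map_sec, σ_σ]

lemma conj_conj (hf : IsEquivariant f) (hg : IsEquivariant g) (p : FiberSection f g) :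
    conj hf hg (conj hf hg p) = p := by
  refine FiberSection.ext' (σ_σ p.base) fun a ha ha' => ?_
  change σ (σ (p.sec (σ (σ a)) _)) = _
  rw [σ_σ]
  congr 1
  exact σ_σ a

lemma composes_conj (hf : IsEquivariant f) (hg : IsEquivariant g) {p q r : FiberSection f g}
    (h : p.Composes q r) : (conj hf hg p).Composes (conj hf hg q) (conj hf hg r) where
  base := comp_σ h.base
  sec {a b c} ha hb hc H := comp_σ (h.sec (by rw [hg.map_σ, ha]; exact σ_σ _)
    (by rw [hg.map_σ, hb]; exact σ_σ _) (by rw [hg.map_σ, hc]; exact σ_σ _) (comp_σ H))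

/-- The dependent product, as a groupoid with involution. -/
@[reducible]
def invGroupoid (hf : IsEquivariant f) (hg : IsEquivariant g) (hg' : IsIsofibration g) :
    InvGroupoid (PiArrow f g) where
  toSGroupoid := sGroupoid hf.toIsFunctor hg.toIsFunctor hg'
  σ p := ⟨conj hf hg p.toFiberSection,
    let ⟨d, hd, hd'⟩ := p.exists_src
    ⟨conj hf hg d, composes_conj hf hg hd, composes_conj hf hg hd'⟩,
    let ⟨c, hc, hc'⟩ := p.exists_tgt
    ⟨conj hf hg c, composes_conj hf hg hc, composes_conj hf hg hc'⟩⟩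
  σ_σ _ := PiArrow.ext (conj_conj hf hg _)
  comp_σ h := composes_conj hf hg h

end

/-! ### Dependent products of discrete fibrations -/

section Discrete

variable {Y A B : Type*} [SGroupoid Y] [SGroupoid A] [SGroupoid B] {f : Y → A} {g : A → B}

lemma _root_.TTFC.IsDiscreteFibration.src_eq_self {M N : Type*} [SGroupoid M] [SGroupoid N]
    {q : M → N} (hq : IsDiscreteFibration q) (hq' : IsFunctor q) {x : M} (h : src (q x) = q x) :
    src x = x :=
  hq.ext hq' (src_src x) (by rw [hq'.map_src, h])

lemma _root_.TTFC.IsDiscreteFibration.ext_tgt {M N : Type*} [SGroupoid M] [SGroupoid N] {q : M → N}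
    (hq : IsDiscreteFibration q) (hq' : IsFunctor q) {m m' : M} (h : tgt m = tgt m')
    (h' : q m = q m') : m = m' := by
  rw [← SGroupoid.inv_inv m, ← SGroupoid.inv_inv m']
  congr 1
  exact hq.ext hq' (by simpa) (by rw [hq'.map_inv, hq'.map_inv, h'])

/-- A section over `n` with source `p` has no freedom: its value at `a` must be the unique lift of
`a` starting at the value of `p` at `src a`. What remains is to see that these lifts have a target
section. -/
lemma isDiscreteFibration_base (hf : IsFunctor f) (hg : IsFunctor g) (hf' : IsDiscreteFibration f)
    (hg' : IsDiscreteFibration g) :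
    letI := sGroupoid hf hg hg'.isIsofibration
    IsDiscreteFibration (fun p : PiArrow f g => p.toFiberSection.base) := by
  let := sGroupoid hf hg hg'.isIsofibration
  have hb : IsFunctor (fun p : PiArrow f g => p.toFiberSection.base) := ⟨fun h => h.base⟩
  have hsrc (m : PiArrow f g) (a : A) (h : g a = m.toFiberSection.base)
      (h' : g (src a) = (src m).toFiberSection.base) :
      src (m.toFiberSection.sec a h) = (src m).toFiberSection.sec (src a) h' :=
    (eq_src ((comp_src m).sec h' h h (comp_src a))).symm
  intro p n hp hn
  replace hn : src n = p.toFiberSection.base := hn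
  have hd (a : A) (h : g a = n) : g (src a) = p.toFiberSection.base := by
    rw [hg.map_src, h, hn]
  have hlift (a : A) (h : g a = n) : ∃ y, src y = p.toFiberSection.sec (src a) (hd a h) ∧
      f y = a := by
    refine (hf' _ _ ?_ ?_).exists
    · have := hsrc p (src a) (hd a h) (by rw [src_src, hp, hd a h])
      rw [this]
      congr 1
      · rw [hp]
      · exact src_src a
    · rw [p.toFiberSection.map_sec]
  choose s hs hs' using hlift
  -- The target section is needed on arrows over `tgt n`, which are identities because `g` is
  -- discrete. Each is the end of exactly one arrow over `n`, and the lift of that arrow determines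
  -- the value there.
  have hex (a : A) (h : g a = tgt n) : ∃ a', tgt a' = a ∧ g a' = n := by
    obtain ⟨a', h1, h2⟩ := hg'.isIsofibration.exists_tgt_eq hg (a := a) (b := n)
      (by rw [h, src_tgt])
    exact ⟨a', by rw [h1, hg'.src_eq_self hg (by rw [h, src_tgt])], h2⟩
  choose t ht ht' using hex
  let m₀ : FiberSection f g := ⟨n, s, hs'⟩
  let c₀ : FiberSection f g := ⟨tgt n, fun a h => tgt (s (t a h) (ht' a h)), fun a h => by
    rw [hf.map_tgt, hs', ht]⟩
  have hc : c₀.Composes c₀ c₀ := by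
    refine ⟨comp_tgt_tgt n, fun {a b c} ha hb hc H => ?_⟩
    have ea := hg'.src_eq_self hg (x := a) (by rw [ha, src_tgt])
    have eb := hg'.src_eq_self hg (x := b) (by rw [hb, src_tgt])
    obtain rfl : a = b := by
      rw [← ea, ← tgt_src, ea, tgt_eq_src H, eb]
    obtain rfl : a = c := by
      have := src_mul_self a
      rw [ea] at this
      rw [← (comp_iff.1 H).2, this]
    exact comp_tgt_tgt _
  have hm : m₀.Composes c₀ m₀ := by
    refine ⟨comp_tgt n, fun {a b c} ha hb hc H => ?_⟩
    have eb := hg'.src_eq_self hg (x := b) (by rw [hb, src_tgt])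
    obtain rfl : tgt a = b := by rw [tgt_eq_src H, eb]
    obtain rfl : a = c := comp_unique (comp_tgt a) H
    have : t (tgt a) hb = a := hg'.ext_tgt hg (ht _ _) (by rw [ht']; exact ha.symm)
    have e : c₀.sec (tgt a) hb = tgt (s a ha) := by
      change tgt (s (t (tgt a) hb) _) = _
      congr 2
    rw [e]
    exact comp_tgt _
  have hpm : p.toFiberSection.Composes m₀ m₀ := by
    refine ⟨hn ▸ comp_src n, fun {a b c} ha hb hc H => ?_⟩
    have ea := hg'.src_eq_self hg (x := a) (by rw [ha, ← hn, src_src])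
    obtain rfl : a = src b := by
      rw [← tgt_eq_src H, ← ea, tgt_src]
    obtain rfl : b = c := comp_unique (comp_src b) H
    rw [show p.toFiberSection.sec (src b) ha = src (s b hb) from (hs b hb).symm]
    exact comp_src _
  have hpp : p.toFiberSection.Composes p.toFiberSection p.toFiberSection := by
    have := comp_src_src p
    rw [hp] at this
    exact this
  refine ⟨⟨m₀, ⟨_, hpp, hpm⟩, ⟨c₀, hc, hm⟩⟩, ⟨?_, rfl⟩, ?_⟩
  · exact (eq_src (show SGroupoid.Comp p _ _ from hpm)).symm
  · rintro m ⟨rfl, hmn⟩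
    refine PiArrow.ext (FiberSection.ext' hmn fun a ha ha' => ?_)
    refine hf'.ext hf ?_ ?_
    · rw [hsrc m a ha (hd a ha')]
      exact (hs a ha').symm
    · exact (m.toFiberSection.map_sec a ha).trans (hs' a ha').symm

end Discrete

end PiArrow

/-! ### Arrows of groupoids with involution -/

/-- The arrows of a category. -/
structure Arr (C : Type u) [Category.{u} C] : Type u where
  dom : C
  cod : C
  hom : dom ⟶ cod

namespace Arr

section

variable {C D : Type u} [Category.{u} C] [Category.{u} D]

/-- The composition relation of the arrows of a category. -/
inductive Composes : Arr C → Arr C → Arr C → Prop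
  | mk {x y z : C} (f : x ⟶ y) (g : y ⟶ z) : Composes ⟨x, y, f⟩ ⟨y, z, g⟩ ⟨x, z, f ≫ g⟩

lemma mk_inj {x y : C} {f g : x ⟶ y} (h : Arr.mk x y f = Arr.mk x y g) : f = g := by
  simpa using h

lemma composes_mk {x y z : C} {f : x ⟶ y} {g : y ⟶ z} {h : x ⟶ z} (e : f ≫ g = h) :
    Composes ⟨x, y, f⟩ ⟨y, z, g⟩ ⟨x, z, h⟩ := e ▸ .mk f g

lemma Composes.comp_eq {x y z : C} {f : x ⟶ y} {g : y ⟶ z} {h : x ⟶ z}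
    (H : Composes ⟨x, y, f⟩ ⟨y, z, g⟩ ⟨x, z, h⟩) : f ≫ g = h := by
  generalize hh : Arr.mk x z h = k at H
  cases H
  exact (mk_inj hh).symm

lemma Composes.exists_eq {a b c : Arr C} (H : Composes a b c) :
    ∃ (x y z : C) (f : x ⟶ y) (g : y ⟶ z), a = ⟨x, y, f⟩ ∧ b = ⟨y, z, g⟩ ∧ c = ⟨x, z, f ≫ g⟩ := by
  cases H
  exact ⟨_, _, _, _, _, rfl, rfl, rfl⟩

/-- The action of a functor on arrows. -/
def map (F : C ⥤ D) (a : Arr C) : Arr D := ⟨F.obj a.dom, F.obj a.cod, F.map a.hom⟩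

lemma composes_map (F : C ⥤ D) {a b c : Arr C} (h : Composes a b c) :
    Composes (map F a) (map F b) (map F c) := by
  cases h
  exact composes_mk (F.map_comp _ _).symm

lemma functor_ext {F G : C ⥤ D} (h : ∀ a, map F a = map G a) : F = G := by
  refine Functor.hext (fun x => congrArg Arr.dom (h ⟨x, x, 𝟙 x⟩)) fun x y f => ?_
  exact (Arr.mk.inj (h ⟨x, y, f⟩)).2.2

end

section

variable {C D : Type u} [Groupoid.{u} C] [Groupoid.{u} D]

instance : SGroupoid (Arr C) where
  Comp := Composes
  comp_unique h h' := by
    cases h; cases h'; rfl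
  left_cancel h h' := by
    cases h
    obtain ⟨x, y, z, f, g, h1, rfl, h2⟩ := h'.exists_eq
    cases h1
    cases congrArg Arr.cod h2
    rw [(cancel_epi _).1 (mk_inj h2)]
  right_cancel h h' := by
    cases h
    obtain ⟨x, y, z, f, g, rfl, h1, h2⟩ := h'.exists_eq
    cases h1
    cases congrArg Arr.dom h2
    rw [(cancel_mono _).1 (mk_inj h2)]
  exists_src a := ⟨⟨a.dom, a.dom, 𝟙 _⟩, composes_mk (Category.id_comp _),
    composes_mk (Category.id_comp _)⟩
  exists_tgt a := ⟨⟨a.cod, a.cod, 𝟙 _⟩, composes_mk (Category.id_comp _),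
    composes_mk (Category.comp_id _)⟩
  exists_comp {a c b} h h' := by
    obtain ⟨x, y, z, f, g, rfl, rfl, h2⟩ := h.exists_eq
    cases congrArg Arr.cod h2
    obtain ⟨x', y', z', f', g', h3, rfl, h4⟩ := h'.exists_eq
    cases congrArg Arr.dom h4
    cases congrArg Arr.dom h3
    exact ⟨_, .mk _ _⟩
  exists_mid h := by
    cases h
    exact ⟨⟨_, _, 𝟙 _⟩, composes_mk (Category.comp_id _), composes_mk (Category.id_comp _)⟩
  assoc h h' h'' := by
    cases h; cases h'; cases h''
    exact composes_mk (Category.assoc _ _ _).symm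
  assoc' h h' h'' := by
    cases h; cases h'; cases h''
    exact composes_mk (Category.assoc _ _ _)
  exists_inv a := ⟨⟨a.cod, a.dom, Groupoid.inv a.hom⟩, ⟨a.dom, a.dom, 𝟙 _⟩,
    composes_mk (Groupoid.comp_inv _), composes_mk (Category.id_comp _)⟩

lemma isFunctor_map (F : C ⥤ D) : IsFunctor (map F) := ⟨fun h => composes_map F h⟩

lemma src_eq (a : Arr C) : src a = ⟨a.dom, a.dom, 𝟙 _⟩ :=
  (eq_src (composes_mk (Category.id_comp _) : Composes _ _ _)).symm

lemma tgt_eq (a : Arr C) : tgt a = ⟨a.cod, a.cod, 𝟙 _⟩ :=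
  (eq_tgt (composes_mk (Category.comp_id _) : Composes _ _ _)).symm

lemma map_id_arr (F : C ⥤ D) (x : C) : map F ⟨x, x, 𝟙 x⟩ = ⟨F.obj x, F.obj x, 𝟙 _⟩ := by
  rw [map, F.map_id]

/-- Functors which are given by their action on arrows. -/
lemma exists_functor {φ : Arr C → Arr D} (hφ : IsFunctor φ) : ∃ F : C ⥤ D, ∀ a, map F a = φ a := by
  -- Objects are sent to the domains of the images of their identities. Retyping `φ a` between these
  -- objects confines all equalities of objects to this step.
  have key (a : Arr C) : ∃ h : (φ ⟨a.dom, a.dom, 𝟙 _⟩).dom ⟶ (φ ⟨a.cod, a.cod, 𝟙 _⟩).dom,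
      φ a = ⟨_, _, h⟩ := by
    have h1 : (φ ⟨a.dom, a.dom, 𝟙 _⟩).dom = (φ a).dom := by
      rw [← src_eq, hφ.map_src, src_eq]
    have h2 : (φ ⟨a.cod, a.cod, 𝟙 _⟩).dom = (φ a).cod := by
      rw [← tgt_eq, hφ.map_tgt, tgt_eq]
    rw [h1, h2]
    exact ⟨(φ a).hom, rfl⟩
  choose m hm using key
  refine ⟨{ obj x := (φ ⟨x, x, 𝟙 x⟩).dom
            map f := m ⟨_, _, f⟩
            map_id x := ?_
            map_comp {x y z} f g := ?_ }, fun a => (hm a).symm⟩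
  · have := hφ.comp (composes_mk (Category.id_comp (𝟙 x)) : Composes _ _ _)
    rw [hm ⟨x, x, 𝟙 x⟩] at this
    rw [← cancel_epi (m ⟨x, x, 𝟙 x⟩), Category.comp_id]
    exact this.comp_eq
  · have := hφ.comp (Composes.mk f g : Composes _ _ _)
    rw [hm ⟨x, y, f⟩, hm ⟨y, z, g⟩, hm ⟨x, z, f ≫ g⟩] at this
    exact this.comp_eq.symm

/-- Identity arrows encode objects, so injectivity on arrows amounts to faithfulness with
injectivity on objects, and the other two conditions are fullness and essential surjectivity. -/
lemma isAcyclicCofibration_map_iff (F : C ⥤ D) :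
    IsAcyclicCofibration (map F) ↔ F.IsEquivalence ∧ Function.Injective F.obj := by
  refine ⟨fun h => ?_, fun ⟨_, h⟩ => ?_⟩
  · have hF : Function.Injective F.obj := fun x y hxy => by
      have : (⟨x, x, 𝟙 x⟩ : Arr C) = ⟨y, y, 𝟙 y⟩ := h.injective (by
        rw [map_id_arr, map_id_arr, hxy])
      exact congrArg Arr.dom this
    refine ⟨⟨⟨fun {x y f g} e => mk_inj (h.injective (by simp only [map, e]))⟩,
      ⟨fun {x y} f => ?_⟩, ⟨fun d => ?_⟩⟩, hF⟩
    · obtain ⟨⟨x', y', f'⟩, hf⟩ := h.full ⟨_, _, f⟩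
        ⟨⟨x, x, 𝟙 x⟩, by rw [map_id_arr, src_eq]⟩ ⟨⟨y, y, 𝟙 y⟩, by rw [map_id_arr, tgt_eq]⟩
      obtain rfl := hF (congrArg Arr.dom hf)
      obtain rfl := hF (congrArg Arr.cod hf)
      exact ⟨f', mk_inj hf⟩
    · obtain ⟨k, ⟨a, ha⟩, hk⟩ := h.essSurj ⟨d, d, 𝟙 d⟩
      rw [src_eq] at ha hk
      rw [tgt_eq] at hk
      obtain ⟨x, y, k⟩ := k
      obtain rfl : F.obj a.dom = x := congrArg Arr.dom ha
      obtain rfl : y = d := congrArg Arr.dom hk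
      exact ⟨a.dom, ⟨asIso k⟩⟩
  · refine ⟨isFunctor_map F, ?_, ?_, ?_⟩
    · rintro ⟨x, y, f⟩ ⟨x', y', f'⟩ hf
      obtain rfl := h (congrArg Arr.dom hf)
      obtain rfl := h (congrArg Arr.cod hf)
      exact congrArg (Arr.mk x y) (F.map_injective (mk_inj hf))
    · rintro ⟨x, y, f⟩ ⟨a, ha⟩ ⟨b, hb⟩
      rw [src_eq] at ha
      rw [tgt_eq] at hb
      obtain rfl : F.obj a.dom = x := congrArg Arr.dom ha
      obtain rfl : F.obj b.dom = y := congrArg Arr.dom hb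
      exact ⟨⟨_, _, F.preimage f⟩, by rw [map, F.map_preimage]⟩
    · rintro ⟨x, y, f⟩
      refine ⟨⟨_, x, (F.objObjPreimageIso x).hom⟩, ⟨⟨_, _, 𝟙 (F.objPreimage x)⟩, ?_⟩, ?_⟩
      · rw [map_id_arr, src_eq]
      · rw [tgt_eq, src_eq]

end

end Arr

/-! ### Translation of `GpdZ2` into sets of arrows with involution -/

/-- The nontrivial endomorphism of the object of `BZ2`. -/
def BZ2.gen : (SingleObj.star (Multiplicative (ZMod 2)) : BZ2) ⟶ SingleObj.star _ :=
  (Multiplicative.ofAdd (1 : ZMod 2) : Multiplicative (ZMod 2))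

lemma BZ2.gen_comp_gen : BZ2.gen ≫ BZ2.gen = 𝟙 _ := rfl

lemma BZ2.eq_id_or_eq_gen (g : (SingleObj.star (Multiplicative (ZMod 2)) : BZ2) ⟶ SingleObj.star _) :
    g = 𝟙 _ ∨ g = BZ2.gen := by
  have : ∀ g : Multiplicative (ZMod 2), g = 1 ∨ g = Multiplicative.ofAdd 1 := by decide
  exact this g

/-- The set of arrows of a groupoid with involution. -/
def arr (X : GpdZ2.{u}) : Type u := Arr (X.obj (SingleObj.star _))

instance (X : GpdZ2.{u}) : InvGroupoid (arr X) where
  toSGroupoid := inferInstanceAs (SGroupoid (Arr (X.obj (SingleObj.star _))))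
  σ := Arr.map (X.map BZ2.gen)
  σ_σ a := by
    have h : X.map BZ2.gen ≫ X.map BZ2.gen = 𝟙 _ := by
      rw [← X.map_comp, BZ2.gen_comp_gen, X.map_id]
    exact congrArg (fun F => Arr.map F a) h
  comp_σ h := Arr.composes_map _ h

/-- The action of a morphism of `GpdZ2` on arrows. -/
def arrMap {X Y : GpdZ2.{u}} (f : X ⟶ Y) : arr X → arr Y := Arr.map (f.app (SingleObj.star _))

lemma arrMap_id (X : GpdZ2.{u}) (a : arr X) : arrMap (𝟙 X) a = a := rfl

lemma arrMap_comp {X Y Z : GpdZ2.{u}} (f : X ⟶ Y) (g : Y ⟶ Z) (a : arr X) :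
    arrMap (f ≫ g) a = arrMap g (arrMap f a) := rfl

lemma isEquivariant_arrMap {X Y : GpdZ2.{u}} (f : X ⟶ Y) : IsEquivariant (arrMap f) where
  comp h := Arr.composes_map _ h
  map_σ a := congrArg (fun F => Arr.map F a) (f.naturality BZ2.gen)

lemma hom_ext_arr {X Y : GpdZ2.{u}} {f g : X ⟶ Y} (h : ∀ a, arrMap f a = arrMap g a) : f = g := by
  refine NatTrans.ext (funext fun a => ?_)
  obtain rfl : a = SingleObj.star _ := rfl
  exact Arr.functor_ext h

lemma exists_hom {X Y : GpdZ2.{u}} {φ : arr X → arr Y} (hφ : IsEquivariant φ) :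
    ∃ f : X ⟶ Y, ∀ a, arrMap f a = φ a := by
  obtain ⟨F, hF⟩ : ∃ F : X.obj (SingleObj.star _) ⟶ Y.obj (SingleObj.star _),
      ∀ a, Arr.map F a = φ a :=
    Arr.exists_functor (C := X.obj (SingleObj.star _)) (D := Y.obj (SingleObj.star _)) (φ := φ)
      ⟨fun h => hφ.comp h⟩
  have h (g : (SingleObj.star (Multiplicative (ZMod 2)) : BZ2) ⟶ SingleObj.star _) :
      X.map g ≫ F = F ≫ Y.map g := by
    obtain rfl | rfl := BZ2.eq_id_or_eq_gen g
    · rw [X.map_id, Y.map_id]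
      rfl
    · exact Arr.functor_ext fun a =>
        (hF _).trans ((hφ.map_σ a).trans (congrArg (σ (M := arr Y)) (hF a).symm))
  exact ⟨{ app := fun _ => F, naturality := fun _ _ g => h g }, hF⟩

lemma injAcyclicCofibrations_iff {X Y : GpdZ2.{u}} (i : X ⟶ Y) :
    injAcyclicCofibrations i ↔ IsAcyclicCofibration (arrMap i) := by
  have := Arr.isAcyclicCofibration_map_iff (C := X.obj (SingleObj.star _))
    (D := Y.obj (SingleObj.star _)) (i.app (SingleObj.star _))
  refine Iff.trans ⟨fun h => ?_, fun h => ?_⟩ this.symm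
  · exact ⟨h.1 _, h.2 _⟩
  · exact ⟨fun _ => h.1, fun _ => h.2⟩

/-- Morphisms of `GpdZ2` are exactly the equivariant maps of arrows, so a lift of arrow maps is a
lift in `GpdZ2`. -/
lemma injFibrations_of_hasAcyclicRLP {X Y : GpdZ2.{u}} {q : X ⟶ Y} (hq : HasAcyclicRLP (arrMap q)) :
    injFibrations q := by
  intro A B i hi
  refine ⟨fun {a b} sq => ?_⟩
  obtain ⟨l, hl, hl', hl''⟩ := hq (arrMap i) (arrMap a) (arrMap b) (isEquivariant_arrMap i)
    ((injAcyclicCofibrations_iff i).1 hi) (isEquivariant_arrMap a) (isEquivariant_arrMap b)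
    fun x => congrArg (fun f => arrMap f x) sq.w
  obtain ⟨l, rfl⟩ : ∃ f : B ⟶ X, arrMap f = l := by
    obtain ⟨f, hf⟩ := exists_hom hl
    exact ⟨f, funext hf⟩
  exact ⟨⟨l, hom_ext_arr hl', hom_ext_arr hl''⟩⟩

/-! ### Realization of arrow sets as objects of `GpdZ2` -/

section Realization

variable (M : Type u) [InvGroupoid M]

/-- The objects of the groupoid described by `M`. -/
structure Realization where
  unit : M
  src_unit : src unit = unit

noncomputable instance : Groupoid.{u} (Realization M) where
  Hom x y := {m : M // src m = x.unit ∧ tgt m = y.unit}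
  id x := ⟨x.unit, x.src_unit, by rw [← x.src_unit, tgt_src]⟩
  comp f g := ⟨f.1 ⊙ g.1, by rw [src_mul (by rw [f.2.2, g.2.1]), f.2.1],
    by rw [tgt_mul (by rw [f.2.2, g.2.1]), g.2.2]⟩
  inv f := ⟨inv f.1, by rw [src_inv, f.2.2], by rw [tgt_inv, f.2.1]⟩
  id_comp f := Subtype.ext (by simp only [← f.2.1, src_mul_self])
  comp_id f := Subtype.ext (by simp only [← f.2.2, mul_tgt_self])
  assoc f g h := Subtype.ext (SGroupoid.mul_assoc (by rw [f.2.2, g.2.1]) (by rw [g.2.2, h.2.1]))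
  inv_comp f := Subtype.ext ((inv_mul _).trans f.2.2)
  comp_inv f := Subtype.ext ((SGroupoid.mul_inv _).trans f.2.1)

/-- The arrows of the groupoid described by `M` are the elements of `M`. -/
def Realization.arrow (a : Arr (Realization M)) : M := a.hom.1

lemma Realization.bijective_arrow : Function.Bijective (Realization.arrow M) := by
  refine ⟨?_, fun m => ⟨⟨⟨src m, src_src m⟩, ⟨tgt m, src_tgt m⟩, ⟨m, rfl, rfl⟩⟩, rfl⟩⟩
  rintro ⟨⟨x, hx⟩, ⟨y, hy⟩, ⟨m, h1, h2⟩⟩ ⟨⟨x', hx'⟩, ⟨y', hy'⟩, ⟨m', h1', h2'⟩⟩ h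
  obtain rfl : m = m' := h
  obtain rfl : src m = x := h1
  obtain rfl : tgt m = y := h2
  obtain rfl : src m = x' := h1'
  obtain rfl : tgt m = y' := h2'
  rfl

lemma Realization.isFunctor_arrow : IsFunctor (Realization.arrow M) := ⟨fun h => by
  obtain ⟨x, y, z, f, g, rfl, rfl, rfl⟩ := Arr.Composes.exists_eq h
  exact comp_mul (f.2.2.trans g.2.1.symm)⟩

/-- The involution of the groupoid described by `M`. -/
def Realization.involution : Realization M ⥤ Realization M where
  obj x := ⟨σ x.unit, by rw [← σ_src, x.src_unit]⟩
  map f := ⟨σ f.1, by rw [← σ_src, f.2.1], by rw [← σ_tgt, f.2.2]⟩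
  map_id _ := rfl
  map_comp f g := Subtype.ext (σ_mul (by rw [f.2.2, g.2.1]))

lemma Realization.involution_involution :
    Realization.involution M ⋙ Realization.involution M = 𝟭 _ :=
  Arr.functor_ext fun _ => (Realization.bijective_arrow M).1 (σ_σ _)

/-- Constructions made on arrow sets, such as fiber products, the factorization and dependent
products, become objects of `GpdZ2` through this. -/
lemma exists_realization : ∃ (X : GpdZ2.{u}) (e : arr X → M) (e' : M → arr X),
    IsEquivariant e ∧ IsEquivariant e' ∧ (∀ x, e' (e x) = x) ∧ ∀ x, e (e' x) = x := by
  let X := ofInvolution (Grpd.of (Realization M)) (Realization.involution M)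
    (Realization.involution_involution M)
  let e : arr X → M := Realization.arrow M
  have he : IsEquivariant e := ⟨⟨fun h => (Realization.isFunctor_arrow M).comp h⟩, fun _ => rfl⟩
  let E := Equiv.ofBijective e (Realization.bijective_arrow M)
  have hE (x) : e (E.symm x) = x := E.apply_symm_apply x
  refine ⟨X, e, E.symm, he, ⟨⟨fun {x y z} h => ?_⟩, fun x => ?_⟩, E.symm_apply_apply, hE⟩
  · exact he.comp_of_injective E.injective (by rwa [hE, hE, hE])
  · exact E.injective ((hE _).trans ((congrArg σ (hE x)).symm.trans (he.map_σ _).symm))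

end Realization

/-! ### Pullbacks, factorizations and dependent products in `GpdZ2` -/

section Pullback

/-- The fiber product of groupoids with involution. -/
@[reducible]
def fiberProduct {M N B : Type*} [InvGroupoid M] [InvGroupoid N] [InvGroupoid B] {f : M → B}
    {g : N → B} (hf : IsEquivariant f) (hg : IsEquivariant g) :
    InvGroupoid {z : M × N // f z.1 = g z.2} where
  Comp x y z := SGroupoid.Comp x.1 y.1 z.1
  comp_unique h h' := Subtype.ext (comp_unique h h')
  left_cancel h h' := Subtype.ext (left_cancel h h')
  right_cancel h h' := Subtype.ext (right_cancel h h')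
  exists_src x := ⟨⟨(src x.1.1, src x.1.2), by rw [hf.map_src, hg.map_src, x.2]⟩,
    ⟨comp_src_src _, comp_src_src _⟩, comp_src _, comp_src _⟩
  exists_tgt x := ⟨⟨(tgt x.1.1, tgt x.1.2), by rw [hf.map_tgt, hg.map_tgt, x.2]⟩,
    ⟨comp_tgt_tgt _, comp_tgt_tgt _⟩, comp_tgt _, comp_tgt _⟩
  exists_comp {x c y} h h' := by
    obtain ⟨z, hz⟩ := exists_comp h h'
    exact ⟨⟨z, comp_unique (hf.comp hz.1) (x.2 ▸ y.2 ▸ hg.comp hz.2)⟩, hz⟩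
  exists_mid {x y z} h := ⟨⟨(tgt x.1.1, tgt x.1.2), by rw [hf.map_tgt, hg.map_tgt, x.2]⟩,
    ⟨comp_tgt _, comp_tgt _⟩, by
      have h1 := comp_src y.1.1
      have h2 := comp_src y.1.2
      rw [← tgt_eq_src h.1] at h1
      rw [← tgt_eq_src h.2] at h2
      exact ⟨h1, h2⟩⟩
  assoc h h' h'' := SGroupoid.assoc h h' h''
  assoc' h h' h'' := SGroupoid.assoc' h h' h''
  exists_inv x := ⟨⟨(inv x.1.1, inv x.1.2), by rw [hf.map_inv, hg.map_inv, x.2]⟩,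
    ⟨(src x.1.1, src x.1.2), by rw [hf.map_src, hg.map_src, x.2]⟩,
    ⟨comp_inv _, comp_inv _⟩, comp_src _, comp_src _⟩
  σ x := ⟨(σ x.1.1, σ x.1.2), by rw [hf.map_σ, hg.map_σ, x.2]⟩
  σ_σ x := Subtype.ext (Prod.ext (σ_σ _) (σ_σ _))
  comp_σ h := ⟨comp_σ h.1, comp_σ h.2⟩

lemma arrMap_eq {P X Y B : GpdZ2.{u}} {fst : P ⟶ X} {snd : P ⟶ Y} {f : X ⟶ B} {g : Y ⟶ B}
    (w : fst ≫ f = snd ≫ g) (p : arr P) : arrMap f (arrMap fst p) = arrMap g (arrMap snd p) :=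
  congrArg (fun k => arrMap k p) w

/-- The pair of projections is injective on arrows and hence reflects composition, so a map into `P`
defined elementwise is automatically an equivariant functor. -/
lemma isPullback_of_existsUnique {P X Y B : GpdZ2.{u}} {fst : P ⟶ X} {snd : P ⟶ Y} {f : X ⟶ B}
    {g : Y ⟶ B} (w : fst ≫ f = snd ≫ g)
    (h : ∀ x y, arrMap f x = arrMap g y → ∃! p, arrMap fst p = x ∧ arrMap snd p = y) :
    IsPullback fst snd f g := by
  have inj {p q} (h1 : arrMap fst p = arrMap fst q) (h2 : arrMap snd p = arrMap snd q) : p = q :=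
    (h _ _ (arrMap_eq w q)).unique ⟨h1, h2⟩ ⟨rfl, rfl⟩
  have hP : IsFunctor (fun p => (arrMap fst p, arrMap snd p)) :=
    ⟨fun H => ⟨(isEquivariant_arrMap fst).comp H, (isEquivariant_arrMap snd).comp H⟩⟩
  have hP' : Function.Injective (fun p => (arrMap fst p, arrMap snd p)) :=
    fun p q e => inj (congrArg Prod.fst e) (congrArg Prod.snd e)
  have lift {T : GpdZ2.{u}} (a : T ⟶ X) (b : T ⟶ Y) (e : a ≫ f = b ≫ g) :
      ∃ l : T ⟶ P, l ≫ fst = a ∧ l ≫ snd = b := by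
    choose φ hφ using fun t =>
      (h (arrMap a t) (arrMap b t) (congrArg (fun k => arrMap k t) e)).exists
    obtain ⟨l, hl⟩ := exists_hom (φ := φ) ⟨⟨fun {x y z} H => by
      refine hP.comp_of_injective hP' ?_
      simp only [hφ]
      exact ⟨(isEquivariant_arrMap a).comp H, (isEquivariant_arrMap b).comp H⟩⟩, fun x => by
      refine inj ?_ ?_
      · rw [(hφ _).1, (isEquivariant_arrMap a).map_σ, (isEquivariant_arrMap fst).map_σ, (hφ _).1]
      · rw [(hφ _).2, (isEquivariant_arrMap b).map_σ, (isEquivariant_arrMap snd).map_σ, (hφ _).2]⟩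
    exact ⟨l, hom_ext_arr fun t => by rw [arrMap_comp, hl, (hφ t).1],
      hom_ext_arr fun t => by rw [arrMap_comp, hl, (hφ t).2]⟩
  refine ⟨⟨w⟩, ⟨PullbackCone.IsLimit.mk w (fun s => (lift s.fst s.snd s.condition).choose)
    (fun s => (lift s.fst s.snd s.condition).choose_spec.1)
    (fun s => (lift s.fst s.snd s.condition).choose_spec.2) fun s m h1 h2 => ?_⟩⟩
  obtain ⟨h1', h2'⟩ := (lift s.fst s.snd s.condition).choose_spec
  exact hom_ext_arr fun t => inj
    (congrArg (fun k => arrMap k t) (h1.trans h1'.symm))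
    (congrArg (fun k => arrMap k t) (h2.trans h2'.symm))

lemma exists_isPullback {X Y B : GpdZ2.{u}} (f : X ⟶ B) (g : Y ⟶ B) :
    ∃ (P : GpdZ2.{u}) (fst : P ⟶ X) (snd : P ⟶ Y), IsPullback fst snd f g ∧
      ∀ x y, arrMap f x = arrMap g y → ∃! p, arrMap fst p = x ∧ arrMap snd p = y := by
  let := fiberProduct (isEquivariant_arrMap f) (isEquivariant_arrMap g)
  obtain ⟨P, e, e', he, he', h1, h2⟩ :=
    exists_realization {z : arr X × arr Y // arrMap f z.1 = arrMap g z.2}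
  obtain ⟨fst, hfst⟩ := exists_hom (φ := fun p => (e p).1.1)
    ⟨⟨fun h => (he.comp h).1⟩, fun x => by rw [he.map_σ]; rfl⟩
  obtain ⟨snd, hsnd⟩ := exists_hom (φ := fun p => (e p).1.2)
    ⟨⟨fun h => (he.comp h).2⟩, fun x => by rw [he.map_σ]; rfl⟩
  have h (x y) (hxy : arrMap f x = arrMap g y) : ∃! p, arrMap fst p = x ∧ arrMap snd p = y := by
    refine ⟨e' ⟨(x, y), hxy⟩, ⟨by rw [hfst, h2], by rw [hsnd, h2]⟩, fun p ⟨hp, hp'⟩ => ?_⟩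
    rw [← h1 p]
    congr 1
    rw [hfst] at hp
    rw [hsnd] at hp'
    exact Subtype.ext (Prod.ext hp hp')
  refine ⟨P, fst, snd, isPullback_of_existsUnique (hom_ext_arr fun p => ?_) h, h⟩
  rw [arrMap_comp, arrMap_comp, hfst, hsnd]
  exact (e p).2

instance : HasPullbacks GpdZ2.{u} :=
  have (X Y B : GpdZ2.{u}) (f : X ⟶ B) (g : Y ⟶ B) : HasPullback f g := by
    obtain ⟨P, fst, snd, h, -⟩ := exists_isPullback f g
    exact h.hasPullback
  hasPullbacks_of_hasLimit_cospan _

/-- Any pullback is isomorphic to the explicit fiber product, where the statement holds by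
construction. -/
lemma existsUnique_of_isPullback {P X Y B : GpdZ2.{u}} {fst : P ⟶ X} {snd : P ⟶ Y} {f : X ⟶ B}
    {g : Y ⟶ B} (h : IsPullback fst snd f g) {x : arr X} {y : arr Y}
    (hxy : arrMap f x = arrMap g y) : ∃! p, arrMap fst p = x ∧ arrMap snd p = y := by
  obtain ⟨P', fst', snd', h', H⟩ := exists_isPullback f g
  let e := h'.isoIsPullback _ _ h
  have e1 : e.hom ≫ fst = fst' := h'.isoIsPullback_hom_fst _ _ h
  have e2 : e.hom ≫ snd = snd' := h'.isoIsPullback_hom_snd _ _ h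
  have e3 : e.inv ≫ fst' = fst := h'.isoIsPullback_inv_fst _ _ h
  have e4 : e.inv ≫ snd' = snd := h'.isoIsPullback_inv_snd _ _ h
  obtain ⟨p, ⟨hp, hp'⟩, hu⟩ := H x y hxy
  refine ⟨arrMap e.hom p, ⟨by rw [← arrMap_comp, e1, hp], by rw [← arrMap_comp, e2, hp']⟩,
    fun q ⟨hq, hq'⟩ => ?_⟩
  rw [← hu (arrMap e.inv q) ⟨by rw [← arrMap_comp, e3, hq], by rw [← arrMap_comp, e4, hq']⟩,
    ← arrMap_comp, e.inv_hom_id, arrMap_id]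

lemma ext_of_isPullback {P X Y B : GpdZ2.{u}} {fst : P ⟶ X} {snd : P ⟶ Y} {f : X ⟶ B}
    {g : Y ⟶ B} (h : IsPullback fst snd f g) {p q : arr P} (h1 : arrMap fst p = arrMap fst q)
    (h2 : arrMap snd p = arrMap snd q) : p = q :=
  (existsUnique_of_isPullback h (arrMap_eq h.w q)).unique ⟨h1, h2⟩ ⟨rfl, rfl⟩

lemma comp_of_isPullback {P X Y B : GpdZ2.{u}} {fst : P ⟶ X} {snd : P ⟶ Y} {f : X ⟶ B}
    {g : Y ⟶ B} (h : IsPullback fst snd f g) {x y z : arr P}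
    (h1 : Comp (arrMap fst x) (arrMap fst y) (arrMap fst z))
    (h2 : Comp (arrMap snd x) (arrMap snd y) (arrMap snd z)) : Comp x y z :=
  have hF : IsFunctor (fun p => (arrMap fst p, arrMap snd p)) :=
    ⟨fun H => ⟨(isEquivariant_arrMap fst).comp H, (isEquivariant_arrMap snd).comp H⟩⟩
  hF.comp_of_injective (fun _ _ e => ext_of_isPullback h (congrArg Prod.fst e)
    (congrArg Prod.snd e)) ⟨h1, h2⟩

end Pullback

/-! ### Terminal object, factorizations and stability of acyclic cofibrations -/

instance : InvGroupoid PUnit.{u + 1} where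
  Comp _ _ _ := True
  comp_unique _ _ := rfl
  left_cancel _ _ := rfl
  right_cancel _ _ := rfl
  exists_src _ := ⟨⟨⟩, trivial, trivial⟩
  exists_tgt _ := ⟨⟨⟩, trivial, trivial⟩
  exists_comp _ _ := ⟨⟨⟩, trivial⟩
  exists_mid _ := ⟨⟨⟩, trivial, trivial⟩
  assoc _ _ _ := trivial
  assoc' _ _ _ := trivial
  exists_inv _ := ⟨⟨⟩, ⟨⟩, trivial, trivial⟩
  σ _ := ⟨⟩
  σ_σ _ := rfl
  comp_σ _ := trivial

lemma exists_isTerminal : ∃ (T : GpdZ2.{u}) (_ : IsTerminal T), Subsingleton (arr T) := by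
  obtain ⟨T, e, e', he, he', h1, h2⟩ := exists_realization PUnit.{u + 1}
  have hT : Subsingleton (arr T) := ⟨fun x y => by rw [← h1 x, ← h1 y]⟩
  choose l _ using fun X : GpdZ2.{u} => exists_hom (X := X) (Y := T) (φ := fun _ => e' ⟨⟩)
    ⟨⟨fun _ => he'.comp (x := ⟨⟩) (y := ⟨⟩) (z := ⟨⟩) trivial⟩, fun _ => hT.elim _ _⟩
  exact ⟨T, IsTerminal.ofUniqueHom l fun X m => hom_ext_arr fun _ => hT.elim _ _, hT⟩

instance : HasTerminal GpdZ2.{u} := by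
  obtain ⟨T, hT, -⟩ := exists_isTerminal.{u}
  exact hT.hasTerminal

lemma exists_factorization {X Y : GpdZ2.{u}} (f : X ⟶ Y) :
    ∃ (Z : GpdZ2.{u}) (i : X ⟶ Z) (q : Z ⟶ Y), injAcyclicCofibrations i ∧ injFibrations q ∧
      i ≫ q = f ∧ IsIsofibration (arrMap q) := by
  have hf := isEquivariant_arrMap f
  obtain ⟨Z, e, e', he, he', h1, h2⟩ := exists_realization (Factorization hf)
  have hi := Factorization.isAcyclicCofibration_incl hf
  have hi' := Factorization.isEquivariant_incl hf
  have hq := Factorization.isEquivariant_fst hf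
  obtain ⟨i, hi₁⟩ := exists_hom (φ := fun x => e' (Factorization.incl hf x))
    ⟨⟨fun h => he'.comp (hi'.comp h)⟩, fun x => by rw [hi'.map_σ, he'.map_σ]⟩
  obtain ⟨q, hq₁⟩ := exists_hom (φ := fun z => (e z).arr.1)
    ⟨⟨fun h => hq.comp (he.comp h)⟩, fun x => by rw [he.map_σ]; exact hq.map_σ _⟩
  have hmem (z) (h : e z ∈ Set.range (Factorization.incl hf)) : z ∈ Set.range (arrMap i) := by
    obtain ⟨x, hx⟩ := h
    exact ⟨x, by rw [hi₁, hx, h1]⟩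
  have hmem' (z) (h : z ∈ Set.range (arrMap i)) : e z ∈ Set.range (Factorization.incl hf) := by
    obtain ⟨x, rfl⟩ := h
    exact ⟨x, by rw [hi₁, h2]⟩
  refine ⟨Z, i, q, (injAcyclicCofibrations_iff i).2 ⟨(isEquivariant_arrMap i).toIsFunctor,
    fun x y h => ?_, fun n h h' => ?_, fun n => ?_⟩, injFibrations_of_hasAcyclicRLP ?_,
    hom_ext_arr fun x => ?_, ?_⟩
  · rw [hi₁, hi₁] at h
    exact hi.injective (by rw [← h2 (Factorization.incl hf x), h, h2])
  · exact hmem _ (hi.full _ (he.map_src n ▸ hmem' _ h) (he.map_tgt n ▸ hmem' _ h'))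
  · obtain ⟨k, hk, hk'⟩ := hi.essSurj (e n)
    refine ⟨e' k, hmem _ ?_, ?_⟩
    · rwa [← he'.map_src, h2]
    · rw [← he'.map_tgt, hk', he'.map_src, h1]
  · intro A B _ _ i a b hi' hi ha hb w
    obtain ⟨l, hl, hl', hl''⟩ := Factorization.hasAcyclicRLP_fst hf i (fun x => e (a x)) b hi' hi
      ⟨⟨fun h => he.comp (ha.comp h)⟩, fun x => by rw [ha.map_σ, he.map_σ]⟩ hb
      fun x => (hq₁ _).symm.trans (w x)
    refine ⟨fun y => e' (l y), ⟨⟨fun h => he'.comp (hl.comp h)⟩, fun x => ?_⟩, fun x => ?_,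
      fun y => ?_⟩
    · rw [hl.map_σ, he'.map_σ]
    · exact (congrArg e' (hl' x)).trans (h1 _)
    · exact (hq₁ _).trans ((congrArg (fun z => z.arr.1) (h2 (l y))).trans (hl'' y))
  · rw [arrMap_comp, hi₁, hq₁, h2]
    rfl
  · intro x n hx hn
    rw [hq₁] at hn
    obtain ⟨m, hm, hm'⟩ := Factorization.isIsofibration_fst hf (e x) n
      (by rw [← he.map_src, hx]) hn
    exact ⟨e' m, by rw [← he'.map_src, hm, h1], by rw [hq₁, h2, ← hm']⟩

/-- Retract argument: lifting `f` against the first factor of its own factorization exhibits `f` as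
a retract of the second, which is an isofibration. -/
lemma injFibrations.isIsofibration {X Y : GpdZ2.{u}} {f : X ⟶ Y} (hf : injFibrations f) :
    IsIsofibration (arrMap f) := by
  obtain ⟨Z, i, q, hi, -, w, hq⟩ := exists_factorization f
  have := hf i hi
  have sq : CommSq (𝟙 X) i f q := ⟨by rw [w, Category.id_comp]⟩
  intro x n hx hn
  have hr (x) : arrMap sq.lift (arrMap i x) = x := congrArg (fun k => arrMap k x) sq.fac_left
  have hr' (z) : arrMap f (arrMap sq.lift z) = arrMap q z :=
    congrArg (fun k => arrMap k z) sq.fac_right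
  obtain ⟨m, hm, hm'⟩ := hq (arrMap i x) n (by rw [← (isEquivariant_arrMap i).map_src, hx])
    (by rw [hn, ← arrMap_comp, w])
  exact ⟨arrMap sq.lift m, by rw [← (isEquivariant_arrMap sq.lift).map_src, hm, hr],
    by rw [hr', hm']⟩

/-- The image of `j` is the preimage under `b` of the image of `i`. Injectivity and fullness follow
at once; for essential surjectivity the connecting arrow is lifted along `b`, which is an
isofibration. -/
lemma injAcyclicCofibrations_of_isPullback {X' X Y' Y : GpdZ2.{u}} (j : X' ⟶ Y') (a : X' ⟶ X)
    (b : Y' ⟶ Y) (i : X ⟶ Y) (h : IsPullback j a b i) (hb : injFibrations b)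
    (hi : injAcyclicCofibrations i) : injAcyclicCofibrations j := by
  rw [injAcyclicCofibrations_iff] at hi ⊢
  have hj' := isEquivariant_arrMap j
  have hb' := isEquivariant_arrMap b
  have hmem (y : arr Y') (hy : arrMap b y ∈ Set.range (arrMap i)) : y ∈ Set.range (arrMap j) := by
    obtain ⟨x, hx⟩ := hy
    obtain ⟨z, hz, -⟩ := (existsUnique_of_isPullback h hx.symm).exists
    exact ⟨z, hz⟩
  have hmem' (y : arr Y') (hy : y ∈ Set.range (arrMap j)) : arrMap b y ∈ Set.range (arrMap i) := by
    obtain ⟨x, rfl⟩ := hy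
    exact ⟨arrMap a x, (arrMap_eq h.w x).symm⟩
  refine ⟨hj'.toIsFunctor, fun x y hxy => ?_, fun n h1 h2 => ?_, fun n => ?_⟩
  · refine (existsUnique_of_isPullback h (arrMap_eq h.w y)).unique ⟨hxy, ?_⟩ ⟨rfl, rfl⟩
    exact hi.injective (by rw [← arrMap_eq h.w, ← arrMap_eq h.w, hxy])
  · exact hmem _ (hi.full _ (hb'.map_src n ▸ hmem' _ h1) (hb'.map_tgt n ▸ hmem' _ h2))
  · obtain ⟨k, hk, hk'⟩ := hi.essSurj (arrMap b n)
    obtain ⟨m, hm, hm'⟩ := hb.isIsofibration.exists_tgt_eq hb'.toIsFunctor hk'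
    exact ⟨m, hmem _ (by rwa [hb'.map_src, hm']), hm⟩

section DependentProduct

variable {Y A B : GpdZ2.{u}} (f : Y ⟶ A) (g : A ⟶ B)

lemma FiberSection.sec_congr {Y A B : Type*} {f : Y → A} {g : A → B} {p q : FiberSection f g}
    (h : p = q) {a b : A} (hab : a = b) (ha : g a = p.base) (hb : g b = q.base) :
    p.sec a ha = q.sec b hb := by
  subst h hab
  rfl

/-- The groupoid of fiber sections is the dependent product along any isofibration, for arbitrary
`f`. Its identification `e` with the arrows of `P` is exported so that discreteness and fiber sizes
can be read off. -/
lemma exists_isDependentProduct (hg : IsIsofibration (arrMap g)) :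
    ∃ (P Q : GpdZ2.{u}) (π : P ⟶ B) (q : Q ⟶ P) (q' : Q ⟶ A) (ev : Q ⟶ Y)
      (e : arr P → PiArrow (arrMap f) (arrMap g)) (e' : PiArrow (arrMap f) (arrMap g) → arr P),
      IsDependentProduct f g π q q' ev ∧
      letI := PiArrow.invGroupoid (isEquivariant_arrMap f) (isEquivariant_arrMap g) hg
      IsEquivariant e ∧ IsEquivariant e' ∧ (∀ x, e' (e x) = x) ∧ (∀ x, e (e' x) = x) ∧
      ∀ x, arrMap π x = (e x).toFiberSection.base := by
  have hf' := isEquivariant_arrMap f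
  have hg' := isEquivariant_arrMap g
  let := PiArrow.invGroupoid hf' hg' hg
  obtain ⟨P, e, e', he, he', h1, h2⟩ := exists_realization (PiArrow (arrMap f) (arrMap g))
  obtain ⟨π, hπ⟩ := exists_hom (φ := fun x => (e x).toFiberSection.base)
    ⟨⟨fun h => FiberSection.Composes.base (he.comp h)⟩, fun x => by rw [he.map_σ]; rfl⟩
  have hQ := IsPullback.of_hasPullback π g
  have hw (z) : arrMap g (arrMap (pullback.snd π g) z) =
      (e (arrMap (pullback.fst π g) z)).toFiberSection.base := by
    rw [← hπ, arrMap_eq hQ.w]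
  have hq := isEquivariant_arrMap (pullback.fst π g)
  have hq' := isEquivariant_arrMap (pullback.snd π g)
  obtain ⟨ev, hev⟩ := exists_hom
    (φ := fun z => (e (arrMap (pullback.fst π g) z)).toFiberSection.sec
      (arrMap (pullback.snd π g) z) (hw z))
    ⟨⟨fun h => FiberSection.Composes.sec (he.comp (hq.comp h)) _ _ _ (hq'.comp h)⟩, fun z => by
      refine (FiberSection.sec_congr (congrArg PiArrow.toFiberSection
        ((congrArg e (hq.map_σ z)).trans (he.map_σ _))) (hq'.map_σ z) _
        (by rw [hg'.map_σ, hw]; rfl)).trans ?_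
      exact congrArg σ (FiberSection.sec_congr rfl (σ_σ _) _ _)⟩
  refine ⟨P, _, π, _, _, ev, e, e', ⟨hQ, hom_ext_arr fun z => ?_, ?_⟩, he, he', h1, h2, hπ⟩
  · rw [arrMap_comp, hev]
    exact FiberSection.map_sec _ _ _
  intro T R t r r' h hR hh
  have ht := isEquivariant_arrMap t
  have hr := isEquivariant_arrMap r
  have hr' := isEquivariant_arrMap r'
  have hh' := isEquivariant_arrMap h
  choose ρ hρ hρ' using fun x a (ha : arrMap g a = arrMap t x) =>
    (existsUnique_of_isPullback hR ha.symm).exists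
  -- The transpose of `h` sends `x` to the section `a ↦ h (x, a)`, where `(x, a)` is the unique
  -- arrow `ρ x a` of the pullback `R`.
  let S (x : arr T) : FiberSection (arrMap f) (arrMap g) :=
    ⟨arrMap t x, fun a ha => arrMap h (ρ x a ha), fun a ha => by
      rw [← arrMap_comp, hh, hρ']⟩
  have hS {x y z : arr T} (H : Comp x y z) : (S x).Composes (S y) (S z) := by
    refine ⟨ht.comp H, fun {a b c} ha hb hc H' => hh'.comp (comp_of_isPullback hR ?_ ?_)⟩
    · rwa [hρ, hρ, hρ]
    · rwa [hρ', hρ', hρ']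
  let k₀ (x : arr T) : PiArrow (arrMap f) (arrMap g) :=
    ⟨S x, ⟨S (src x), hS (comp_src_src x), hS (comp_src x)⟩,
      ⟨S (tgt x), hS (comp_tgt_tgt x), hS (comp_tgt x)⟩⟩
  have hk₀ : IsEquivariant k₀ := ⟨⟨fun H => hS H⟩, fun x =>
    PiArrow.ext (FiberSection.ext' (ht.map_σ x) fun a ha ha' => by
      refine (congrArg (arrMap h) (ext_of_isPullback hR ?_ ?_)).trans (hh'.map_σ _)
      · rw [hρ, hr.map_σ, hρ]
      · rw [hρ', hr'.map_σ, hρ', σ_σ])⟩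
  obtain ⟨k, hk⟩ := exists_hom (φ := fun x => e' (k₀ x))
    ⟨⟨fun H => he'.comp (hk₀.comp H)⟩, fun x => by rw [hk₀.map_σ, he'.map_σ]⟩
  refine ⟨k, ⟨hom_ext_arr fun x => ?_, fun l hl hl' => hom_ext_arr fun z => ?_⟩,
    fun m ⟨hm, hm'⟩ => hom_ext_arr fun x => ?_⟩
  · rw [arrMap_comp, hk, hπ, h2]
  · have e1 : e (arrMap (pullback.fst π g) (arrMap l z)) = k₀ (arrMap r z) := by
      rw [← arrMap_comp, hl, arrMap_comp, hk, h2]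
    have e2 : arrMap (pullback.snd π g) (arrMap l z) = arrMap r' z := by
      rw [← arrMap_comp, hl']
    rw [arrMap_comp, hev]
    exact (FiberSection.sec_congr (congrArg PiArrow.toFiberSection e1) e2 _
      (arrMap_eq hR.w z).symm).trans
      (congrArg (arrMap h) (ext_of_isPullback hR (hρ _ _ _) (hρ' _ _ _)))
  · rw [hk, ← h1 (arrMap m x)]
    congr 1
    have hb : (e (arrMap m x)).toFiberSection.base = arrMap t x := by
      rw [← hπ, ← arrMap_comp, hm]
    refine PiArrow.ext (FiberSection.ext' hb fun a ha ha' => ?_)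
    have hl : (r ≫ m) ≫ π = r' ≫ g := by rw [Category.assoc, hm, hR.w]
    -- The evaluation condition for `m`, taken at the point `(x, a)` of `R`, is the value at `a` of
    -- the section assigned to `x`.
    have := congrArg (fun k => arrMap k (ρ x a ha'))
      (hm' (hQ.lift (r ≫ m) r' hl) (hQ.lift_fst _ _ hl) (hQ.lift_snd _ _ hl))
    rw [arrMap_comp, hev] at this
    refine Eq.trans (FiberSection.sec_congr ?_ ?_ _ _) this
    · rw [← arrMap_comp, hQ.lift_fst, arrMap_comp, hρ]
    · rw [← arrMap_comp, hQ.lift_snd, hρ']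

end DependentProduct

theorem isTypeTheoreticFibrationCategory_fibrations :
    IsTypeTheoreticFibrationCategory fibrations.{u} :=
  isTypeTheoreticFibrationCategory_fibrantObjects (W := injAcyclicCofibrations.{u})
    (fun _ _ _ _ j a b i h hb hi => injAcyclicCofibrations_of_isPullback j a b i h hb hi)
    (fun _ _ f => by
      obtain ⟨Z, i, q, hi, hq, w, -⟩ := exists_factorization f
      exact ⟨Z, i, q, hi, hq, w⟩)
    (fun _ _ _ f g hg => by
      obtain ⟨P, Q, π, q, q', ev, e, e', h, -⟩ :=
        exists_isDependentProduct f g (injFibrations.isIsofibration hg)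
      exact ⟨P, Q, π, q, q', ev, h⟩)

/-! ### Discrete fibrations with small fibers -/

/-- The discrete fibrations with `κ`-small fibers. -/
def smallDiscreteFibrations (κ : Cardinal.{u}) : MorphismProperty GpdZ2.{u} :=
  fun _ _ q => IsDiscreteFibration (arrMap q) ∧ ∀ y, Cardinal.mk {x // arrMap q x = y} < κ

namespace smallDiscreteFibrations

variable {κ : Cardinal.{u}}

lemma le_injFibrations : smallDiscreteFibrations κ ≤ injFibrations := fun _ _ q hq =>
  injFibrations_of_hasAcyclicRLP (hq.1.hasAcyclicRLP (isEquivariant_arrMap q))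

/-- A fiber of a composite embeds in a sum of fibers indexed by a fiber, which is small because `κ`
is regular; identities have fibers of size at most one. -/
lemma isMultiplicative (hκ : κ.IsInaccessible) : (smallDiscreteFibrations κ).IsMultiplicative where
  id_mem X := by
    refine ⟨fun x n hx hn => ⟨n, ⟨hn, rfl⟩, fun m hm => hm.2⟩, fun y => ?_⟩
    have : Subsingleton {x // arrMap (𝟙 X) x = y} := ⟨fun a b => Subtype.ext (a.2.trans b.2.symm)⟩
    exact (Cardinal.mk_le_one_iff_set_subsingleton.2 (Set.subsingleton_coe _ |>.1 this)).trans_lt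
      (Cardinal.one_lt_aleph0.trans hκ.aleph0_lt)
  comp_mem {X Y Z} f g hf hg := by
    have hf' := (isEquivariant_arrMap f).toIsFunctor
    have hg' := (isEquivariant_arrMap g).toIsFunctor
    refine ⟨fun x n hx hn => ?_, fun z => ?_⟩
    · obtain ⟨m, hm, hm'⟩ := (hg.1 (arrMap f x) n (by rw [← hf'.map_src, hx]) hn).exists
      obtain ⟨l, hl, hl'⟩ := (hf.1 x m hx hm).exists
      refine ⟨l, ⟨hl, by rw [arrMap_comp, hl', hm']⟩, fun k ⟨hk, hk'⟩ => ?_⟩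
      refine hf.1.ext hf' (hk.trans hl.symm) (hg.1.ext hg' ?_ ?_)
      · rw [← hf'.map_src, ← hf'.map_src, hk, hl]
      · rw [hl', hm', ← hk', arrMap_comp]
    · have h : Cardinal.mk {x // arrMap (f ≫ g) x = z} ≤
          Cardinal.mk (Σ y : {y // arrMap g y = z}, {x // arrMap f x = y}) :=
        Cardinal.mk_le_of_injective (f := fun x => ⟨⟨arrMap f x.1, x.2⟩, ⟨x.1, rfl⟩⟩)
          fun x x' h => by
            obtain ⟨x, hx⟩ := x
            obtain ⟨x', hx'⟩ := x'
            have h1 : arrMap f x = arrMap f x' := congrArg (fun s => s.1.1) h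
            refine Subtype.ext ?_
            exact congrArg (fun s => s.2.1) h
      refine h.trans_lt ?_
      rw [Cardinal.mk_sigma]
      exact Cardinal.sum_lt_of_isRegular hκ.isRegular (hg.2 z) fun y => hf.2 y

lemma isStableUnderBaseChange : (smallDiscreteFibrations κ).IsStableUnderBaseChange where
  of_isPullback {X Y Y' S f g f' g'} sq hg := by
    have hf₁ := (isEquivariant_arrMap f').toIsFunctor
    have hg₁ := (isEquivariant_arrMap g').toIsFunctor
    refine ⟨fun x n hx hn => ?_, fun y => ?_⟩
    · obtain ⟨m, hm, hm'⟩ := (hg.1 (arrMap f' x) (arrMap f n) (by rw [← hf₁.map_src, hx])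
        (by rw [← (isEquivariant_arrMap f).map_src, hn, arrMap_eq sq.w])).exists
      obtain ⟨l, hl, hl'⟩ := (existsUnique_of_isPullback sq hm').exists
      refine ⟨l, ⟨ext_of_isPullback sq ?_ ?_, hl'⟩, fun k ⟨hk, hk'⟩ =>
        ext_of_isPullback sq (hg.1.ext (isEquivariant_arrMap g).toIsFunctor ?_ ?_)
          (hk'.trans hl'.symm)⟩
      · rw [hf₁.map_src, hl, hm]
      · rw [hg₁.map_src, hl', hn]
      · rw [← hf₁.map_src, hk, hl, hm]
      · rw [hl, hm', arrMap_eq sq.w, hk']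
    · exact (Cardinal.mk_le_of_injective
        (f := fun x : {x // arrMap g' x = y} => (⟨arrMap f' x.1, by
          rw [arrMap_eq sq.w, x.2]⟩ : {x // arrMap g x = arrMap f y}))
        fun x x' h => Subtype.ext (ext_of_isPullback sq (congrArg Subtype.val h)
          (x.2.trans x'.2.symm))).trans_lt (hg.2 (arrMap f y))

/-- Lift `arrMap g n` along `f ≫ g`; unique lifting along `g` shows that `f` sends the result to
`n`. This cancellation trivializes the factorization axiom of a universe. -/
lemma of_postcomp {X Y Z : GpdZ2.{u}} (f : X ⟶ Y) (g : Y ⟶ Z) (hg : smallDiscreteFibrations κ g)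
    (h : smallDiscreteFibrations κ (f ≫ g)) : smallDiscreteFibrations κ f := by
  have hf' := (isEquivariant_arrMap f).toIsFunctor
  have hg' := (isEquivariant_arrMap g).toIsFunctor
  refine ⟨fun x n hx hn => ?_, fun y => ?_⟩
  · obtain ⟨m, ⟨hm, hm'⟩, hu⟩ := h.1 x (arrMap g n) hx (by rw [← hg'.map_src, hn, arrMap_comp])
    refine ⟨m, ⟨hm, hg.1.ext hg' ?_ hm'⟩, fun k ⟨hk, hk'⟩ => hu k ⟨hk, by rw [arrMap_comp, hk']⟩⟩
    rw [← hf'.map_src, hm, hn]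
  · exact (Cardinal.mk_le_of_injective
        (f := fun x : {x // arrMap f x = y} => (⟨x.1, by
          rw [arrMap_comp, x.2]⟩ : {x // arrMap (f ≫ g) x = arrMap g y}))
        fun x x' h => Subtype.ext (congrArg
          (fun s : {x // arrMap (f ≫ g) x = arrMap g y} => s.1) h)).trans_lt (h.2 (arrMap g y))

lemma exists_isDependentProduct (hκ : κ.IsInaccessible) {Y A B : GpdZ2.{u}} (f : Y ⟶ A) (g : A ⟶ B)
    (hf : smallDiscreteFibrations κ f) (hg : smallDiscreteFibrations κ g) :
    ∃ (P Q : GpdZ2.{u}) (π : P ⟶ B) (q : Q ⟶ P) (q' : Q ⟶ A) (ev : Q ⟶ Y),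
      smallDiscreteFibrations κ π ∧ IsDependentProduct f g π q q' ev := by
  obtain ⟨P, Q, π, q, q', ev, e, e', h, he, he', h1, h2, hπ⟩ :=
    TTFC.exists_isDependentProduct f g hg.1.isIsofibration
  refine ⟨P, Q, π, q, q', ev, ⟨fun x n hx hn => ?_, fun b => ?_⟩, h⟩
  · let := PiArrow.invGroupoid (isEquivariant_arrMap f) (isEquivariant_arrMap g)
      hg.1.isIsofibration
    obtain ⟨m, ⟨hm, hm'⟩, hu⟩ := PiArrow.isDiscreteFibration_base
      (isEquivariant_arrMap f).toIsFunctor (isEquivariant_arrMap g).toIsFunctor hf.1 hg.1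
      (e x) n (by rw [← he.map_src, hx]) (by rw [hn, hπ])
    refine ⟨e' m, ⟨?_, by rw [hπ, h2]; exact hm'⟩, fun k ⟨hk, hk'⟩ => ?_⟩
    · rw [← he'.map_src, hm, h1]
    · rw [← hu (e k) ⟨by rw [← he.map_src, hk], by rw [← hk', hπ]⟩, h1]
  · have hs : Cardinal.mk (Σ a : {a // arrMap g a = b}, {y // arrMap f y = a}) < κ := by
      rw [Cardinal.mk_sigma]
      exact Cardinal.sum_lt_of_isRegular hκ.isRegular (hg.2 b) fun a => hf.2 a
    -- A section over `b` is recovered from its graph, a subset of the sum of the fibers of `f` over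
    -- the fiber of `g`. That sum is smaller than `κ` by regularity, and so is its power set since
    -- `κ` is a strong limit.
    refine lt_of_le_of_lt (Cardinal.mk_le_of_injective
      (β := Set (Σ a : {a // arrMap g a = b}, {y // arrMap f y = a}))
      (f := fun x => {s | ∃ h, s.2.1 = (e x.1).toFiberSection.sec s.1.1 h}) fun x x' hxx => ?_) ?_
    · have hb : (e x.1).toFiberSection.base = b := by rw [← hπ, x.2]
      have hb' : (e x'.1).toFiberSection.base = b := by rw [← hπ, x'.2]
      refine Subtype.ext ?_
      rw [← h1 x.1, ← h1 x'.1]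
      congr 1
      refine PiArrow.ext (FiberSection.ext' (hb.trans hb'.symm) fun a ha ha' => ?_)
      have hmem : (⟨⟨a, ha.trans hb⟩, ⟨(e x.1).toFiberSection.sec a ha,
          (e x.1).toFiberSection.map_sec a ha⟩⟩ :
          Σ a : {a // arrMap g a = b}, {y // arrMap f y = a}) ∈
          {s | ∃ h, s.2.1 = (e x.1).toFiberSection.sec s.1.1 h} := ⟨ha, rfl⟩
      exact ((Set.ext_iff.1 hxx _).1 hmem).2
    · rw [Cardinal.mk_set]
      exact hκ.isStrongLimit.isStrongPrelimit hs

end smallDiscreteFibrations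

/-! ### The classification of small discrete fibrations -/

section Fiber

variable {X Y : Type u} [InvGroupoid X] [InvGroupoid Y] {q : X → Y}

/-- The transport between the fibers of a discrete fibration along an arrow. -/
lemma IsDiscreteFibration.exists_transport (hq : IsDiscreteFibration q) (hq' : IsFunctor q) (y : Y)
    {d c : Y} (hd : src y = d) (hc : tgt y = c) :
    ∃ T : {x // q x = d} ≃ {x // q x = c}, ∀ a, ∃ m, q m = y ∧ src m = a.1 ∧ tgt m = (T a).1 := by
  have h (a : {x // q x = d}) : ∃ m, q m = y ∧ src m = a.1 := by
    have ha := hq.src_eq_self hq' (x := a.1) (by rw [a.2, ← hd, src_src])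
    obtain ⟨m, hm, hm'⟩ := (hq a.1 y ha (by rw [a.2, hd])).exists
    exact ⟨m, hm', hm⟩
  choose m hm hm' using h
  let f (a : {x // q x = d}) : {x // q x = c} := ⟨tgt (m a), by rw [hq'.map_tgt, hm, hc]⟩
  have hf : Function.Bijective f := by
    refine ⟨fun a b hab => Subtype.ext ?_, fun b => ?_⟩
    · have : tgt (m a) = tgt (m b) := congrArg Subtype.val hab
      rw [← hm', ← hm', hq.ext_tgt hq' this (by rw [hm, hm])]
    · obtain ⟨n, hn, hn'⟩ := hq.isIsofibration.exists_tgt_eq hq' (a := b.1) (b := y)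
        (by rw [b.2, ← hc, src_tgt])
      rw [hq.src_eq_self hq' (x := b.1) (by rw [b.2, ← hc, src_tgt])] at hn
      refine ⟨⟨src n, by rw [hq'.map_src, hn', hd]⟩, Subtype.ext ?_⟩
      rw [← hn]
      exact congrArg tgt (hq.ext hq' (hm' _) (by rw [hm, hn']))
  exact ⟨Equiv.ofBijective f hf, fun a => ⟨m a, hm a, hm' a, rfl⟩⟩

/-- The transport between the fibers of a discrete fibration along an arrow. -/
noncomputable def IsDiscreteFibration.transport (hq : IsDiscreteFibration q) (hq' : IsFunctor q)
    (y : Y) {d c : Y} (hd : src y = d) (hc : tgt y = c) : {x // q x = d} ≃ {x // q x = c} :=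
  (hq.exists_transport hq' y hd hc).choose

lemma IsDiscreteFibration.transport_eq (hq : IsDiscreteFibration q) (hq' : IsFunctor q)
    {y : Y} {d c : Y} (hd : src y = d) (hc : tgt y = c) {m : X} (hm : q m = y) {a : {x // q x = d}}
    (ha : src m = a.1) : (hq.transport hq' y hd hc a).1 = tgt m := by
  obtain ⟨n, h1, h2, h3⟩ := (hq.exists_transport hq' y hd hc).choose_spec a
  rw [transport, ← h3, hq.ext hq' (h2.trans ha.symm) (h1.trans hm.symm)]

lemma IsDiscreteFibration.exists_transport_eq (hq : IsDiscreteFibration q) (hq' : IsFunctor q)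
    {y : Y} {d c : Y} (hd : src y = d) (hc : tgt y = c) (a : {x // q x = d}) :
    ∃ m, q m = y ∧ src m = a.1 ∧ tgt m = (hq.transport hq' y hd hc a).1 :=
  (hq.exists_transport hq' y hd hc).choose_spec a

lemma IsDiscreteFibration.transport_comp (hq : IsDiscreteFibration q) (hq' : IsFunctor q)
    {x y z : Y} (H : Comp x y z) {a b c : Y} (hx : src x = a) (hx' : tgt x = b) (hy : src y = b)
    (hy' : tgt y = c) (hz : src z = a) (hz' : tgt z = c) (s : {x // q x = a}) :
    hq.transport hq' y hy hy' (hq.transport hq' x hx hx' s) = hq.transport hq' z hz hz' s := by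
  obtain ⟨m, h1, h2, h3⟩ := hq.exists_transport_eq hq' hx hx' s
  obtain ⟨n, h4, h5, h6⟩ := hq.exists_transport_eq hq' hy hy' (hq.transport hq' x hx hx' s)
  have h : tgt m = src n := h3.trans h5.symm
  refine Subtype.ext (h6.symm.trans ?_)
  rw [hq.transport_eq hq' hz hz' (m := m ⊙ n)
    (by rw [hq'.map_mul h, h1, h4]; exact (comp_iff.1 H).2) (by rw [src_mul h, h2]), tgt_mul h]

/-- The action of the involution on the fibers. -/
def fiberσ (hq : IsEquivariant q) {d d' : Y} (h : σ d = d') : {x // q x = d} ≃ {x // q x = d'} where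
  toFun x := ⟨σ x.1, by rw [hq.map_σ, x.2, h]⟩
  invFun x := ⟨σ x.1, by rw [hq.map_σ, x.2, ← h, σ_σ]⟩
  left_inv x := Subtype.ext (σ_σ _)
  right_inv x := Subtype.ext (σ_σ _)

lemma IsDiscreteFibration.transport_fiberσ (hq : IsDiscreteFibration q) (hq' : IsEquivariant q)
    {y y' d d' c c' : Y} (hd : src y = d) (hc : tgt y = c) (hy : σ y = y') (hd' : σ d = d')
    (hc' : σ c = c') (hd₁ : src y' = d') (hc₁ : tgt y' = c') (s : {x // q x = d}) :
    hq.transport hq'.toIsFunctor y' hd₁ hc₁ (fiberσ hq' hd' s) =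
      fiberσ hq' hc' (hq.transport hq'.toIsFunctor y hd hc s) := by
  obtain ⟨m, h1, h2, h3⟩ := hq.exists_transport_eq hq'.toIsFunctor hd hc s
  refine Subtype.ext ((hq.transport_eq hq'.toIsFunctor hd₁ hc₁ (m := σ m)
    (by rw [hq'.map_σ, h1, hy]) ?_).trans ?_)
  · rw [← σ_src, h2]
    rfl
  · rw [← σ_tgt, h3]
    rfl

end Fiber

/-! ### The classifying square of a small discrete fibration -/

section Classification

variable {κ : Cardinal.{u}}

/-- The arrow of `Ũ` given by an arrow of `U` and an element. -/
def liftArrow {X Y : U κ} (h : U.Hom X Y) (a : X.A.El) : arr (UTildeObj κ) :=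
  ⟨(⟨X, a⟩ : UTilde κ), (⟨Y, h.ρ a⟩ : UTilde κ), (⟨h, rfl⟩ : UTilde.Hom _ _)⟩

/-- An arrow of `U`. -/
def arrow {X Y : U κ} (h : U.Hom X Y) : arr (UObj κ) := ⟨X, Y, h⟩

lemma arrMap_p_liftArrow {X Y : U κ} (h : U.Hom X Y) (a : X.A.El) :
    arrMap (p κ) (liftArrow h a) = arrow h := rfl

/-- The endpoint of an arrow of `Ũ` is forced by its starting point, so such an arrow amounts to an
arrow of `U` with an element of its source. -/
lemma exists_eq_liftArrow (z : arr (UTildeObj κ)) :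
    ∃ (X Y : U κ) (h : U.Hom X Y) (a : X.A.El), z = liftArrow h a := by
  obtain ⟨⟨X, a⟩, ⟨Y, b⟩, ⟨h, e⟩⟩ := z
  have key (X Y : U κ) (h : U.Hom X Y) (a b) (e : h.ρ a = b) :
      (⟨(⟨X, a⟩ : UTilde κ), (⟨Y, b⟩ : UTilde κ), (⟨h, e⟩ : UTilde.Hom _ _)⟩ :
        arr (UTildeObj κ)) = liftArrow h a := by
    subst e
    rfl
  exact ⟨X, Y, h, a, key X Y h a b e⟩

lemma liftArrow_injective {X Y : U κ} {h : U.Hom X Y} {a b : X.A.El}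
    (e : liftArrow h a = liftArrow h b) : a = b := by
  have : (⟨X, a⟩ : UTilde κ) = ⟨X, b⟩ := congrArg Arr.dom e
  simpa using this

lemma src_arrow {X Y : U κ} (h : U.Hom X Y) : src (arrow h) = arrow (𝟙 X : X ⟶ X) :=
  Arr.src_eq (C := U κ) ⟨X, Y, h⟩

lemma src_liftArrow {X Y : U κ} (h : U.Hom X Y) (a : X.A.El) :
    src (liftArrow h a) = liftArrow (𝟙 X : X ⟶ X) a :=
  Arr.src_eq (C := UTilde κ) (liftArrow h a)

variable (κ) in
-- The fiber of `p` over an arrow out of `(A, B, φ)` is a copy of `A`, and the lift from `a` is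
-- forced to be `liftArrow k a`.
lemma smallDiscreteFibrations_p : smallDiscreteFibrations κ (p κ) := by
  refine ⟨fun x n hx hn => ?_, fun y => ?_⟩
  · obtain ⟨X, X', h, a, rfl⟩ := exists_eq_liftArrow x
    rw [src_liftArrow] at hx
    rw [← hx] at hn ⊢
    clear hx
    obtain ⟨Y, Y', k⟩ := n
    obtain rfl : Y = X := congrArg Arr.dom ((src_arrow k).symm.trans hn)
    refine ⟨liftArrow k a, ⟨src_liftArrow _ _, rfl⟩, fun m ⟨hm, hm'⟩ => ?_⟩
    obtain ⟨Z, Z', l, b, rfl⟩ := exists_eq_liftArrow m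
    obtain rfl : Z = Y := congrArg Arr.dom hm'
    obtain rfl : Z' = Y' := congrArg Arr.cod hm'
    obtain rfl : l = k := Arr.mk_inj (C := U κ) hm'
    rw [src_liftArrow] at hm
    rw [liftArrow_injective hm]
  · obtain ⟨X, Y, h⟩ := y
    refine lt_of_le_of_lt (Cardinal.mk_le_of_surjective
      (f := fun a : X.A.El => (⟨liftArrow h a, rfl⟩ : {x // arrMap (p κ) x = ⟨X, Y, h⟩})) ?_) X.A.2
    rintro ⟨z, hz⟩
    obtain ⟨Z, Z', l, b, rfl⟩ := exists_eq_liftArrow z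
    cases hz
    exact ⟨b, rfl⟩

variable {X Y : GpdZ2.{u}} {q : X ⟶ Y} (hq : IsDiscreteFibration (arrMap q))
  (A : arr Y → SmallSet κ) (c : ∀ y, (A y).El ≃ {x // arrMap q x = y})

/-- The object of `U` classifying the fibers over `d` and `σ d`. -/
def codeObj {d d' : arr Y} (h : σ d = d') : U κ :=
  ⟨A d, A d', (c d).trans ((fiberσ (isEquivariant_arrMap q) h).trans (c d').symm)⟩

/-- The morphism of `U` classifying the transport between fibers. -/
noncomputable def codeHom {d d' e e' y y' : arr Y} (hd : σ d = d') (he : σ e = e') (hy : σ y = y')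
    (h1 : src y = d) (h2 : tgt y = e) (h3 : src y' = d') (h4 : tgt y' = e') :
    U.Hom (codeObj A c hd) (codeObj A c he) where
  ρ := (c d).trans ((hq.transport (isEquivariant_arrMap q).toIsFunctor y h1 h2).trans (c e).symm)
  τ := (c d').trans ((hq.transport (isEquivariant_arrMap q).toIsFunctor y' h3 h4).trans (c e').symm)
  comm x := by
    change (c e').symm (fiberσ _ he (c e ((c e).symm (hq.transport _ y h1 h2 (c d x))))) =
      (c e').symm (hq.transport _ y' h3 h4 (c d' ((c d').symm (fiberσ _ hd (c d x)))))
    rw [Equiv.apply_symm_apply, Equiv.apply_symm_apply,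
      hq.transport_fiberσ (isEquivariant_arrMap q) h1 h2 hy hd he h3 h4]

lemma codeHom_comp {d d' e e' f f' x x' y y' z z' : arr Y} (hd : σ d = d') (he : σ e = e')
    (hf : σ f = f') (hx : σ x = x') (hy : σ y = y') (hz : σ z = z')
    (h1 : src x = d) (h2 : tgt x = e) (h3 : src x' = d') (h4 : tgt x' = e')
    (k1 : src y = e) (k2 : tgt y = f) (k3 : src y' = e') (k4 : tgt y' = f')
    (l1 : src z = d) (l2 : tgt z = f) (l3 : src z' = d') (l4 : tgt z' = f') (H : Comp x y z) :
    (show codeObj A c hd ⟶ codeObj A c he from codeHom hq A c hd he hx h1 h2 h3 h4) ≫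
      (show codeObj A c he ⟶ codeObj A c hf from codeHom hq A c he hf hy k1 k2 k3 k4) =
      codeHom hq A c hd hf hz l1 l2 l3 l4 := by
  refine U.Hom.ext (Equiv.ext fun s => ?_) (Equiv.ext fun s => ?_)
  · change (c f).symm (hq.transport _ y k1 k2 (c e ((c e).symm (hq.transport _ x h1 h2 (c d s))))) =
      (c f).symm (hq.transport _ z l1 l2 (c d s))
    rw [Equiv.apply_symm_apply, hq.transport_comp _ H]
  · change (c f').symm (hq.transport _ y' k3 k4
      (c e' ((c e').symm (hq.transport _ x' h3 h4 (c d' s))))) =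
      (c f').symm (hq.transport _ z' l3 l4 (c d' s))
    rw [Equiv.apply_symm_apply, hq.transport_comp _ (hx ▸ hy ▸ hz ▸ comp_σ H)]

lemma comp_liftArrow {X Y Z : U κ} {h : U.Hom X Y} {k : U.Hom Y Z} {l : U.Hom X Z} {a : X.A.El}
    {b : Y.A.El} (hb : h.ρ a = b) (hl : (show X ⟶ Y from h) ≫ (show Y ⟶ Z from k) = l) :
    Comp (liftArrow h a) (liftArrow k b) (liftArrow l a) := by
  subst hb hl
  exact Arr.Composes.mk (C := UTilde κ) (x := ⟨X, a⟩) (y := ⟨Y, h.ρ a⟩) (z := ⟨Z, k.ρ (h.ρ a)⟩)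
    (⟨h, rfl⟩ : UTilde.Hom _ _) (⟨k, rfl⟩ : UTilde.Hom _ _)

lemma σ_liftArrow {X Y : U κ} (h : U.Hom X Y) (a : X.A.El) :
    σ (liftArrow h a) = liftArrow ((υ κ).map h) (X.φ a) := by
  have key (b) (e : ((υ κ).map h : U.Hom _ _).ρ (X.φ a) = b) :
      (⟨(⟨(υ κ).obj X, X.φ a⟩ : UTilde κ), (⟨(υ κ).obj Y, b⟩ : UTilde κ),
        (⟨(υ κ).map h, e⟩ : UTilde.Hom _ _)⟩ : arr (UTildeObj κ)) =
      liftArrow ((υ κ).map h) (X.φ a) := by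
    subst e
    rfl
  exact key (Y.φ (h.ρ a)) (h.comm a).symm

/-- The arrow of `U` classifying the fiber over an arrow. -/
noncomputable def code (y : arr Y) : arr (UObj κ) :=
  arrow (codeHom hq A c (y := y) rfl rfl rfl rfl rfl (σ_src y).symm (σ_tgt y).symm)

/-- The arrow of `Ũ` corresponding to an arrow of the total space. -/
noncomputable def codeLift (x : arr X) : arr (UTildeObj κ) :=
  liftArrow (codeHom hq A c (y := arrMap q x) rfl rfl rfl rfl rfl (σ_src _).symm (σ_tgt _).symm)
    ((c _).symm ⟨src x, (isEquivariant_arrMap q).map_src x⟩)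

section

variable {d d' e e' y y' : arr Y} (hd : σ d = d') (he : σ e = e') (hy : σ y = y')
    (h1 : src y = d) (h2 : tgt y = e) (h3 : src y' = d') (h4 : tgt y' = e')

/-- Free endpoints with equations let codes be compared when objects agree only propositionally,
such as `tgt x` with `src y`, or `σ (σ d)` with `d`. -/
lemma code_eq : code hq A c y = arrow (codeHom hq A c hd he hy h1 h2 h3 h4) := by
  subst h1 h2 hd he hy
  rfl

lemma codeLift_eq {x : arr X} (hx : arrMap q x = y) {s : {x // arrMap q x = d}} (hs : s.1 = src x) :
    codeLift hq A c x = liftArrow (codeHom hq A c hd he hy h1 h2 h3 h4) ((c d).symm s) := by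
  subst hx h1 h2 hd he hy
  obtain ⟨s, hs'⟩ := s
  subst hs
  rfl

end

/-- The code at `d` uses the sets chosen at `d` and `σ d`, so the code at `σ d` is exactly its swap,
with no compatibility required of the choices `A` and `c`. Functoriality is that of transport. -/
lemma isEquivariant_code : IsEquivariant (code hq A c) where
  comp {x y z} H := by
    have h := tgt_eq_src H
    have h' : src (σ y) = σ (tgt x) := by rw [h, σ_src]
    rw [code_eq hq A c (y := y) rfl rfl rfl h.symm rfl h' (σ_tgt y).symm,
      code_eq hq A c (y := z) rfl rfl rfl (src_eq_of_comp H) (tgt_eq_of_comp H)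
        (by rw [← σ_src, src_eq_of_comp H]) (by rw [← σ_tgt, tgt_eq_of_comp H])]
    exact Arr.composes_mk (C := U κ) (codeHom_comp hq A c _ _ _ _ _ _ _ _ _ _ _ _ _ _ _ _ _ _ H)
  map_σ y := by
    rw [code_eq hq A c (y := σ y) (σ_σ (src y)) (σ_σ (tgt y)) (σ_σ y) (σ_src y).symm (σ_tgt y).symm
      rfl rfl, code]
    rfl

lemma isEquivariant_codeLift : IsEquivariant (codeLift hq A c) where
  comp {x y z} H := by
    have hq' := isEquivariant_arrMap q
    have H' := hq'.comp H
    have h := tgt_eq_src H'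
    have h' : src (σ (arrMap q y)) = σ (tgt (arrMap q x)) := by rw [h, σ_src]
    have e := hq.transport_eq hq'.toIsFunctor rfl rfl (m := x) rfl (a := ⟨src x, hq'.map_src x⟩) rfl
    rw [codeLift_eq hq A c (x := y) rfl rfl rfl h.symm rfl h' (σ_tgt _).symm rfl
        (e.trans (tgt_eq_src H)),
      codeLift_eq hq A c (x := z) rfl rfl rfl (src_eq_of_comp H') (tgt_eq_of_comp H')
        (by rw [← σ_src, src_eq_of_comp H']) (by rw [← σ_tgt, tgt_eq_of_comp H']) rfl
        (s := ⟨src x, hq'.map_src x⟩) (src_eq_of_comp H).symm]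
    refine comp_liftArrow ?_ (codeHom_comp hq A c _ _ _ _ _ _ _ _ _ _ _ _ _ _ _ _ _ _ H')
    change (c _).symm (hq.transport _ _ _ _ (c _ ((c _).symm _))) = _
    rw [Equiv.apply_symm_apply]
  map_σ x := by
    have hq' := isEquivariant_arrMap q
    rw [codeLift_eq hq A c (x := σ x) (σ_σ (src (arrMap q x))) (σ_σ (tgt (arrMap q x)))
      (σ_σ (arrMap q x)) (σ_src _).symm (σ_tgt _).symm rfl rfl (hq'.map_σ x)
      (s := fiberσ hq' rfl ⟨src x, hq'.map_src x⟩) (σ_src x), codeLift]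
    refine Eq.trans ?_ (σ_liftArrow (codeHom hq A c (y := arrMap q x) rfl rfl rfl rfl rfl
      (σ_src _).symm (σ_tgt _).symm) ((c _).symm ⟨src x, hq'.map_src x⟩)).symm
    have key (s) : (c (σ (src (arrMap q x)))).symm (fiberσ hq' rfl s) =
        (codeObj A c rfl).φ ((c _).symm s) := by
      change _ = (c _).symm (fiberσ _ _ (c _ ((c _).symm _)))
      rw [Equiv.apply_symm_apply]
    exact congrArg (liftArrow (codeHom hq A c (σ_σ (src (arrMap q x))) (σ_σ (tgt (arrMap q x)))
      (σ_σ (arrMap q x)) (σ_src _).symm (σ_tgt _).symm rfl rfl)) (key _)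

include hq in
-- An arrow of `Ũ` over the code of `y` is an element of the chosen copy of the fiber over `src y`;
-- by discreteness it corresponds to the unique arrow over `y` starting at that element.
lemma exists_isPullback_p (A : arr Y → SmallSet κ) (c : ∀ y, (A y).El ≃ {x // arrMap q x = y}) :
    ∃ (a : X ⟶ UTildeObj κ) (b : Y ⟶ UObj κ), IsPullback a q (p κ) b := by
  have hq' := isEquivariant_arrMap q
  obtain ⟨a, ha⟩ := exists_hom (isEquivariant_codeLift hq A c)
  obtain ⟨b, hb⟩ := exists_hom (isEquivariant_code hq A c)
  refine ⟨a, b, isPullback_of_existsUnique (hom_ext_arr fun x => ?_) fun z y h => ?_⟩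
  · rw [arrMap_comp, arrMap_comp, ha, hb]
    rfl
  · rw [hb] at h
    obtain ⟨Z, Z', k, s, rfl⟩ := exists_eq_liftArrow z
    rw [arrMap_p_liftArrow] at h
    obtain rfl : Z = _ := congrArg Arr.dom h
    obtain rfl : Z' = _ := congrArg Arr.cod h
    obtain rfl := Arr.mk_inj (C := U κ) h
    have key (x) (hx : arrMap q x = y) : arrMap a x = liftArrow (codeHom hq A c (y := y) rfl rfl rfl
        rfl rfl (σ_src y).symm (σ_tgt y).symm) ((c (src y)).symm
          ⟨src x, by rw [hq'.map_src, hx]⟩) := by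
      subst hx
      exact ha x
    obtain ⟨m, h1, h2, -⟩ := hq.exists_transport_eq hq'.toIsFunctor (y := y) rfl rfl (c (src y) s)
    refine ⟨m, ⟨(key m h1).trans (congrArg _ ?_), h1⟩, fun n ⟨hn, hn'⟩ => ?_⟩
    · exact (Equiv.symm_apply_eq (c (src y))).2 (Subtype.ext h2)
    · refine hq.ext hq'.toIsFunctor ?_ (hn'.trans h1.symm)
      rw [key n hn'] at hn
      have := (Equiv.symm_apply_eq (c (src y))).1 (liftArrow_injective hn)
      rw [h2, ← this]

lemma smallDiscreteFibrations.exists_isPullback (hq : smallDiscreteFibrations κ q) :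
    ∃ (a : X ⟶ UTildeObj κ) (b : Y ⟶ UObj κ), IsPullback a q (p κ) b := by
  choose A c using fun y => SmallSet.exists_equiv _ (hq.2 y)
  exact exists_isPullback_p hq.1 A fun y => (c y).some

end Classification

/-! ### The fibrancy of `U` and `Ũ` -/

variable {κ : Cardinal.{u}}

/-- The groupoid of `κ`-small sets. -/
instance : Groupoid.{u} (SmallSet κ) where
  Hom X Y := X.El ≃ Y.El
  id _ := Equiv.refl _
  comp f g := f.trans g
  inv f := f.symm
  id_comp _ := rfl
  comp_id _ := rfl
  assoc _ _ _ := rfl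
  inv_comp f := f.symm_trans_self
  comp_inv f := f.self_trans_symm

variable (κ) in
/-- The projection `(A, B, φ) ↦ A`. -/
def fstFunctor : U κ ⥤ SmallSet κ where
  obj X := X.A
  map f := U.Hom.ρ f
  map_id _ := rfl
  map_comp _ _ := rfl

/-- The projection `(A, B, φ) ↦ A`, on arrows. -/
def fstArrow (x : arr (UObj κ)) : Arr (SmallSet κ) := Arr.map (fstFunctor κ) x

lemma isFunctor_fstArrow : IsFunctor (fstArrow (κ := κ)) := Arr.isFunctor_map (fstFunctor κ)

lemma arrow_congr {X : U κ} {C D : SmallSet κ} {ψ ψ' : C.El ≃ D.El} (hψ : ψ = ψ')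
    {ρ : X.A.El ≃ C.El} {τ : X.B.El ≃ D.El} (h : ∀ x, ψ (ρ x) = τ (X.φ x))
    (h' : ∀ x, ψ' (ρ x) = τ (X.φ x)) :
    arrow (⟨ρ, τ, h⟩ : U.Hom X ⟨C, D, ψ⟩) = arrow (⟨ρ, τ, h'⟩ : U.Hom X ⟨C, D, ψ'⟩) := by
  subst hψ
  rfl

variable (κ) in
-- Forgetting `φ` is a discrete fibration to pairs of small sets: along `(ρ, τ)` the bijection `φ`
-- is carried to `τ φ ρ⁻¹` and to nothing else. The involution swaps the pair, so
-- `hasAcyclicRLP_of_discrete` applies over the terminal object with `e` the first projection.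
lemma injFibrant_U : injFibrant (UObj κ) := by
  obtain ⟨T, hT, hT'⟩ := exists_isTerminal.{u}
  refine ⟨T, hT, injFibrations_of_hasAcyclicRLP (hasAcyclicRLP_of_discrete
    (isEquivariant_arrMap _) isFunctor_fstArrow ?_)⟩
  rintro ⟨X, X', h⟩ ⟨t, ⟨A, A', ρ⟩, ⟨B, B', τ⟩⟩ hx hn
  obtain rfl : X = X' := congrArg Arr.cod ((src_arrow h).symm.trans hx)
  rw [src_prod, src_prod] at hn
  obtain ⟨-, hn⟩ := Prod.mk.inj hn
  obtain ⟨h1, h2⟩ := Prod.mk.inj hn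
  rw [Arr.src_eq] at h1 h2
  obtain rfl : A = X.A := congrArg Arr.dom h1
  obtain rfl : B = X.B := congrArg Arr.dom h2
  clear h1 h2 hn
  refine ⟨arrow (X := X) (Y := ⟨A', B', (ρ.symm.trans X.φ).trans τ⟩)
    ⟨ρ, τ, fun x => congrArg (fun s => (show X.B.El ≃ B'.El from τ) (X.φ s))
      (ρ.symm_apply_apply x)⟩,
    ⟨(src_arrow _).trans ((src_arrow h).symm.trans hx), Prod.ext (hT'.elim _ _) rfl⟩, ?_⟩
  rintro ⟨Y, Y', ⟨ρ', τ', e⟩⟩ ⟨hm, hm'⟩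
  obtain rfl : Y = X := congrArg Arr.dom ((src_arrow (X := Y) _).symm.trans hm)
  obtain ⟨-, hm'⟩ := Prod.mk.inj hm'
  obtain ⟨h1, h2⟩ := Prod.mk.inj hm'
  obtain ⟨A₁, B₁, ψ⟩ := Y'
  obtain rfl : A₁ = A' := congrArg Arr.cod h1
  obtain rfl : B₁ = B' := congrArg Arr.cod h2
  obtain rfl : ρ' = ρ := Arr.mk_inj (C := SmallSet κ) h1
  obtain rfl : τ' = τ := Arr.mk_inj (C := SmallSet κ) h2
  refine arrow_congr (Equiv.ext fun x => ?_) _ _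
  have := e (ρ'.symm x)
  rw [Equiv.apply_symm_apply] at this
  exact this

variable (κ) in
lemma injFibrant_UTilde : injFibrant (UTildeObj κ) :=
  fibrantObjects_of_rlp (W := injAcyclicCofibrations)
    (smallDiscreteFibrations.le_injFibrations _ (smallDiscreteFibrations_p κ)) (injFibrant_U κ)

end TTFC

theorem mainTheorem2 (κ : Cardinal.{u}) (hκ : κ.IsInaccessible) :
    TTFC.IsTypeTheoreticFibrationCategory TTFC.fibrations.{u} ∧
    ∃ (hE : TTFC.injFibrant (TTFC.UTildeObj κ)) (hU : TTFC.injFibrant (TTFC.UObj κ)),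
      TTFC.IsUniverse TTFC.fibrations.{u}
        (ObjectProperty.homMk (TTFC.p κ) :
          (⟨TTFC.UTildeObj κ, hE⟩ : TTFC.GpdZ2f.{u}) ⟶ ⟨TTFC.UObj κ, hU⟩) := by
  have := TTFC.smallDiscreteFibrations.isMultiplicative hκ
  have := TTFC.smallDiscreteFibrations.isStableUnderBaseChange (κ := κ)
  exact ⟨TTFC.isTypeTheoreticFibrationCategory_fibrations, TTFC.injFibrant_UTilde κ,
    TTFC.injFibrant_U κ, TTFC.isUniverse_fibrantObjects (W := TTFC.injAcyclicCofibrations.{u}) _ _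
      (TTFC.smallDiscreteFibrations κ) TTFC.smallDiscreteFibrations.le_injFibrations
      (TTFC.smallDiscreteFibrations_p κ)
      (fun _ _ _ hq => TTFC.smallDiscreteFibrations.exists_isPullback hq)
      (fun _ _ _ => TTFC.smallDiscreteFibrations.of_postcomp)
      (fun _ _ _ => TTFC.smallDiscreteFibrations.exists_isDependentProduct hκ)⟩
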